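/- Let $d\ge 0$ and $m,p\ge 0$ be integers. For $i=1,\dots,d$ let $n_i\ge 1$, let $A_i\in\mathbb C^{n_i\times n_i}$, and let $\Omega_i\subset\mathbb C$ be a bounded convex domain whose boundary is a continuously differentiable regular simple closed curve, traversed counterclockwise (in particular, any smooth bounded convex domain is allowed), such that the numerical range $W(A_i)=\{v^*A_iv:\ v\in\mathbb C^{n_i},\ \|v\|_2=1\}$ is contained in $\Omega_i$. Let $F(x_1,\dots,x_d)\in\mathbb C^{m\times p}$ be a matrix-valued function that is (entrywise) analytic on $\Omega_1\times\cdots\times\Omega_d$ and continuous on $\overline{\Omega}_1\times\cdots\times\overline{\Omega}_d$. Define recursively $$F\{A_1,\dots,A_d\}=\frac{1}{2\pi\mathrm i}\oint_{\partial\Omega_1}F_{x_1}\{A_2,\dots,A_d\}\otimes(x_1I-A_1)^{-1}\,\mathrm dx_1,\qquad F_{x_1}(x_2,\dots,x_d):=F(x_1,x_2,\dots,x_d),$$ where $\otimes$ is the Kronecker product and, for $d=0$, $F\{\}$ is the constant matrix $F()$. Then the maximum $\|F\|_{W(A_1)\times\cdots\times W(A_d)}$ of the spectral norm $\|F(x)\|_2$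 over $x\in W(A_1)\times\cdots\times W(A_d)$ exists, and $$\|F\{A_1,\dots,A_d\}\|_2\le(1+\sqrt2)^d\,\|F\|_{W(A_1)\times\cdots\times W(A_d)}.$$ -/

import Mathlib

open scoped Kronecker Matrix.Norms.L2Operator

noncomputable section

/-- The numerical range `W(A) = {v* A v : ‖v‖₂ = 1}` of a square complex matrix. -/
def numericalRange {n : ℕ} (A : Matrix (Fin n) (Fin n) ℂ) : Set ℂ :=
  {z | ∃ v : EuclideanSpace ℂ (Fin n), ‖v‖ = 1 ∧ z = star v.ofLp ⬝ᵥ A.mulVec v.ofLp}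

/-- `Ω` is a bounded convex domain with `C¹` boundary, and `γ` is a regular parametrization of
the closed curve `∂Ω` with period `1` that traverses `∂Ω` once, counterclockwise
(i.e. with winding number `1` about every point of `Ω`). -/
structure IsConvexDomainWithBoundary (Ω : Set ℂ) (γ : ℝ → ℂ) : Prop where
  isOpen : IsOpen Ω
  nonempty : Ω.Nonempty
  convex : Convex ℝ Ω
  isBounded : Bornology.IsBounded Ω
  contDiff : ContDiff ℝ 1 γ
  periodic : Function.Periodic γ 1
  deriv_ne_zero : ∀ t, deriv γ t ≠ 0
  injOn : Set.InjOn γ (Set.Ico 0 1)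
  image_eq : γ '' Set.Ico 0 1 = frontier Ω
  winding : ∀ w ∈ Ω,
    (2 * Real.pi * Complex.I : ℂ)⁻¹ * ∫ t in (0 : ℝ)..1, (γ t - w)⁻¹ * deriv γ t = 1

/-- The contour integral `∮ G(z) dz` (entry by entry) of a matrix-valued function along the
closed curve `γ : [0, 1] → ℂ`. -/
def matrixContourIntegral {α β : Type} (γ : ℝ → ℂ) (G : ℂ → Matrix α β ℂ) : Matrix α β ℂ :=
  Matrix.of fun i j => ∫ t in (0 : ℝ)..1, G (γ t) i j * deriv γ t

/-- The index type of a Kronecker product `((Fin k × Fin n_d) × ⋯) × Fin n_1`. -/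
def KronIndex : (d : ℕ) → (k : ℕ) → (n : Fin d → ℕ) → Type
  | 0, k, _ => Fin k
  | d + 1, k, n => KronIndex d k (fun i => n i.succ) × Fin (n 0)

instance KronIndex.instFintype : (d k : ℕ) → (n : Fin d → ℕ) → Fintype (KronIndex d k n)
  | 0, k, _ => inferInstanceAs (Fintype (Fin k))
  | d + 1, k, n =>
    haveI := KronIndex.instFintype d k (fun i => n i.succ)
    inferInstanceAs (Fintype (KronIndex d k (fun i => n i.succ) × Fin (n 0)))

instance KronIndex.instDecidableEq : (d k : ℕ) → (n : Fin d → ℕ) → DecidableEq (KronIndex d k n)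
  | 0, k, _ => inferInstanceAs (DecidableEq (Fin k))
  | d + 1, k, n =>
    haveI := KronIndex.instDecidableEq d k (fun i => n i.succ)
    inferInstanceAs (DecidableEq (KronIndex d k (fun i => n i.succ) × Fin (n 0)))

/-- The multivariate matrix function `F{A₁, …, A_d}`, defined by recursion on `d`:
`F{A₁, …, A_d} = (2πi)⁻¹ ∮_{γ₁} F_x{A₂, …, A_d} ⊗ (x I - A₁)⁻¹ dx`, where
`F_x(x₂, …, x_d) = F(x, x₂, …, x_d)`; for `d = 0` it is the constant matrix `F()`. -/
def multivariateMatrixFunction {m p : ℕ} : {d : ℕ} → {n : Fin d → ℕ} →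
    (γ : Fin d → ℝ → ℂ) → (A : (i : Fin d) → Matrix (Fin (n i)) (Fin (n i)) ℂ) →
    (F : (Fin d → ℂ) → Matrix (Fin m) (Fin p) ℂ) →
    Matrix (KronIndex d m n) (KronIndex d p n) ℂ
  | 0, _, _, _, F => F Fin.elim0
  | d + 1, n, γ, A, F =>
    (2 * Real.pi * Complex.I : ℂ)⁻¹ •
      (matrixContourIntegral (γ 0) fun x : ℂ =>
        (multivariateMatrixFunction (n := fun i : Fin d => n i.succ)
            (fun i => γ i.succ) (fun i => A i.succ)
            (fun y : Fin d → ℂ => F (Fin.cons x y))) ⊗ₖ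
          (x • (1 : Matrix (Fin (n 0)) (Fin (n 0)) ℂ) - A 0)⁻¹ :
        Matrix (KronIndex d m (fun i => n i.succ) × Fin (n 0))
          (KronIndex d p (fun i => n i.succ) × Fin (n 0)) ℂ)

end

/-! The outermost integral in `F{A₁, …, A_d}` is the one-variable calculus at `A₁` applied to the
matrix-valued function x ↦ F_x{A₂, …, A_d}. So the theorem follows by induction on d from the
Crouzeix–Palencia theorem for matrix-valued functions, each variable costing one factor 1 + √2
(`norm_multivariateMatrixFunction_le`).

In one variable, let W(A) lie in a convex body K with C² support function, and let ‖F‖ ≤ 1 on a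
neighbourhood of K. Let G be the Cauchy transform over ∂K of the adjoint F*. Two facts are needed.
(1) ‖G‖ ≤ 1 inside K (`norm_cauchyTransform_le_one`). Indeed G + F* is the double layer potential of
F*, an integral against a positive measure of mass 2. For z close to ∂K, at most about half of that
mass is far from z; on the rest F* is nearly F*(z), and subtracting F*(z) leaves norm about 1. The
maximum principle does the rest. (2) ‖F{A} + G{A}*‖ ≤ 2 (`exists_companion`). The sum equals ∫ F ⊗
(N + N*), where N is the resolvent density of the Cauchy integral. N + N* is positive semidefinite
because W(A) lies in every supporting half-plane of K, and it integrates to 2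
(`norm_integral_kron_le`).

With X = F{A} and Y = G{A}, fact (2) gives ‖X‖³ ≤ 2‖X‖² + ‖XYX‖ (`pow_three_le_of_norm_add_le`), and
XYX = (FGF){A} with ‖FGF‖ ≤ 1. For an extremal F this reads x³ ≤ 2x² + x, that is x ≤ 1 + √2. No
extremal function is used: if x > 1 + √2, iterating F ↦ FGF makes the norms grow geometrically,
against an a priori bound. Each iteration halves the collar around K on which the function lives.

W(A) is compact and convex (`numericalRange_convex`), so it is approximated from outside by such
bodies K (`exists_isSupportFn`). The calculus `hfc` is defined by Newton interpolation at the
eigenvalues and mentions no contour, so integrals over ∂Ω and over ∂K agree without any deformation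
argument. -/

open scoped Matrix

/-! ### Function classes and loops for Cauchy's theorem. -/

/-- Functions holomorphic on `Ω` and continuous on the larger set `C`. -/
def HolOn (Ω C : Set ℂ) (f : ℂ → ℂ) : Prop :=
  DifferentiableOn ℂ f Ω ∧ ContinuousOn f C

/-- A closed `C¹` curve in `C` for which Cauchy's theorem holds for `HolOn Ω C`, and which has
winding number one about every point of `D ⊆ Ω`. -/
structure IsCauchyLoop (Ω C D : Set ℂ) (T : ℝ) (γ γ' : ℝ → ℂ) : Prop where
  isOpen : IsOpen Ω
  subset : Ω ⊆ C
  subset' : D ⊆ Ω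
  nonneg : 0 ≤ T
  hasDerivAt : ∀ t, HasDerivAt γ (γ' t) t
  continuous_deriv : Continuous γ'
  closed : γ T = γ 0
  mem : ∀ t, γ t ∈ C
  integral_eq_zero : ∀ f, HolOn Ω C f → ∫ t in (0 : ℝ)..T, f (γ t) * γ' t = 0
  ne : ∀ w ∈ D, ∀ t, γ t ≠ w
  winding : ∀ w ∈ D, ∫ t in (0 : ℝ)..T, (γ t - w)⁻¹ * γ' t = 2 * Real.pi * Complex.I

namespace HolOn

variable {Ω C : Set ℂ} {f g : ℂ → ℂ}

theorem const (c : ℂ) : HolOn Ω C fun _ => c :=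
  ⟨differentiableOn_const c, continuousOn_const⟩

theorem id : HolOn Ω C fun z => z :=
  ⟨differentiableOn_id, continuousOn_id⟩

theorem add (hf : HolOn Ω C f) (hg : HolOn Ω C g) : HolOn Ω C fun z => f z + g z :=
  ⟨hf.1.add hg.1, hf.2.add hg.2⟩

theorem mul (hf : HolOn Ω C f) (hg : HolOn Ω C g) : HolOn Ω C fun z => f z * g z :=
  ⟨hf.1.mul hg.1, hf.2.mul hg.2⟩

theorem sum {ι : Type*} (s : Finset ι) {f : ι → ℂ → ℂ} (hf : ∀ i ∈ s, HolOn Ω C (f i)) :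
    HolOn Ω C fun z => ∑ i ∈ s, f i z :=
  ⟨DifferentiableOn.fun_sum fun i hi => (hf i hi).1, continuousOn_finsetSum s fun i hi => (hf i hi).2⟩

/-- Continuity at `w` is differentiability of `f` there, hence the node must lie in the open set `Ω`
and not merely in `C`. -/
theorem dslope (hΩ : IsOpen Ω) (_hC : Ω ⊆ C) (hf : HolOn Ω C f) {w : ℂ} (hw : w ∈ Ω) :
    HolOn Ω C (dslope f w) := by
  refine ⟨(Complex.differentiableOn_dslope (hΩ.mem_nhds hw)).2 hf.1, fun b hb => ?_⟩
  rcases eq_or_ne b w with rfl | hne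
  · exact (continuousAt_dslope_same.2
      ((hf.1 b hw).differentiableAt (hΩ.mem_nhds hw))).continuousWithinAt
  · exact (continuousWithinAt_dslope_of_ne hne).2 (hf.2 b hb)

end HolOn

/-! ### The resolvent. -/

/-- The resolvent-type inverse `(x - A)⁻¹`. -/
noncomputable def resolv {n : ℕ} (A : Matrix (Fin n) (Fin n) ℂ) (x : ℂ) :
    Matrix (Fin n) (Fin n) ℂ :=
  (x • (1 : Matrix (Fin n) (Fin n) ℂ) - A)⁻¹

section resolv

variable {n : ℕ} {A : Matrix (Fin n) (Fin n) ℂ} {x : ℂ}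

theorem isUnit_smul_one_sub (hx : x ∉ spectrum ℂ A) :
    IsUnit (x • (1 : Matrix (Fin n) (Fin n) ℂ) - A) := by
  rw [spectrum.notMem_iff, Algebra.algebraMap_eq_smul_one] at hx
  exact hx

theorem smul_one_sub_mul_resolv (hx : x ∉ spectrum ℂ A) :
    (x • (1 : Matrix (Fin n) (Fin n) ℂ) - A) * resolv A x = 1 :=
  Matrix.mul_nonsing_inv _ ((Matrix.isUnit_iff_isUnit_det _).1 (isUnit_smul_one_sub hx))

/-- Split x − a = (x − A) + (A − a). This trades a scalar factor x − a for a matrix factor A − a and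
drives every recursion over eigenvalues below. -/
theorem smul_resolv (hx : x ∉ spectrum ℂ A) (a : ℂ) :
    (x - a) • resolv A x = 1 + (A - a • 1) * resolv A x := by
  have h := smul_one_sub_mul_resolv hx
  have : (x - a) • resolv A x = ((x • 1 - A) + (A - a • 1)) * resolv A x := by
    rw [sub_add_sub_cancel, ← sub_smul, Matrix.smul_mul, one_mul]
  rw [this, add_mul, h]

theorem continuousAt_resolv (hx : x ∉ spectrum ℂ A) : ContinuousAt (resolv A) x := by
  have h := isUnit_smul_one_sub hx
  have h1 := NormedRing.inverse_continuousAt h.unit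
  have h2 : ContinuousAt (fun y : ℂ => y • (1 : Matrix (Fin n) (Fin n) ℂ) - A) x := by fun_prop
  have : resolv A = Ring.inverse ∘ (fun y : ℂ => y • (1 : Matrix (Fin n) (Fin n) ℂ) - A) := by
    ext1 y
    exact Matrix.nonsing_inv_eq_ringInverse _
  rw [this]
  exact ContinuousAt.comp h1 h2

end resolv

theorem intervalIntegrable_smul {α β : Type*} [Fintype α] [Fintype β] [DecidableEq β]
    {u : ℝ → ℂ} {M : ℝ → Matrix α β ℂ} (hu : Continuous u) (hM : Continuous M) (a b : ℝ) :
    IntervalIntegrable (fun t => u t • M t) MeasureTheory.volume a b :=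
  (hu.smul hM).intervalIntegrable a b

theorem mul_intervalIntegral {n : ℕ} (B : Matrix (Fin n) (Fin n) ℂ)
    {M : ℝ → Matrix (Fin n) (Fin n) ℂ} (hM : Continuous M) (a b : ℝ) :
    B * ∫ t in a..b, M t = ∫ t in a..b, B * M t :=
  ((ContinuousLinearMap.mul ℂ (Matrix (Fin n) (Fin n) ℂ) B).intervalIntegral_comp_comm
    (hM.intervalIntegrable a b)).symm

/-! ### The holomorphic functional calculus by Newton interpolation. -/

/-- Newton interpolation polynomial of `f` at the nodes in the list. -/
noncomputable def newton : List ℂ → (ℂ → ℂ) → Polynomial ℂ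
  | [], _ => 0
  | a :: l, f => Polynomial.C (f a) + (Polynomial.X - Polynomial.C a) * newton l (dslope f a)

/-- The Cauchy integral `∮ f(x) (x - A)⁻¹ dx`. -/
noncomputable def cauchyInt {n : ℕ} (T : ℝ) (γ γ' : ℝ → ℂ) (A : Matrix (Fin n) (Fin n) ℂ)
    (f : ℂ → ℂ) : Matrix (Fin n) (Fin n) ℂ :=
  ∫ t in (0 : ℝ)..T, (f (γ t) * γ' t) • resolv A (γ t)

namespace IsCauchyLoop

variable {Ω C D : Set ℂ} {T : ℝ} {γ γ' : ℝ → ℂ} {n : ℕ} {A : Matrix (Fin n) (Fin n) ℂ}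

theorem continuous (h : IsCauchyLoop Ω C D T γ γ') : Continuous γ :=
  continuous_iff_continuousAt.2 fun t => (h.hasDerivAt t).continuousAt

theorem continuous_comp (h : IsCauchyLoop Ω C D T γ γ') {f : ℂ → ℂ} (hf : ContinuousOn f C) :
    Continuous fun t => f (γ t) :=
  hf.comp_continuous h.continuous h.mem

theorem notMem_spectrum (h : IsCauchyLoop Ω C D T γ γ') (hA : spectrum ℂ A ⊆ D) (t : ℝ) :
    γ t ∉ spectrum ℂ A := fun ht => h.ne _ (hA ht) t rfl

theorem continuous_resolv (h : IsCauchyLoop Ω C D T γ γ') (hA : spectrum ℂ A ⊆ D) :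
    Continuous fun t => resolv A (γ t) :=
  continuous_iff_continuousAt.2 fun t =>
    ContinuousAt.comp (g := resolv A) (continuousAt_resolv (h.notMem_spectrum hA t))
      h.continuous.continuousAt

/-- Insert f(x) = f(a) + (x − a)·`dslope f a x` and apply `smul_resolv`. The identity term left over
integrates to zero by Cauchy's theorem, so no winding number enters. -/
theorem cauchyInt_mul_cons (h : IsCauchyLoop Ω C D T γ γ') (hA : spectrum ℂ A ⊆ D)
    {f g : ℂ → ℂ} (hf : HolOn Ω C f) (hg : HolOn Ω C g) {a : ℂ} (ha : a ∈ Ω) :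
    cauchyInt T γ γ' A (fun x => f x * g x) =
      f a • cauchyInt T γ γ' A g +
        (A - a • 1) * cauchyInt T γ γ' A (fun x => dslope f a x * g x) := by
  have hd := hf.dslope h.isOpen h.subset ha
  have hR := h.continuous_resolv hA
  have cg := h.continuous_comp hg.2
  have cd := h.continuous_comp hd.2
  have cγ := h.continuous_deriv
  have h0 : (∫ t in (0 : ℝ)..T, (dslope f a (γ t) * g (γ t) * γ' t) •
      (1 : Matrix (Fin n) (Fin n) ℂ)) = 0 := by
    rw [intervalIntegral.integral_smul_const, h.integral_eq_zero _ (hd.mul hg), zero_smul]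
  have u1 : Continuous fun t => dslope f a (γ t) * g (γ t) * γ' t := (cd.mul cg).mul cγ
  have u2 : Continuous fun t => g (γ t) * γ' t := cg.mul cγ
  have v1 : Continuous fun t => f a • ((g (γ t) * γ' t) • resolv A (γ t)) :=
    (u2.smul hR).const_smul (f a)
  have v2 : Continuous fun t => (A - a • 1) *
      ((dslope f a (γ t) * g (γ t) * γ' t) • resolv A (γ t)) := continuous_const.mul (u1.smul hR)
  have v3 : Continuous fun t => (dslope f a (γ t) * g (γ t) * γ' t) •
      (1 : Matrix (Fin n) (Fin n) ℂ) := u1.smul continuous_const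
  have h1 : (A - a • 1) * cauchyInt T γ γ' A (fun x => dslope f a x * g x) =
      ∫ t in (0 : ℝ)..T, (A - a • 1) *
        ((dslope f a (γ t) * g (γ t) * γ' t) • resolv A (γ t)) :=
    mul_intervalIntegral _ (u1.smul hR) _ _
  have h2 : f a • cauchyInt T γ γ' A g = ∫ t in (0 : ℝ)..T, f a • ((g (γ t) * γ' t) •
      resolv A (γ t)) := (intervalIntegral.integral_smul _ _).symm
  rw [h1, h2, ← add_zero (intervalIntegral _ _ _ _), ← h0, cauchyInt,
    add_right_comm, ← intervalIntegral.integral_add, ← intervalIntegral.integral_add]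
  · refine intervalIntegral.integral_congr fun t _ => ?_
    have e1 := smul_resolv (h.notMem_spectrum hA t) a
    have e2 : f (γ t) = f a + (γ t - a) * dslope f a (γ t) := by
      have := sub_smul_dslope f a (γ t)
      rw [smul_eq_mul] at this
      rw [this]; ring
    have e3 : (f (γ t) * g (γ t) * γ' t) • resolv A (γ t) =
        f a • ((g (γ t) * γ' t) • resolv A (γ t)) +
        (dslope f a (γ t) * g (γ t) * γ' t) • ((γ t - a) • resolv A (γ t)) := by
      rw [e2, smul_smul, smul_smul, ← add_smul]; congr 1; ring
    rw [e3, e1, smul_add, Matrix.mul_smul]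
    abel
  all_goals first
    | exact v1.intervalIntegrable _ _
    | exact v2.intervalIntegrable _ _
    | exact v3.intervalIntegrable _ _
    | exact (v1.intervalIntegrable _ _).add (v2.intervalIntegrable _ _)

/-- One step of Newton's scheme per node. The prefix `B` collects the factors A − a already
extracted, so the remainder vanishes once the nodes are used up. Carrying the spectator `g` yields
multiplicativity of the calculus directly. -/
theorem mul_cauchyInt_mul (h : IsCauchyLoop Ω C D T γ γ') (hA : spectrum ℂ A ⊆ D) {g : ℂ → ℂ}
    (hg : HolOn Ω C g) : ∀ (l : List ℂ) (_ : ∀ a ∈ l, a ∈ D) (f : ℂ → ℂ) (_ : HolOn Ω C f)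
    (B : Matrix (Fin n) (Fin n) ℂ) (_ : B * (l.map fun a => A - a • 1).prod = 0),
    B * cauchyInt T γ γ' A (fun x => f x * g x) =
      B * (Polynomial.aeval A (newton l f) * cauchyInt T γ γ' A g)
  | [], _, f, _, B, hB => by
    simp only [List.map_nil, List.prod_nil, mul_one] at hB
    rw [hB, zero_mul, zero_mul]
  | a :: l, hl, f, hf, B, hB => by
    have haD : a ∈ D := hl a (by simp)
    have ha := h.subset' haD
    have ih := mul_cauchyInt_mul h hA hg l (fun b hb => hl b (by simp [hb])) (dslope f a)
      (hf.dslope h.isOpen h.subset ha) (B * (A - a • 1)) (by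
        simpa only [List.map_cons, List.prod_cons, mul_assoc] using hB)
    rw [h.cauchyInt_mul_cons hA hf hg ha, mul_add, ← mul_assoc, ih, newton]
    simp only [map_add, map_mul, map_sub, Polynomial.aeval_X, Polynomial.aeval_C,
      Algebra.algebraMap_eq_smul_one, add_mul, mul_add, mul_assoc, Matrix.smul_mul,
      Matrix.mul_smul, one_mul]

end IsCauchyLoop

/-- The eigenvalues of `A`, with multiplicity, as a list. -/
noncomputable def eigList {n : ℕ} (A : Matrix (Fin n) (Fin n) ℂ) : List ℂ :=
  A.charpoly.roots.toList

theorem mem_spectrum_of_mem_eigList {n : ℕ} {A : Matrix (Fin n) (Fin n) ℂ} {a : ℂ}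
    (ha : a ∈ eigList A) : a ∈ spectrum ℂ A := by
  rw [eigList, Multiset.mem_toList] at ha
  exact Matrix.mem_spectrum_iff_isRoot_charpoly.2 (Polynomial.isRoot_of_mem_roots ha)

/-- Cayley–Hamilton, with the characteristic polynomial split over ℂ; this is what terminates the
Newton recursion. -/
theorem prod_eigList {n : ℕ} (A : Matrix (Fin n) (Fin n) ℂ) :
    ((eigList A).map fun a => A - a • 1).prod = 0 := by
  have h := (IsAlgClosed.splits A.charpoly).eq_prod_roots_of_monic A.charpoly_monic
  have h2 := Matrix.aeval_self_charpoly A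
  rw [h, ← Multiset.coe_toList A.charpoly.roots, Multiset.map_coe, Multiset.prod_coe,
    map_list_prod, List.map_map] at h2
  rw [← h2, eigList]
  congr 1
  refine List.map_congr_left fun a _ => ?_
  simp [Algebra.algebraMap_eq_smul_one]

namespace IsCauchyLoop

variable {Ω C D : Set ℂ} {T : ℝ} {γ γ' : ℝ → ℂ} {n : ℕ} {A : Matrix (Fin n) (Fin n) ℂ}

theorem continuous_prod_inv (h : IsCauchyLoop Ω C D T γ γ') (l : List ℂ) (hl : ∀ a ∈ l, a ∈ D) :
    Continuous fun t => (l.map fun a => (γ t - a)⁻¹).prod := by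
  induction l with
  | nil => simpa using continuous_const
  | cons a l ih =>
    simp only [List.map_cons, List.prod_cons]
    refine Continuous.mul (Continuous.inv₀ (h.continuous.sub continuous_const) fun t => ?_)
      (ih fun b hb => hl b (by simp [hb]))
    exact sub_ne_zero.2 (h.ne a (hl a (by simp)) t)

/-- The integrand has a single-valued primitive, since the exponent is at least 2. -/
theorem integral_pow_inv (h : IsCauchyLoop Ω C D T γ γ') {a : ℂ} (ha : a ∈ D) (k : ℕ) :
    ∫ t in (0 : ℝ)..T, ((γ t - a)⁻¹) ^ (k + 2) * γ' t = 0 := by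
  have hne : ∀ t, γ t - a ≠ 0 := fun t => sub_ne_zero.2 (h.ne a ha t)
  have hd : ∀ t, HasDerivAt (fun t => -(k + 1 : ℂ)⁻¹ * ((γ t - a)⁻¹) ^ (k + 1))
      (((γ t - a)⁻¹) ^ (k + 2) * γ' t) t := by
    intro t
    have h1 := ((((h.hasDerivAt t).sub_const a).inv (hne t)).pow (k + 1)).const_mul
      (-(k + 1 : ℂ)⁻¹)
    convert! h1 using 1
    have hk : (k + 1 : ℂ) ≠ 0 := Nat.cast_add_one_ne_zero k
    have := hne t
    simp only [Pi.inv_apply, Nat.add_sub_cancel, Nat.cast_add, Nat.cast_one, inv_pow]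
    field_simp
    ring
  rw [intervalIntegral.integral_eq_sub_of_hasDerivAt (fun t _ => hd t), h.closed, sub_self]
  have := h.continuous
  have := h.continuous_deriv
  exact Continuous.intervalIntegrable (by fun_prop (disch := assumption)) _ _

/-- Partial fractions: two distinct poles are separated, lowering the number of factors by one,
until all poles coincide or only two simple ones remain. -/
theorem integral_prod_inv (h : IsCauchyLoop Ω C D T γ γ') : ∀ (k : ℕ) (l : List ℂ)
    (_ : ∀ a ∈ l, a ∈ D) (_ : l.length = k + 2),
    ∫ t in (0 : ℝ)..T, (l.map fun a => (γ t - a)⁻¹).prod * γ' t = 0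
  | k, [], _, hk => by simp at hk
  | k, a :: l, hl, hk => by
    have ha : a ∈ D := hl a (by simp)
    have hl' : ∀ b ∈ l, b ∈ D := fun b hb => hl b (by simp [hb])
    by_cases hall : ∀ b ∈ l, b = a
    · have : l = List.replicate (k + 1) a :=
        List.eq_replicate_iff.2 ⟨by simpa using hk, hall⟩
      subst this
      simpa only [List.map_cons, List.map_replicate, List.prod_cons, List.prod_replicate,
        ← pow_succ'] using h.integral_pow_inv ha k
    · push Not at hall
      obtain ⟨b, hb, hba⟩ := hall
      have hbD := hl' b hb
      have hperm := List.perm_cons_erase hb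
      set m := l.erase b with hm
      have hmD : ∀ c ∈ m, c ∈ D := fun c hc => hl' c (List.mem_of_mem_erase hc)
      have hml : m.length = k := by
        have := hperm.length_eq
        simp at this hk
        omega
      have key : ∀ t, ((a :: l).map fun a => (γ t - a)⁻¹).prod * γ' t =
          (b - a)⁻¹ * (((b :: m).map fun a => (γ t - a)⁻¹).prod * γ' t -
            ((a :: m).map fun a => (γ t - a)⁻¹).prod * γ' t) := by
        intro t
        rw [List.map_cons, List.prod_cons, (hperm.map _).prod_eq]
        simp only [List.map_cons, List.prod_cons]
        have h1 : γ t - a ≠ 0 := sub_ne_zero.2 (h.ne a ha t)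
        have h2 : γ t - b ≠ 0 := sub_ne_zero.2 (h.ne b hbD t)
        have h3 : b - a ≠ 0 := sub_ne_zero.2 hba
        field_simp
        ring
      have hint : ∀ c ∈ D, IntervalIntegrable
          (fun t => ((c :: m).map fun a => (γ t - a)⁻¹).prod * γ' t) MeasureTheory.volume 0 T := by
        intro c hc
        refine Continuous.intervalIntegrable ((h.continuous_prod_inv _ ?_).mul
          h.continuous_deriv) _ _
        intro d hd
        rcases List.mem_cons.1 hd with rfl | hd
        exacts [hc, hmD d hd]
      simp only [key]
      rw [intervalIntegral.integral_const_mul, intervalIntegral.integral_sub (hint b hbD)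
        (hint a ha)]
      rcases k with _ | k
      -- Two distinct simple poles: both winding integrals are 2πi and cancel.
      · have : m = [] := List.length_eq_zero_iff.1 hml
        simp [this, h.winding a ha, h.winding b hbD]
      · rw [integral_prod_inv h k (b :: m) _ (by simp [hml]),
          integral_prod_inv h k (a :: m) _ (by simp [hml])]
        · simp
        · intro d hd
          rcases List.mem_cons.1 hd with rfl | hd
          exacts [ha, hmD d hd]
        · intro d hd
          rcases List.mem_cons.1 hd with rfl | hd
          exacts [hbD, hmD d hd]

theorem integral_prod_inv_smul_resolv (h : IsCauchyLoop Ω C D T γ γ') (hA : spectrum ℂ A ⊆ D)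
    (u : List ℂ) (hu : ∀ a ∈ u, a ∈ D) (a : ℂ) (ha : a ∈ D) :
    ∫ t in (0 : ℝ)..T, ((u.map fun a => (γ t - a)⁻¹).prod * γ' t) • resolv A (γ t) =
      (∫ t in (0 : ℝ)..T, ((a :: u).map fun a => (γ t - a)⁻¹).prod * γ' t) • 1 +
      (A - a • 1) * ∫ t in (0 : ℝ)..T,
        (((a :: u).map fun a => (γ t - a)⁻¹).prod * γ' t) • resolv A (γ t) := by
  have hR := h.continuous_resolv hA
  have cγ := h.continuous_deriv
  have cu := h.continuous_prod_inv (a :: u) (by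
    intro d hd
    rcases List.mem_cons.1 hd with rfl | hd
    exacts [ha, hu d hd])
  have h1 : (A - a • 1) * ∫ t in (0 : ℝ)..T,
        (((a :: u).map fun a => (γ t - a)⁻¹).prod * γ' t) • resolv A (γ t) =
      ∫ t in (0 : ℝ)..T, (A - a • 1) *
        ((((a :: u).map fun a => (γ t - a)⁻¹).prod * γ' t) • resolv A (γ t)) :=
    mul_intervalIntegral _ ((cu.mul cγ).smul hR) _ _
  rw [h1, ← intervalIntegral.integral_smul_const, ← intervalIntegral.integral_add]
  · refine intervalIntegral.integral_congr fun t _ => ?_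
    have e1 := smul_resolv (h.notMem_spectrum hA t) a
    have hne : γ t - a ≠ 0 := sub_ne_zero.2 (h.ne a ha t)
    simp only [List.map_cons, List.prod_cons]
    rw [Matrix.mul_smul, ← smul_add, ← e1, smul_smul]
    congr 1
    field_simp
  · exact intervalIntegrable_smul (cu.mul cγ) continuous_const _ _
  · exact (continuous_const.mul ((cu.mul cγ).smul hR)).intervalIntegrable _ _

/-- Each application of `integral_prod_inv_smul_resolv` produces one more pole and one more factor A
− a. The scalar term dies because `u ≠ []` leaves at least two poles, and the matrix factors
eventually multiply to zero. -/
theorem mul_integral_prod_inv_eq_zero (h : IsCauchyLoop Ω C D T γ γ') (hA : spectrum ℂ A ⊆ D) :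
    ∀ (l : List ℂ) (_ : ∀ a ∈ l, a ∈ D) (u : List ℂ) (_ : ∀ a ∈ u, a ∈ D) (_ : u ≠ [])
    (B : Matrix (Fin n) (Fin n) ℂ) (_ : B * (l.map fun a => A - a • 1).prod = 0),
    B * ∫ t in (0 : ℝ)..T, ((u.map fun a => (γ t - a)⁻¹).prod * γ' t) • resolv A (γ t) = 0
  | [], _, u, _, _, B, hB => by
    simp only [List.map_nil, List.prod_nil, mul_one] at hB
    rw [hB, zero_mul]
  | a :: l, hl, u, hu, hu0, B, hB => by
    have ha : a ∈ D := hl a (by simp)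
    have hau : ∀ b ∈ a :: u, b ∈ D := by
      intro d hd
      rcases List.mem_cons.1 hd with rfl | hd
      exacts [ha, hu d hd]
    obtain ⟨k, hk⟩ : ∃ k, (a :: u).length = k + 2 :=
      ⟨u.length - 1, by have := List.length_pos_of_ne_nil hu0; simp; omega⟩
    rw [h.integral_prod_inv_smul_resolv hA u hu a ha, h.integral_prod_inv k _ hau hk, zero_smul,
      zero_add, ← mul_assoc]
    exact mul_integral_prod_inv_eq_zero h hA l (fun b hb => hl b (by simp [hb])) _ hau (by simp) _
      (by simpa only [List.map_cons, List.prod_cons, mul_assoc] using hB)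

/-- Only the first pole contributes, through its winding number; all later terms vanish by
Cayley–Hamilton. This replaces pushing the contour to infinity. -/
theorem cauchyInt_one (h : IsCauchyLoop Ω C D T γ γ') (hA : spectrum ℂ A ⊆ D) :
    cauchyInt T γ γ' A (fun _ => 1) = (2 * Real.pi * Complex.I : ℂ) • 1 := by
  have hp := prod_eigList A
  have hm : ∀ a ∈ eigList A, a ∈ D := fun a ha => hA (mem_spectrum_of_mem_eigList ha)
  rcases hl : eigList A with _ | ⟨a, l⟩
  -- Without eigenvalues the empty product gives 1 = 0, so the matrix ring is trivial.
  · rw [hl, List.map_nil, List.prod_nil] at hp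
    have := subsingleton_of_zero_eq_one hp.symm
    exact Subsingleton.elim _ _
  · rw [hl] at hp hm
    have ha := hm a (by simp)
    have h1 := h.integral_prod_inv_smul_resolv hA [] (by simp) a ha
    have h2 := h.mul_integral_prod_inv_eq_zero hA l (fun b hb => hm b (by simp [hb])) [a]
      (by simpa using ha) (by simp) (A - a • 1) (by simpa using hp)
    rw [h2, add_zero] at h1
    simpa [h.winding a ha, cauchyInt] using h1

theorem cauchyInt_mul (h : IsCauchyLoop Ω C D T γ γ') (hA : spectrum ℂ A ⊆ D) {f g : ℂ → ℂ}
    (hf : HolOn Ω C f) (hg : HolOn Ω C g) :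
    cauchyInt T γ γ' A (fun x => f x * g x) =
      Polynomial.aeval A (newton (eigList A) f) * cauchyInt T γ γ' A g := by
  simpa using h.mul_cauchyInt_mul hA hg (eigList A)
    (fun a ha => hA (mem_spectrum_of_mem_eigList ha)) f hf 1 (by rw [prod_eigList, mul_zero])

theorem cauchyInt_eq (h : IsCauchyLoop Ω C D T γ γ') (hA : spectrum ℂ A ⊆ D) {f : ℂ → ℂ}
    (hf : HolOn Ω C f) :
    cauchyInt T γ γ' A f =
      (2 * Real.pi * Complex.I : ℂ) • Polynomial.aeval A (newton (eigList A) f) := by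
  have := h.cauchyInt_mul hA hf (HolOn.const 1)
  rw [h.cauchyInt_one hA] at this
  simpa using this

end IsCauchyLoop

/-- The holomorphic functional calculus `f(A)`, through Newton interpolation. -/
noncomputable def hfc {n : ℕ} (A : Matrix (Fin n) (Fin n) ℂ) (f : ℂ → ℂ) :
    Matrix (Fin n) (Fin n) ℂ :=
  Polynomial.aeval A (newton (eigList A) f)

namespace IsCauchyLoop

variable {Ω C D : Set ℂ} {T : ℝ} {γ γ' : ℝ → ℂ} {n : ℕ} {A : Matrix (Fin n) (Fin n) ℂ}

/-- The left side mentions no curve, so the Cauchy integrals of `f` over all admissible loops agree.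
-/
theorem hfc_eq (h : IsCauchyLoop Ω C D T γ γ') (hA : spectrum ℂ A ⊆ D) {f : ℂ → ℂ}
    (hf : HolOn Ω C f) :
    hfc A f = (2 * Real.pi * Complex.I : ℂ)⁻¹ • cauchyInt T γ γ' A f := by
  rw [h.cauchyInt_eq hA hf, inv_smul_smul₀ Complex.two_pi_I_ne_zero, hfc]

theorem hfc_mul (h : IsCauchyLoop Ω C D T γ γ') (hA : spectrum ℂ A ⊆ D) {f g : ℂ → ℂ}
    (hf : HolOn Ω C f) (hg : HolOn Ω C g) :
    hfc A (fun x => f x * g x) = hfc A f * hfc A g := by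
  rw [h.hfc_eq hA (hf.mul hg), h.cauchyInt_mul hA hf hg, h.hfc_eq hA hg, Matrix.mul_smul, hfc]

theorem hfc_add (h : IsCauchyLoop Ω C D T γ γ') (hA : spectrum ℂ A ⊆ D) {f g : ℂ → ℂ}
    (hf : HolOn Ω C f) (hg : HolOn Ω C g) :
    hfc A (fun x => f x + g x) = hfc A f + hfc A g := by
  have hR := h.continuous_resolv hA
  have cγ := h.continuous_deriv
  have cf := h.continuous_comp hf.2
  have cg := h.continuous_comp hg.2
  rw [h.hfc_eq hA (hf.add hg), h.hfc_eq hA hf, h.hfc_eq hA hg, ← smul_add, cauchyInt, cauchyInt,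
    cauchyInt, ← intervalIntegral.integral_add]
  · simp only [add_mul, add_smul]
  · exact intervalIntegrable_smul (cf.mul cγ) hR _ _
  · exact intervalIntegrable_smul (cg.mul cγ) hR _ _

theorem hfc_const (h : IsCauchyLoop Ω C D T γ γ') (hA : spectrum ℂ A ⊆ D) (c : ℂ) :
    hfc A (fun _ => c) = c • 1 := by
  have h1 := h.cauchyInt_mul hA (HolOn.const 1) (HolOn.const c)
  have h2 : cauchyInt T γ γ' A (fun _ => c) = c • cauchyInt T γ γ' A (fun _ => 1) := by
    rw [cauchyInt, cauchyInt, ← intervalIntegral.integral_smul]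
    simp only [one_mul, smul_smul]
  rw [h.hfc_eq hA (HolOn.const c), h2, h.cauchyInt_one hA, smul_comm c,
    inv_smul_smul₀ Complex.two_pi_I_ne_zero]

theorem hfc_sum (h : IsCauchyLoop Ω C D T γ γ') (hA : spectrum ℂ A ⊆ D) {ι : Type*}
    (s : Finset ι) {f : ι → ℂ → ℂ} (hf : ∀ i, HolOn Ω C (f i)) :
    hfc A (fun x => ∑ i ∈ s, f i x) = ∑ i ∈ s, hfc A (f i) := by
  classical
  induction s using Finset.induction_on with
  | empty => simpa using h.hfc_const hA 0
  | insert i s hi ih =>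
    simp only [Finset.sum_insert hi]
    rw [h.hfc_add hA (hf i) (HolOn.sum s fun i _ => hf i), ih]

theorem hfc_id (h : IsCauchyLoop Ω C D T γ γ') (hA : spectrum ℂ A ⊆ D) :
    hfc A (fun x => x) = A := by
  have hR := h.continuous_resolv hA
  have cγ := h.continuous_deriv
  have hc := h.hfc_const hA 1
  rw [h.hfc_eq hA (HolOn.const 1)] at hc
  have h0 : (∫ t in (0 : ℝ)..T, γ' t • (1 : Matrix (Fin n) (Fin n) ℂ)) = 0 := by
    rw [intervalIntegral.integral_smul_const]
    have := h.integral_eq_zero _ (HolOn.const 1)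
    simp only [one_mul] at this
    rw [this, zero_smul]
  have h1 : cauchyInt T γ γ' A (fun x => x) = A * cauchyInt T γ γ' A (fun _ => 1) := by
    have c1 : Continuous fun t => (1 * γ' t) • resolv A (γ t) :=
      (continuous_const.mul cγ).smul hR
    have : A * cauchyInt T γ γ' A (fun _ => 1) =
        ∫ t in (0 : ℝ)..T, A * ((1 * γ' t) • resolv A (γ t)) := mul_intervalIntegral _ c1 _ _
    rw [this, ← add_zero (intervalIntegral _ _ _ _), ← h0, ← intervalIntegral.integral_add]
    · refine intervalIntegral.integral_congr fun t _ => ?_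
      have e1 := smul_resolv (h.notMem_spectrum hA t) 0
      simp only [sub_zero, zero_smul] at e1
      simp only [one_mul]
      rw [Matrix.mul_smul, ← smul_add, add_comm, ← e1, smul_smul, mul_comm]
    · exact (continuous_const.mul c1).intervalIntegrable _ _
    · exact intervalIntegrable_smul cγ continuous_const _ _
  rw [h.hfc_eq hA HolOn.id, h1, ← Matrix.mul_smul, hc, one_smul, mul_one]

/-- `f(A)` for `f(z) = (σ - z)⁻¹` is the resolvent. -/
theorem hfc_inv (h : IsCauchyLoop Ω C D T γ γ') (hA : spectrum ℂ A ⊆ D) {σ : ℂ} (hσ : σ ∉ C) :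
    hfc A (fun z => (σ - z)⁻¹) = resolv A σ := by
  have hσA : σ ∉ spectrum ℂ A := fun hh => hσ (h.subset (h.subset' (hA hh)))
  have hne : ∀ z ∈ C, σ - z ≠ 0 := fun z hz h0 => hσ ((sub_eq_zero.1 h0) ▸ hz)
  have hol : HolOn Ω C fun z => (σ - z)⁻¹ :=
    ⟨((differentiableOn_const _).sub differentiableOn_id).inv fun z hz => hne z (h.subset hz),
      (continuousOn_const.sub continuousOn_id).inv₀ hne⟩
  have hol2 : HolOn Ω C fun z => σ + (-1) * z := (HolOn.const σ).add ((HolOn.const _).mul HolOn.id)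
  have h1 : hfc A (fun z => σ + (-1) * z) = σ • 1 - A := by
    rw [h.hfc_add hA (HolOn.const σ) ((HolOn.const (-1)).mul HolOn.id),
      h.hfc_mul hA (HolOn.const (-1)) HolOn.id, h.hfc_const hA, h.hfc_const hA, h.hfc_id hA]
    simp [sub_eq_add_neg]
  have h2 := h.hfc_mul hA hol hol2
  -- The product is 1 only off z = σ, so the constant rule is reached through the integral, which
  -- sees only points of the curve.
  have h3 : hfc A (fun x => (σ - x)⁻¹ * (σ + (-1) * x)) = 1 := by
    rw [h.hfc_eq hA (hol.mul hol2), ← one_smul ℂ (1 : Matrix (Fin n) (Fin n) ℂ),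
      ← h.hfc_const hA 1, h.hfc_eq hA (HolOn.const 1)]
    congr 1
    refine intervalIntegral.integral_congr fun t _ => ?_
    have := hne _ (h.mem t)
    have e : (σ - γ t)⁻¹ * (σ + (-1) * γ t) = 1 := by
      rw [neg_one_mul, ← sub_eq_add_neg, inv_mul_cancel₀ this]
    simp only [e]
  rw [h3, h1] at h2
  calc hfc A (fun z => (σ - z)⁻¹) = hfc A (fun z => (σ - z)⁻¹) * ((σ • 1 - A) * resolv A σ) := by
        rw [smul_one_sub_mul_resolv hσA, mul_one]
    _ = resolv A σ := by rw [← mul_assoc, ← h2, one_mul]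

end IsCauchyLoop

/-! ### Integrals depending on a parameter. -/

section parametric

variable {E : Type*} [NormedAddCommGroup E] [NormedSpace ℂ E]

theorem continuousOn_intervalIntegral_param {S : Type*} [TopologicalSpace S] {K : Set S}
    {f : S → ℝ → E} (hc : ContinuousOn (Function.uncurry f) (K ×ˢ Set.univ)) (a b : ℝ) :
    ContinuousOn (fun s => ∫ t in a..b, f s t) K := by
  rw [continuousOn_iff_continuous_domRestrict]
  refine intervalIntegral.continuous_parametric_intervalIntegral_of_continuous'
    (f := fun (s : K) t => f s t) ?_ a b
  exact hc.comp_continuous (f := fun q : K × ℝ => ((q.1 : S), q.2)) (by fun_prop)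
    fun q => ⟨q.1.2, trivial⟩

/-- Joint continuity and holomorphy in the parameter suffice, because Cauchy's estimate turns a
bound for `f` on a compact set into a dominating bound for its derivative. -/
theorem differentiableOn_intervalIntegral_param [CompleteSpace E] {U : Set ℂ} (hU : IsOpen U)
    {f : ℂ → ℝ → E} (hc : ContinuousOn (Function.uncurry f) (U ×ˢ Set.univ))
    (hd : ∀ t, DifferentiableOn ℂ (fun s => f s t) U) (a b : ℝ) :
    DifferentiableOn ℂ (fun s => ∫ t in a..b, f s t) U := by
  intro s₀ hs₀
  obtain ⟨R, hR, hball⟩ := Metric.nhds_basis_closedBall.mem_iff.1 (hU.mem_nhds hs₀)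
  have hsec : ∀ s ∈ U, Continuous (f s) := fun s hs =>
    hc.comp_continuous (f := fun t => (s, t)) (by fun_prop) fun t => ⟨hs, trivial⟩
  have hcomp : IsCompact (Metric.closedBall s₀ R ×ˢ Set.uIcc a b) :=
    (isCompact_closedBall _ _).prod isCompact_uIcc
  obtain ⟨B, hB⟩ := hcomp.exists_bound_of_continuousOn
    (hc.mono (Set.prod_mono hball (Set.subset_univ _)))
  have hder : ∀ t, ∀ s ∈ Metric.ball s₀ (R / 2), HasDerivAt (fun s => f s t)
      (deriv (fun s => f s t) s) s := by
    intro t s hs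
    have : s ∈ U := hball (Metric.ball_subset_closedBall
      (Metric.ball_subset_ball (by linarith) hs))
    exact ((hd t s this).differentiableAt (hU.mem_nhds this)).hasDerivAt
  have key := intervalIntegral.hasDerivAt_integral_of_dominated_loc_of_deriv_le
    (μ := MeasureTheory.volume) (a := a) (b := b) (F := f)
    (F' := fun s t => deriv (fun s => f s t) s) (x₀ := s₀) (s := Metric.ball s₀ (R / 2))
    (bound := fun _ => B / (R / 2))
    (Metric.ball_mem_nhds _ (by linarith)) ?_ ((hsec s₀ hs₀).intervalIntegrable _ _) ?_ ?_
    (continuous_const.intervalIntegrable _ _) ?_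
  · exact key.2.differentiableAt.differentiableWithinAt
  · filter_upwards [hU.mem_nhds hs₀] with s hs using (hsec s hs).aestronglyMeasurable
  -- Measurability in t of the derivative at `s₀`: it is a pointwise limit of difference quotients
  -- with steps (R/2)/(k+1).
  · have hlim : ∀ t, Filter.Tendsto (fun k : ℕ => ((k : ℂ) + 1) •
        (f (s₀ + ((R / 2 : ℝ) : ℂ) * ((k : ℂ) + 1)⁻¹) t - f s₀ t)) Filter.atTop
        (nhds (((R / 2 : ℝ) : ℂ) • deriv (fun s => f s t) s₀)) := by
      intro t
      have h1 := (hder t s₀ (Metric.mem_ball_self (by linarith))).tendsto_slope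
      have h2 : Filter.Tendsto (fun k : ℕ => s₀ + ((R / 2 : ℝ) : ℂ) * ((k : ℂ) + 1)⁻¹)
          Filter.atTop (nhdsWithin s₀ {s₀}ᶜ) := by
        refine tendsto_nhdsWithin_iff.2 ⟨?_, Filter.Eventually.of_forall fun k => ?_⟩
        · have h3 : Filter.Tendsto (fun k : ℕ => ((k : ℂ) + 1)⁻¹) Filter.atTop (nhds 0) := by
            simpa using tendsto_one_div_add_atTop_nhds_zero_nat (𝕜 := ℂ)
          simpa using (h3.const_mul ((R / 2 : ℝ) : ℂ)).const_add s₀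
        · have h4 : ((k : ℂ) + 1) ≠ 0 := Nat.cast_add_one_ne_zero k
          have h5 : ((R / 2 : ℝ) : ℂ) ≠ 0 := by
            exact_mod_cast (by positivity : (R / 2) ≠ 0)
          simp only [Set.mem_compl_iff, Set.mem_singleton_iff, add_eq_left, mul_eq_zero,
            inv_eq_zero, not_or]
          exact ⟨h5, h4⟩
      have h6 := (h1.comp h2).const_smul ((R / 2 : ℝ) : ℂ)
      refine h6.congr fun k => ?_
      have h4 : ((k : ℂ) + 1) ≠ 0 := Nat.cast_add_one_ne_zero k
      have h5 : ((R / 2 : ℝ) : ℂ) ≠ 0 := by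
        exact_mod_cast (by positivity : (R / 2) ≠ 0)
      simp only [Function.comp_apply, slope_def_module, add_sub_cancel_left, smul_smul]
      congr 1
      field_simp
    have hpt : ∀ k : ℕ, s₀ + ((R / 2 : ℝ) : ℂ) * ((k : ℂ) + 1)⁻¹ ∈ U := by
      intro k
      apply hball
      have h4 : (1 : ℝ) ≤ ‖((k : ℂ) + 1)‖ := by
        have : ((k : ℂ) + 1) = ((k + 1 : ℝ) : ℂ) := by push_cast; rfl
        rw [this, Complex.norm_real, Real.norm_of_nonneg (by positivity)]
        have : (0 : ℝ) ≤ k := Nat.cast_nonneg k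
        linarith
      rw [Metric.mem_closedBall, dist_eq_norm, add_sub_cancel_left, norm_mul, norm_inv,
        Complex.norm_real, Real.norm_of_nonneg (by linarith)]
      calc R / 2 * ‖((k : ℂ) + 1)‖⁻¹ ≤ R / 2 * 1 := by
            gcongr; exact inv_le_one_of_one_le₀ h4
        _ ≤ R := by linarith
    have hm := aestronglyMeasurable_of_tendsto_ae (μ := MeasureTheory.volume.restrict
      (Set.uIoc a b)) Filter.atTop (f := fun (k : ℕ) t => ((k : ℂ) + 1) •
        (f (s₀ + ((R / 2 : ℝ) : ℂ) * ((k : ℂ) + 1)⁻¹) t - f s₀ t))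
        (g := fun t => ((R / 2 : ℝ) : ℂ) • deriv (fun s => f s t) s₀)
        (fun k => (((hsec _ (hpt k)).sub (hsec _ hs₀)).const_smul _).aestronglyMeasurable)
        (Filter.Eventually.of_forall hlim)
    have h5 : ((R / 2 : ℝ) : ℂ) ≠ 0 := by
      exact_mod_cast (by positivity : (R / 2) ≠ 0)
    have := hm.const_smul (((R / 2 : ℝ) : ℂ)⁻¹)
    refine this.congr (Filter.Eventually.of_forall fun t => ?_)
    simp only [Pi.smul_apply]
    rw [inv_smul_smul₀ h5]
  · refine Filter.Eventually.of_forall fun t ht s hs => ?_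
    have hsub : Metric.closedBall s (R / 2) ⊆ Metric.closedBall s₀ R := by
      refine Metric.closedBall_subset_closedBall' ?_
      have := Metric.mem_ball.1 hs
      linarith
    refine Complex.norm_deriv_le_of_forall_mem_sphere_norm_le (by linarith) ?_ ?_
    · refine DifferentiableOn.diffContOnCl_ball (U := U) (hd t) (hsub.trans hball)
    · intro z hz
      exact hB (z, t) ⟨hsub (Metric.sphere_subset_closedBall hz), Set.uIoc_subset_uIcc ht⟩
  · exact Filter.Eventually.of_forall fun t _ s hs => hder t s hs

end parametric

/-! ### Cauchy's theorem on convex domains and their boundary curves. -/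

theorem integral_closed_curve_eq_zero {U : Set ℂ} (hU : IsOpen U) (hconv : Convex ℝ U)
    {f : ℂ → ℂ} (hf : DifferentiableOn ℂ f U) {T : ℝ} {γ γ' : ℝ → ℂ}
    (hγ : ∀ t, HasDerivAt γ (γ' t) t) (hγ' : Continuous γ') (hmem : ∀ t, γ t ∈ U)
    (hcl : γ T = γ 0) : ∫ t in (0 : ℝ)..T, f (γ t) * γ' t = 0 := by
  obtain ⟨g, hg⟩ := hconv.exists_forall_hasDerivWithinAt hf
  have hd : ∀ t, HasDerivAt (fun t => g (γ t)) (f (γ t) * γ' t) t := fun t =>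
    ((hg _ (hmem t)).hasDerivAt (hU.mem_nhds (hmem t))).comp t (hγ t)
  rw [intervalIntegral.integral_eq_sub_of_hasDerivAt (fun t _ => hd t), hcl, sub_self]
  have hc : Continuous γ := continuous_iff_continuousAt.2 fun t => (hγ t).continuousAt
  exact ((hf.continuousOn.comp_continuous hc hmem).mul hγ').intervalIntegrable _ _

namespace IsConvexDomainWithBoundary

variable {Ω : Set ℂ} {γ : ℝ → ℂ}

theorem mem_frontier (h : IsConvexDomainWithBoundary Ω γ) (t : ℝ) : γ t ∈ frontier Ω := by
  obtain ⟨y, hy, hyt⟩ := h.periodic.exists_mem_Ico₀ one_pos t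
  rw [hyt, ← h.image_eq]
  exact Set.mem_image_of_mem _ hy

/-- On the curve itself `f` is only continuous. Contracting the curve towards a point of `Ω` by a
factor r < 1 puts it where `f` is holomorphic; then r → 1. -/
theorem isCauchyLoop (h : IsConvexDomainWithBoundary Ω γ) :
    IsCauchyLoop Ω (closure Ω) Ω 1 γ (deriv γ) := by
  have hd : ∀ t, HasDerivAt γ (deriv γ t) t := fun t =>
    (h.contDiff.differentiable one_ne_zero t).hasDerivAt
  have hdc : Continuous (deriv γ) := h.contDiff.continuous_deriv le_rfl
  have hc : Continuous γ := h.contDiff.continuous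
  have hcl : γ 1 = γ 0 := by simpa using h.periodic 0
  have hfr : ∀ t, γ t ∈ frontier Ω := h.mem_frontier
  have hmem : ∀ t, γ t ∈ closure Ω := fun t => frontier_subset_closure (hfr t)
  have hint : interior Ω = Ω := h.isOpen.interior_eq
  refine ⟨h.isOpen, subset_closure, subset_rfl, zero_le_one, hd, hdc, hcl, hmem, ?_, ?_, ?_⟩
  · rintro f ⟨hf, hfc⟩
    obtain ⟨c, hcΩ⟩ := h.nonempty
    have hin : ∀ r : ℝ, 0 ≤ r → r < 1 → ∀ t, c + r * (γ t - c) ∈ Ω := by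
      intro r h0 h1 t
      have := h.convex.combo_interior_closure_mem_interior (hint.symm ▸ hcΩ) (hmem t)
        (sub_pos.2 h1) h0 (by ring)
      rw [hint] at this
      convert this using 1
      simp only [Complex.real_smul, Complex.ofReal_sub, Complex.ofReal_one]
      ring
    have hincl : ∀ r : ℝ, 0 ≤ r → r ≤ 1 → ∀ t, c + r * (γ t - c) ∈ closure Ω := by
      intro r h0 h1 t
      have := h.convex.closure (subset_closure hcΩ) (hmem t) (sub_nonneg.2 h1) h0 (by ring)
      convert this using 1
      simp only [Complex.real_smul, Complex.ofReal_sub, Complex.ofReal_one]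
      ring
    -- Clamping r to [0, 1] keeps the contracted curve in the closure, so the integral is continuous
    -- in every real r.
    have hcont : Continuous fun r : ℝ => ∫ t in (0 : ℝ)..1,
        f (c + ((Set.projIcc (0 : ℝ) 1 zero_le_one r : ℝ) : ℂ) * (γ t - c)) * deriv γ t := by
      refine intervalIntegral.continuous_parametric_intervalIntegral_of_continuous' ?_ 0 1
      refine Continuous.mul ?_ (by fun_prop)
      refine hfc.comp_continuous ?_ fun q => ?_
      · have : Continuous fun q : ℝ × ℝ => (Set.projIcc (0 : ℝ) 1 zero_le_one q.1 : ℝ) :=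
          continuous_subtype_val.comp (continuous_projIcc.comp continuous_fst)
        fun_prop
      · exact hincl _ (Set.projIcc (0 : ℝ) 1 zero_le_one q.1).2.1
          (Set.projIcc (0 : ℝ) 1 zero_le_one q.1).2.2 q.2
    have hzero : ∀ r ∈ Set.Ioo (0 : ℝ) 1, ∫ t in (0 : ℝ)..1,
        f (c + ((Set.projIcc (0 : ℝ) 1 zero_le_one r : ℝ) : ℂ) * (γ t - c)) * deriv γ t = 0 := by
      intro r hr
      rw [Set.projIcc_of_mem zero_le_one ⟨hr.1.le, hr.2.le⟩]
      have hr0 : (r : ℂ) ≠ 0 := by exact_mod_cast hr.1.ne'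
      have := integral_closed_curve_eq_zero h.isOpen h.convex hf (T := 1)
        (γ := fun t => c + r * (γ t - c)) (γ' := fun t => r * deriv γ t)
        (fun t => (((hd t).sub_const c).const_mul (r : ℂ)).const_add c)
        (continuous_const.mul hdc) (hin r hr.1.le hr.2) (by simp only [hcl])
      have e : ∀ t, f (c + r * (γ t - c)) * deriv γ t =
          (r : ℂ)⁻¹ * (f (c + r * (γ t - c)) * (r * deriv γ t)) := by
        intro t; field_simp
      simp only [e]
      rw [intervalIntegral.integral_const_mul, this, mul_zero]
    have hcl1 : (1 : ℝ) ∈ closure (Set.Ioo (0 : ℝ) 1) := by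
      rw [closure_Ioo zero_ne_one]; exact ⟨zero_le_one, le_rfl⟩
    have := (isClosed_singleton (x := (0 : ℂ))).preimage hcont |>.closure_subset_iff.2 hzero hcl1
    simpa using this
  · intro w hw t ht
    have := hfr t
    rw [frontier, hint, ht] at this
    exact this.2 hw
  · intro w hw
    have := h.winding w hw
    rwa [inv_mul_eq_iff_eq_mul₀ Complex.two_pi_I_ne_zero, mul_one] at this

end IsConvexDomainWithBoundary

/-! ### Convex bodies with C² support function and their boundary curves. -/

/-- A `C²` support function `h` of a planar convex body, with its first two derivatives. -/
structure IsSupportFn (h h' h'' : ℝ → ℝ) : Prop where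
  hasDerivAt : ∀ t, HasDerivAt h (h' t) t
  hasDerivAt' : ∀ t, HasDerivAt h' (h'' t) t
  continuous'' : Continuous h''
  periodic : Function.Periodic h (2 * Real.pi)
  periodic' : Function.Periodic h' (2 * Real.pi)
  nonneg : ∀ t, 0 ≤ h t + h'' t

/-- The direction `e^{-iθ}`. -/
noncomputable def rot (θ : ℝ) : ℂ := Complex.exp (-(θ * Complex.I))

/-- The open convex set with support function `h`. -/
def supportBody (h : ℝ → ℝ) : Set ℂ := {z | ∀ θ, (rot θ * z).re < h θ}

/-- The boundary curve of the convex body with support function `h`. -/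
noncomputable def supportCurve (h h' : ℝ → ℝ) (t : ℝ) : ℂ :=
  Complex.exp (t * Complex.I) * (h t + h' t * Complex.I)

/-- The derivative of `supportCurve`. -/
noncomputable def supportCurveDeriv (h h'' : ℝ → ℝ) (t : ℝ) : ℂ :=
  Complex.I * Complex.exp (t * Complex.I) * (h t + h'' t : ℝ)

theorem continuous_rot : Continuous rot := by
  unfold rot; fun_prop

theorem norm_rot (θ : ℝ) : ‖rot θ‖ = 1 := by
  have := Complex.norm_exp_ofReal_mul_I (-θ)
  rw [rot, ← this]
  congr 2
  push_cast; ring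

theorem rot_eq (θ : ℝ) : rot θ = Real.cos θ - Real.sin θ * Complex.I := by
  have : (-(θ * Complex.I) : ℂ) = ((-θ : ℝ) : ℂ) * Complex.I := by push_cast; ring
  rw [rot, this, Complex.exp_mul_I, ← Complex.ofReal_cos, ← Complex.ofReal_sin, Real.cos_neg,
    Real.sin_neg]
  push_cast; ring

theorem rot_periodic : Function.Periodic rot (2 * Real.pi) := by
  intro θ
  rw [rot_eq, rot_eq, Real.cos_add_two_pi, Real.sin_add_two_pi]

theorem rot_mul_exp (θ t : ℝ) :
    rot θ * Complex.exp (t * Complex.I) = Real.cos (t - θ) + Real.sin (t - θ) * Complex.I := by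
  rw [rot, ← Complex.exp_add]
  have : (-(θ * Complex.I) + t * Complex.I : ℂ) = ((t - θ : ℝ) : ℂ) * Complex.I := by
    push_cast; ring
  rw [this, Complex.exp_mul_I, ← Complex.ofReal_cos, ← Complex.ofReal_sin]

theorem exp_mul_rot (θ : ℝ) : Complex.exp (θ * Complex.I) * rot θ = 1 := by
  rw [mul_comm, rot_mul_exp]; simp

theorem rot_arg_mul (z : ℂ) : rot z.arg * z = ‖z‖ := by
  conv_lhs => rw [← Complex.norm_mul_exp_arg_mul_I z, ← mul_assoc, mul_comm (rot _), mul_assoc]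
  rw [Complex.norm_mul_exp_arg_mul_I, mul_comm (rot _), exp_mul_rot, mul_one]

theorem supportBody_convex (h : ℝ → ℝ) : Convex ℝ (supportBody h) := by
  intro x hx y hy a b ha hb hab θ
  have h1 := hx θ
  have h2 := hy θ
  have : (rot θ * (a • x + b • y)).re = a * (rot θ * x).re + b * (rot θ * y).re := by
    rw [mul_add, Complex.add_re, mul_smul_comm, mul_smul_comm, Complex.smul_re, Complex.smul_re,
      smul_eq_mul, smul_eq_mul]
  rw [this]
  have hb' : b = 1 - a := by linarith
  subst hb'
  rcases ha.eq_or_lt with rfl | ha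
  · simpa using h2
  · nlinarith [mul_lt_mul_of_pos_left h1 ha, mul_le_mul_of_nonneg_left h2.le hb]

theorem supportBody_mono {h k : ℝ → ℝ} (hk : ∀ t, h t ≤ k t) : supportBody h ⊆ supportBody k :=
  fun _ hz θ => (hz θ).trans_le (hk θ)

theorem supportBody_add_subset (h : ℝ → ℝ) {s t : ℝ} (hst : s ≤ t) :
    supportBody (fun θ => h θ + s) ⊆ supportBody (fun θ => h θ + t) :=
  supportBody_mono fun _ => by linarith

theorem subset_supportBody_add (h : ℝ → ℝ) {t : ℝ} (ht : 0 ≤ t) :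
    supportBody h ⊆ supportBody (fun θ => h θ + t) :=
  supportBody_mono fun _ => by linarith

theorem supportBody_isOpen {h : ℝ → ℝ} (hc : Continuous h)
    (hp : Function.Periodic h (2 * Real.pi)) : IsOpen (supportBody h) := by
  rw [isOpen_iff_mem_nhds]
  intro z hz
  have h1 : ∀ᶠ w in nhds z, ∀ θ ∈ Set.Icc (0 : ℝ) (2 * Real.pi), (rot θ * w).re < h θ := by
    refine isCompact_Icc.eventually_forall_of_forall_eventually fun θ _ => ?_
    have hcont : Continuous fun q : ℂ × ℝ => h q.2 - (rot q.2 * q.1).re :=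
      (hc.comp continuous_snd).sub (Complex.continuous_re.comp
        ((continuous_rot.comp continuous_snd).mul continuous_fst))
    filter_upwards [hcont.continuousAt.eventually (lt_mem_nhds (sub_pos.2 (hz θ)))] with q hq
    exact sub_pos.1 hq
  filter_upwards [h1] with w hw θ
  have hper : Function.Periodic (fun θ => h θ - (rot θ * w).re) (2 * Real.pi) := by
    intro θ; simp only [hp θ, rot_periodic θ]
  obtain ⟨y, hy, hyt⟩ := hper.exists_mem_Ico₀ Real.two_pi_pos θ
  have := sub_pos.2 (hw y ⟨hy.1, hy.2.le⟩)
  rw [← hyt] at this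
  exact sub_pos.1 this

namespace IsSupportFn

variable {h h' h'' : ℝ → ℝ}

theorem continuous (H : IsSupportFn h h' h'') : Continuous h :=
  continuous_iff_continuousAt.2 fun t => (H.hasDerivAt t).continuousAt

theorem isOpen (H : IsSupportFn h h' h'') : IsOpen (supportBody h) :=
  supportBody_isOpen H.continuous H.periodic

/-- The parallel body at distance `s`. These bodies are the shrinking collars of the iteration in
`norm_kronHfc_le`. -/
theorem add_const (H : IsSupportFn h h' h'') {s : ℝ} (hs : 0 ≤ s) :
    IsSupportFn (fun t => h t + s) h' h'' :=
  ⟨fun t => (H.hasDerivAt t).add_const s, H.hasDerivAt', H.continuous'',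
    fun t => by simp only [H.periodic t], H.periodic', fun t => by have := H.nonneg t; linarith⟩

theorem exists_bound (H : IsSupportFn h h' h'') : ∃ B, ∀ t, h t ≤ B := by
  obtain ⟨B, hB⟩ := (isCompact_Icc (a := (0 : ℝ)) (b := 2 * Real.pi)).exists_bound_of_continuousOn
    H.continuous.continuousOn
  refine ⟨B, fun t => ?_⟩
  obtain ⟨y, hy, hyt⟩ := H.periodic.exists_mem_Ico₀ Real.two_pi_pos t
  rw [hyt]
  exact (le_abs_self _).trans (hB y ⟨hy.1, hy.2.le⟩)

theorem isBounded (H : IsSupportFn h h' h'') : Bornology.IsBounded (supportBody h) := by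
  obtain ⟨B, hB⟩ := H.exists_bound
  refine isBounded_iff_forall_norm_le.2 ⟨B, fun z hz => ?_⟩
  have h1 := hz z.arg
  rw [rot_arg_mul, Complex.ofReal_re] at h1
  exact h1.le.trans (hB _)

theorem hasDerivAt_curve (H : IsSupportFn h h' h'') (t : ℝ) :
    HasDerivAt (supportCurve h h') (supportCurveDeriv h h'' t) t := by
  have h1 : HasDerivAt (fun t : ℝ => Complex.exp (t * Complex.I))
      (Complex.exp (t * Complex.I) * (1 * Complex.I)) t :=
    ((Complex.ofRealCLM.hasDerivAt (x := t)).mul_const Complex.I).cexp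
  have h2 := (H.hasDerivAt t).ofReal_comp.add ((H.hasDerivAt' t).ofReal_comp.mul_const Complex.I)
  convert! h1.mul h2 using 1
  simp only [supportCurveDeriv, Complex.ofReal_add, Pi.add_apply]
  linear_combination (-Complex.exp (t * Complex.I) * h' t) * Complex.I_sq

theorem continuous_curve (H : IsSupportFn h h' h'') : Continuous (supportCurve h h') :=
  continuous_iff_continuousAt.2 fun t => (H.hasDerivAt_curve t).continuousAt

theorem continuous_curveDeriv (H : IsSupportFn h h' h'') :
    Continuous (supportCurveDeriv h h'') := by
  have := H.continuous
  have := H.continuous''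
  unfold supportCurveDeriv
  fun_prop

theorem periodic_curve (H : IsSupportFn h h' h'') :
    Function.Periodic (supportCurve h h') (2 * Real.pi) := by
  intro t
  rw [supportCurve, supportCurve, H.periodic t, H.periodic' t]
  congr 1
  rw [Complex.ofReal_add, add_mul, Complex.exp_add]
  push_cast
  rw [Complex.exp_two_pi_mul_I, mul_one]

theorem rot_mul_curve_re (θ t : ℝ) :
    (rot θ * supportCurve h h' t).re = Real.cos (t - θ) * h t - Real.sin (t - θ) * h' t := by
  rw [supportCurve, ← mul_assoc, rot_mul_exp]
  simp [Complex.mul_re, -Complex.ofReal_cos, -Complex.ofReal_sin]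

theorem rot_mul_curve_self_re (t : ℝ) : (rot t * supportCurve h h' t).re = h t := by
  rw [rot_mul_curve_re]; simp

/-- The t-derivative of the left side is −sin(t − θ)(h + h''). Since h + h'', the radius of
curvature, is nonnegative, the function increases on [θ − π, θ] and decreases on [θ, θ + π], with
maximum h(θ) at t = θ. -/
theorem rot_mul_curve_re_le (H : IsSupportFn h h' h'') (θ t : ℝ) :
    (rot θ * supportCurve h h' t).re ≤ h θ := by
  have hper : Function.Periodic (fun t => (rot θ * supportCurve h h' t).re) (2 * Real.pi) :=
    fun t => by simp only [H.periodic_curve t]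
  obtain ⟨y, hy, hyt⟩ := hper.exists_mem_Ico Real.two_pi_pos t (θ - Real.pi)
  rw [hyt]
  have hd : ∀ t, HasDerivAt (fun t => (rot θ * supportCurve h h' t).re)
      (-Real.sin (t - θ) * (h t + h'' t)) t := by
    intro t
    have h1 : HasDerivAt (fun t : ℝ => t - θ) 1 t := (hasDerivAt_id t).sub_const θ
    have h2 := (h1.cos.mul (H.hasDerivAt t)).sub (h1.sin.mul (H.hasDerivAt' t))
    simp only [rot_mul_curve_re]
    convert! h2 using 1
    ring
  have hcont : Continuous fun t => (rot θ * supportCurve h h' t).re :=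
    continuous_iff_continuousAt.2 fun t => (hd t).continuousAt
  rw [← rot_mul_curve_self_re (h := h) (h' := h') θ]
  have hpi := Real.pi_pos
  rcases le_total y θ with hle | hle
  · refine monotoneOn_of_deriv_nonneg (convex_Icc (θ - Real.pi) θ) hcont.continuousOn
      (fun t _ => (hd t).differentiableAt.differentiableWithinAt) (fun t ht => ?_)
      ⟨hy.1, hle⟩ ⟨by linarith, le_rfl⟩ hle
    rw [interior_Icc] at ht
    rw [(hd t).deriv, ← Real.sin_neg]
    exact mul_nonneg (Real.sin_nonneg_of_nonneg_of_le_pi (by linarith [ht.2]) (by linarith [ht.1]))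
      (H.nonneg t)
  · refine antitoneOn_of_deriv_nonpos (convex_Icc θ (θ + Real.pi)) hcont.continuousOn
      (fun t _ => (hd t).differentiableAt.differentiableWithinAt) (fun t ht => ?_)
      ⟨le_rfl, by linarith⟩ ⟨hle, by linarith [hy.2]⟩ hle
    rw [interior_Icc] at ht
    rw [(hd t).deriv, neg_mul]
    exact neg_nonpos.2 (mul_nonneg (Real.sin_nonneg_of_nonneg_of_le_pi (by linarith [ht.1])
      (by linarith [ht.2])) (H.nonneg t))

theorem curve_mem_add (H : IsSupportFn h h' h'') {s : ℝ} (hs : 0 < s) (t : ℝ) :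
    supportCurve h h' t ∈ supportBody (fun θ => h θ + s) :=
  fun θ => (H.rot_mul_curve_re_le θ t).trans_lt (by linarith)

theorem curve_notMem (t : ℝ) : supportCurve h h' t ∉ supportBody h := fun hmem => by
  have := hmem t
  rw [rot_mul_curve_self_re] at this
  exact lt_irrefl _ this

/-- Rotated by its normal direction, γ(t) − z stays in the right half-plane, so the principal
logarithm in `logCurve` is smooth along the whole curve. -/
theorem re_rot_mul_sub_pos {z : ℂ} (hz : z ∈ supportBody h) (t : ℝ) :
    0 < (rot t * (supportCurve h h' t - z)).re := by
  rw [mul_sub, Complex.sub_re, rot_mul_curve_self_re]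
  exact sub_pos.2 (hz t)

theorem rot_mul_curveDeriv (t : ℝ) :
    rot t * supportCurveDeriv h h'' t = Complex.I * (h t + h'' t : ℝ) := by
  rw [supportCurveDeriv]
  linear_combination (Complex.I * (h t + h'' t : ℝ)) * exp_mul_rot t

/-- A continuous logarithm of `γ - z` along the boundary curve `γ`. -/
noncomputable def logCurve (h h' : ℝ → ℝ) (z : ℂ) (t : ℝ) : ℂ :=
  t * Complex.I + Complex.log (rot t * (supportCurve h h' t - z))

theorem exp_logCurve {z : ℂ} (hz : z ∈ supportBody h) (t : ℝ) :
    Complex.exp (logCurve h h' z t) = supportCurve h h' t - z := by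
  have hne : rot t * (supportCurve h h' t - z) ≠ 0 := fun h0 => by
    have := re_rot_mul_sub_pos (h' := h') hz t
    rw [h0] at this
    simp at this
  rw [logCurve, Complex.exp_add, Complex.exp_log hne, ← mul_assoc, exp_mul_rot, one_mul]

theorem hasDerivAt_logCurve (H : IsSupportFn h h' h'') {z : ℂ} (hz : z ∈ supportBody h) (t : ℝ) :
    HasDerivAt (logCurve h h' z) ((supportCurve h h' t - z)⁻¹ * supportCurveDeriv h h'' t) t := by
  have hpos := re_rot_mul_sub_pos (h' := h') hz t
  have hrot : HasDerivAt rot (rot t * -(1 * Complex.I)) t :=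
    (((Complex.ofRealCLM.hasDerivAt (x := t)).mul_const Complex.I).neg).cexp
  have hrne : rot t ≠ 0 := by
    have := norm_rot t
    intro h0
    rw [h0] at this
    simp at this
  have hne : supportCurve h h' t - z ≠ 0 := fun h0 => by
    rw [h0] at hpos
    simp at hpos
  have h1 := (hrot.mul ((H.hasDerivAt_curve t).sub_const z)).clog_real (Or.inl hpos)
  have h2 := ((Complex.ofRealCLM.hasDerivAt (x := t)).mul_const Complex.I).add h1
  convert! h2 using 1
  simp only [Pi.mul_apply, Complex.ofRealCLM_apply, Complex.ofReal_one]
  field_simp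
  ring

/-- The principal logarithm is evaluated at a periodic quantity; the summand tI alone accounts for
the winding number. -/
theorem logCurve_two_pi (H : IsSupportFn h h' h'') (z : ℂ) :
    logCurve h h' z (2 * Real.pi) = logCurve h h' z 0 + 2 * Real.pi * Complex.I := by
  have h1 := H.periodic_curve 0
  have h2 := rot_periodic 0
  rw [zero_add] at h1 h2
  rw [logCurve, logCurve, h1, h2]
  push_cast
  ring

/-- Here the curve runs inside an open convex `U` where functions are holomorphic, so a primitive
gives Cauchy's theorem without a limit. -/
theorem isCauchyLoop (H : IsSupportFn h h' h'') {U D : Set ℂ} (hU : IsOpen U)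
    (hconv : Convex ℝ U) (hmem : ∀ t, supportCurve h h' t ∈ U) (hD : D ⊆ supportBody h)
    (hDU : D ⊆ U) :
    IsCauchyLoop U U D (2 * Real.pi) (supportCurve h h') (supportCurveDeriv h h'') := by
  have hcl : supportCurve h h' (2 * Real.pi) = supportCurve h h' 0 := by
    simpa using H.periodic_curve 0
  have hne : ∀ w ∈ D, ∀ t, supportCurve h h' t ≠ w := fun w hw t ht =>
    curve_notMem (h := h) (h' := h') t (ht ▸ hD hw)
  refine ⟨hU, subset_rfl, hDU, Real.two_pi_pos.le, H.hasDerivAt_curve, H.continuous_curveDeriv,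
    hcl, hmem, fun f hf => integral_closed_curve_eq_zero hU hconv hf.1 H.hasDerivAt_curve
    H.continuous_curveDeriv hmem hcl, hne, fun w hw => ?_⟩
  rw [intervalIntegral.integral_eq_sub_of_hasDerivAt
    (fun t _ => H.hasDerivAt_logCurve (hD hw) t), H.logCurve_two_pi]
  · ring
  · exact (((H.continuous_curve.sub continuous_const).inv₀ fun t =>
      sub_ne_zero.2 (hne w hw t)).mul H.continuous_curveDeriv).intervalIntegrable _ _

end IsSupportFn

/-! ### The double layer potential and the bound for Cauchy transforms. -/

/-- A continuous cutoff, equal to `1` on `(-∞, s]` and to `0` on `[2s, ∞)`. -/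
noncomputable def cutoff (s c : ℝ) : ℝ := max 0 (min 1 (2 - c / s))

theorem cutoff_nonneg (s c : ℝ) : 0 ≤ cutoff s c := le_max_left _ _

theorem cutoff_le_one (s c : ℝ) : cutoff s c ≤ 1 := max_le zero_le_one (min_le_left _ _)

theorem continuous_cutoff (s : ℝ) : Continuous (cutoff s) := by
  unfold cutoff; fun_prop

theorem cutoff_eq_one {s c : ℝ} (hs : 0 < s) (hc : c ≤ s) : cutoff s c = 1 := by
  have : c / s ≤ 1 := (div_le_one hs).2 hc
  rw [cutoff, min_eq_left (by linarith), max_eq_right zero_le_one]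

theorem cutoff_eq_zero {s c : ℝ} (hs : 0 < s) (hc : 2 * s ≤ c) : cutoff s c = 0 := by
  have : 2 ≤ c / s := (le_div_iff₀ hs).2 hc
  exact max_eq_left ((min_le_right _ _).trans (by linarith))

/-- The cutoff is a continuous stand-in for the indicator of cos ≤ 0, a set of length π per period.
The overshoot is controlled by cos x ≥ 1 − 2x/π, which makes the cutoff vanish on [0, π/2 − πs]. -/
theorem integral_cutoff_cos_le {s : ℝ} (hs : 0 < s) (a : ℝ) :
    ∫ x in a..(a + 2 * Real.pi), cutoff s (Real.cos x) ≤ Real.pi + 2 * Real.pi * s := by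
  have hpi := Real.pi_pos
  have hc : Continuous fun x => cutoff s (Real.cos x) :=
    (continuous_cutoff s).comp Real.continuous_cos
  have hper : Function.Periodic (fun x => cutoff s (Real.cos x)) (2 * Real.pi) := fun x => by
    simp only [Real.cos_add_two_pi]
  have hint : ∀ a b, IntervalIntegrable (fun x => cutoff s (Real.cos x))
      MeasureTheory.volume a b := fun a b => hc.intervalIntegrable a b
  have hhalf : ∫ x in (0 : ℝ)..Real.pi, cutoff s (Real.cos x) ≤ Real.pi / 2 + Real.pi * s := by
    rcases le_total (1 / 2) s with h1 | h1
    · calc ∫ x in (0 : ℝ)..Real.pi, cutoff s (Real.cos x) ≤ ∫ _ in (0 : ℝ)..Real.pi, (1 : ℝ) :=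
            intervalIntegral.integral_mono_on hpi.le (hint _ _)
              (continuous_const.intervalIntegrable _ _) fun x _ => cutoff_le_one _ _
        _ = Real.pi := by simp
        _ ≤ _ := by nlinarith
    · have hb : 0 ≤ Real.pi / 2 - Real.pi * s := by nlinarith
      rw [← intervalIntegral.integral_add_adjacent_intervals (hint 0 (Real.pi / 2 - Real.pi * s))
        (hint _ Real.pi)]
      have e1 : ∫ x in (0 : ℝ)..(Real.pi / 2 - Real.pi * s), cutoff s (Real.cos x) = 0 := by
        rw [intervalIntegral.integral_congr (g := fun _ => (0 : ℝ)), intervalIntegral.integral_zero]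
        intro x hx
        rw [Set.uIcc_of_le hb] at hx
        refine cutoff_eq_zero hs ?_
        have := Real.one_sub_mul_le_cos hx.1 (by nlinarith [hx.2])
        have h2 : 2 / Real.pi * x ≤ 2 / Real.pi * (Real.pi / 2 - Real.pi * s) := by
          gcongr; exact hx.2
        have h3 : 2 / Real.pi * (Real.pi / 2 - Real.pi * s) = 1 - 2 * s := by
          field_simp
        linarith
      have e2 : ∫ x in (Real.pi / 2 - Real.pi * s)..Real.pi, cutoff s (Real.cos x) ≤
          ∫ _ in (Real.pi / 2 - Real.pi * s)..Real.pi, (1 : ℝ) :=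
        intervalIntegral.integral_mono_on (by nlinarith) (hint _ _)
          (continuous_const.intervalIntegrable _ _) fun x _ => cutoff_le_one _ _
      rw [intervalIntegral.integral_const, smul_eq_mul, mul_one] at e2
      linarith
  have hneg : ∫ x in (-Real.pi)..0, cutoff s (Real.cos x) =
      ∫ x in (0 : ℝ)..Real.pi, cutoff s (Real.cos x) := by
    have := intervalIntegral.integral_comp_neg (a := 0) (b := Real.pi)
      (fun x => cutoff s (Real.cos x))
    simp only [Real.cos_neg, neg_zero] at this
    exact this.symm
  rw [hper.intervalIntegral_add_eq a (-Real.pi), show -Real.pi + 2 * Real.pi = Real.pi by ring,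
    ← intervalIntegral.integral_add_adjacent_intervals (hint (-Real.pi) 0) (hint 0 Real.pi), hneg]
  linarith

namespace IsSupportFn

variable {h h' h'' : ℝ → ℝ}

/-- The logarithmic derivative `γ' / (γ - z)` of the boundary curve. -/
noncomputable def logDerivCurve (h h' h'' : ℝ → ℝ) (z : ℂ) (t : ℝ) : ℂ :=
  (supportCurve h h' t - z)⁻¹ * supportCurveDeriv h h'' t

theorem curve_sub_ne_zero {z : ℂ} (hz : z ∈ supportBody h) (t : ℝ) :
    supportCurve h h' t - z ≠ 0 := fun h0 => by
  have := re_rot_mul_sub_pos (h' := h') hz t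
  rw [h0] at this
  simp at this

theorem continuousOn_logDerivCurve (H : IsSupportFn h h' h'') :
    ContinuousOn (Function.uncurry (logDerivCurve h h' h'')) (supportBody h ×ˢ Set.univ) := by
  have h1 := H.continuous_curve
  have h2 := H.continuous_curveDeriv
  refine ContinuousOn.mul (ContinuousOn.inv₀ (by fun_prop) fun q hq => ?_) (by fun_prop)
  exact curve_sub_ne_zero hq.1 q.2

theorem continuous_logDerivCurve (H : IsSupportFn h h' h'') {z : ℂ} (hz : z ∈ supportBody h) :
    Continuous (logDerivCurve h h' h'' z) :=
  H.continuousOn_logDerivCurve.comp_continuous (f := fun t => (z, t)) (by fun_prop)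
    fun _ => ⟨hz, trivial⟩

/-- Seen from an interior point of a convex body, the argument of the boundary point never
decreases: with w = e^{−it}(γ − z), the kernel is i(h + h'')/w and Re w > 0. -/
theorem im_logDerivCurve_nonneg (H : IsSupportFn h h' h'') {z : ℂ} (hz : z ∈ supportBody h)
    (t : ℝ) : 0 ≤ (logDerivCurve h h' h'' z t).im := by
  have hpos := re_rot_mul_sub_pos (h' := h') hz t
  set w := rot t * (supportCurve h h' t - z) with hw
  have hrne : rot t ≠ 0 := fun h0 => by
    rw [hw, h0] at hpos; simp at hpos
  have hne := curve_sub_ne_zero (h' := h') hz t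
  have e : logDerivCurve h h' h'' z t = ((h t + h'' t : ℝ) : ℂ) * (Complex.I * w⁻¹) := by
    rw [logDerivCurve, hw, mul_inv, ← mul_assoc Complex.I]
    have := rot_mul_curveDeriv (h := h) (h'' := h'') t
    field_simp
    linear_combination this
  rw [e, Complex.im_ofReal_mul]
  refine mul_nonneg (H.nonneg t) ?_
  rw [Complex.I_mul_im, Complex.inv_re]
  exact div_nonneg hpos.le (Complex.normSq_nonneg _)

theorem integral_im_logDerivCurve (H : IsSupportFn h h' h'') {z : ℂ} (hz : z ∈ supportBody h) :
    ∫ t in (0 : ℝ)..(2 * Real.pi), (logDerivCurve h h' h'' z t).im = 2 * Real.pi := by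
  have hd : ∀ t, HasDerivAt (fun t => (logCurve h h' z t).im)
      (logDerivCurve h h' h'' z t).im t := fun t =>
    (Complex.imCLM.hasFDerivAt.comp_hasDerivAt t (H.hasDerivAt_logCurve hz t))
  rw [intervalIntegral.integral_eq_sub_of_hasDerivAt (fun t _ => hd t), H.logCurve_two_pi]
  · simp
  · exact (Complex.continuous_im.comp (H.continuous_logDerivCurve hz)).intervalIntegrable _ _

theorem cos_im_logCurve {z : ℂ} (hz : z ∈ supportBody h) (θ t : ℝ) :
    ‖supportCurve h h' t - z‖ * Real.cos ((logCurve h h' z t).im - θ) =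
      (rot θ * (supportCurve h h' t - z)).re := by
  have e := exp_logCurve (h' := h') hz t
  set L := logCurve h h' z t
  rw [← e, Complex.norm_exp]
  have : Complex.exp L = Real.exp L.re * Complex.exp (L.im * Complex.I) := by
    rw [Complex.ofReal_exp, ← Complex.exp_add, Complex.re_add_im]
  rw [this, mul_left_comm, rot_mul_exp, Complex.re_ofReal_mul]
  simp [-Complex.ofReal_cos, -Complex.ofReal_sin]

/-- Substitute x = arg(γ(t) − z) − θ, which advances by exactly 2π around the curve. -/
theorem integral_cutoff_le (H : IsSupportFn h h' h'') {z : ℂ} (hz : z ∈ supportBody h)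
    {s : ℝ} (hs : 0 < s) (θ : ℝ) :
    ∫ t in (0 : ℝ)..(2 * Real.pi), cutoff s (Real.cos ((logCurve h h' z t).im - θ)) *
      (logDerivCurve h h' h'' z t).im ≤ Real.pi + 2 * Real.pi * s := by
  have hd : ∀ t, HasDerivAt (fun t => (logCurve h h' z t).im - θ)
      (logDerivCurve h h' h'' z t).im t := fun t =>
    (Complex.imCLM.hasFDerivAt.comp_hasDerivAt t (H.hasDerivAt_logCurve hz t)).sub_const θ
  have key := intervalIntegral.integral_comp_mul_deriv (a := 0) (b := 2 * Real.pi)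
    (f := fun t => (logCurve h h' z t).im - θ) (f' := fun t => (logDerivCurve h h' h'' z t).im)
    (g := fun x => cutoff s (Real.cos x)) (fun t _ => hd t)
    (Complex.continuous_im.comp (H.continuous_logDerivCurve hz)).continuousOn
    ((continuous_cutoff s).comp Real.continuous_cos)
  simp only [Function.comp_apply] at key
  rw [key, H.logCurve_two_pi]
  have e : (logCurve h h' z 0 + 2 * Real.pi * Complex.I).im - θ =
      ((logCurve h h' z 0).im - θ) + 2 * Real.pi := by
    simp; ring
  rw [e]
  exact integral_cutoff_cos_le hs _

section cauchyTransform

variable {E : Type*} [NormedAddCommGroup E] [NormedSpace ℂ E]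

/-- The Cauchy transform `(2πi)⁻¹ ∮ Φ(σ) / (σ - z) dσ` along the boundary curve. -/
noncomputable def cauchyTransform (h h' h'' : ℝ → ℝ) (Φ : ℂ → E) (z : ℂ) : E :=
  (2 * Real.pi * Complex.I : ℂ)⁻¹ • ∫ t in (0 : ℝ)..(2 * Real.pi),
    logDerivCurve h h' h'' z t • Φ (supportCurve h h' t)

theorem differentiableOn_cauchyTransform [CompleteSpace E] (H : IsSupportFn h h' h'') {Φ : ℂ → E}
    (hΦ : Continuous fun t => Φ (supportCurve h h' t)) :
    DifferentiableOn ℂ (cauchyTransform h h' h'' Φ) (supportBody h) := by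
  refine DifferentiableOn.const_smul (differentiableOn_intervalIntegral_param H.isOpen ?_ ?_ _ _) _
  · refine ContinuousOn.smul H.continuousOn_logDerivCurve ?_
    exact (hΦ.comp continuous_snd).continuousOn
  · intro t
    refine DifferentiableOn.smul_const (DifferentiableOn.mul_const (DifferentiableOn.inv
      ((differentiableOn_const _).sub differentiableOn_id) fun z hz => ?_) _) _
    exact curve_sub_ne_zero hz t

/-- The double layer potential representation. -/
theorem cauchyTransform_add (H : IsSupportFn h h' h'') {Φ : ℂ → E}
    (hΦ : Continuous fun t => Φ (supportCurve h h' t)) {z : ℂ} (hz : z ∈ supportBody h)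
    (hconj : (2 * Real.pi * Complex.I : ℂ)⁻¹ • ∫ t in (0 : ℝ)..(2 * Real.pi),
      (starRingEnd ℂ) (logDerivCurve h h' h'' z t) • Φ (supportCurve h h' t) = -Φ z) :
    cauchyTransform h h' h'' Φ z + Φ z = ∫ t in (0 : ℝ)..(2 * Real.pi),
      (((logDerivCurve h h' h'' z t).im / Real.pi : ℝ) : ℂ) • Φ (supportCurve h h' t) := by
  have c1 := H.continuous_logDerivCurve hz
  have c2 := Complex.continuous_conj.comp c1
  rw [← neg_neg (Φ z), ← hconj, ← sub_eq_add_neg, cauchyTransform, ← smul_sub,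
    ← intervalIntegral.integral_sub, ← intervalIntegral.integral_smul]
  · refine intervalIntegral.integral_congr fun t _ => ?_
    rw [← sub_smul, smul_smul]
    congr 1
    rw [Complex.sub_conj]
    have := Complex.ofReal_ne_zero.2 Real.pi_ne_zero
    have := Complex.I_ne_zero
    push_cast
    field_simp
  · exact (c1.smul hΦ).intervalIntegrable _ _
  · exact (c2.smul hΦ).intervalIntegrable _ _

/-- The assumption `hθ` puts z within sδ of the supporting line with normal θ. From such a z, curve
points farther than δ appear at an angle whose cosine against θ is at most s, so they carry mass at
most 1 + 2s of the total 2. The remaining mass multiplies values within ω of Φ(z). -/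
theorem norm_cauchyTransform_le (H : IsSupportFn h h' h'') {Φ : ℂ → E}
    (hΦ : Continuous fun t => Φ (supportCurve h h' t))
    (hΦ1 : ∀ t, ‖Φ (supportCurve h h' t)‖ ≤ 1) {z : ℂ} (hz : z ∈ supportBody h) (hz1 : ‖Φ z‖ ≤ 1)
    (hconj : (2 * Real.pi * Complex.I : ℂ)⁻¹ • ∫ t in (0 : ℝ)..(2 * Real.pi),
      (starRingEnd ℂ) (logDerivCurve h h' h'' z t) • Φ (supportCurve h h' t) = -Φ z)
    {s δ ω θ : ℝ} (hs : 0 < s) (hδ : 0 < δ) (hω : 0 ≤ ω)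
    (hclose : ∀ t, ‖supportCurve h h' t - z‖ < δ → ‖Φ (supportCurve h h' t) - Φ z‖ ≤ ω)
    (hθ : h θ - (rot θ * z).re ≤ s * δ) :
    ‖cauchyTransform h h' h'' Φ z‖ ≤ 1 + 4 * s + 2 * ω := by
  have hpi := Real.pi_pos
  have h2pi := Real.two_pi_pos
  set γ := supportCurve h h' with hγ
  set μ : ℝ → ℝ := fun t => (logDerivCurve h h' h'' z t).im / Real.pi with hμ
  set ψ : ℝ → ℝ := fun t => cutoff s (Real.cos ((logCurve h h' z t).im - θ)) with hψ
  have cL : Continuous (logCurve h h' z) :=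
    continuous_iff_continuousAt.2 fun t => (H.hasDerivAt_logCurve hz t).continuousAt
  have cμ : Continuous μ :=
    (Complex.continuous_im.comp (H.continuous_logDerivCurve hz)).div_const _
  have cψ : Continuous ψ := (continuous_cutoff s).comp (Real.continuous_cos.comp
    ((Complex.continuous_im.comp cL).sub continuous_const))
  have μ0 : ∀ t, 0 ≤ μ t := fun t => div_nonneg (H.im_logDerivCurve_nonneg hz t) hpi.le
  have ψ0 : ∀ t, 0 ≤ ψ t := fun t => cutoff_nonneg _ _
  have ψ1 : ∀ t, ψ t ≤ 1 := fun t => cutoff_le_one _ _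
  have hμ2 : ∫ t in (0 : ℝ)..(2 * Real.pi), μ t = 2 := by
    simp only [hμ]
    rw [intervalIntegral.integral_div, H.integral_im_logDerivCurve hz]
    field_simp
  -- c is the mass assigned to far points. The splitting below gives norm at most c + 2ω + |1 − c|,
  -- which is 1 + 2ω if c ≤ 1 and otherwise at most 1 + 4s + 2ω.
  set c := ∫ t in (0 : ℝ)..(2 * Real.pi), ψ t * μ t with hc
  have hc1 : c ≤ 1 + 2 * s := by
    have := H.integral_cutoff_le hz hs θ
    have e : c = (∫ t in (0 : ℝ)..(2 * Real.pi),
        cutoff s (Real.cos ((logCurve h h' z t).im - θ)) *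
          (logDerivCurve h h' h'' z t).im) / Real.pi := by
      rw [hc, ← intervalIntegral.integral_div]
      simp only [hψ, hμ, mul_div_assoc]
    rw [e, div_le_iff₀ hpi]
    linarith
  have hc0 : 0 ≤ c := intervalIntegral.integral_nonneg h2pi.le fun t _ => mul_nonneg (ψ0 t) (μ0 t)
  have hfar : ∀ t, ψ t ≠ 1 → ‖γ t - z‖ < δ := by
    intro t ht
    by_contra hge
    push Not at hge
    apply ht
    refine cutoff_eq_one hs ?_
    have h1 := cos_im_logCurve (h' := h') hz θ t
    have h2 : (rot θ * (γ t - z)).re ≤ s * δ := by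
      rw [mul_sub, Complex.sub_re]
      have := H.rot_mul_curve_re_le θ t
      linarith
    by_contra hlt
    push Not at hlt
    have hn : 0 < ‖γ t - z‖ := hδ.trans_le hge
    have : s * δ < ‖γ t - z‖ * Real.cos ((logCurve h h' z t).im - θ) := by
      calc s * δ ≤ s * ‖γ t - z‖ := by gcongr
        _ < Real.cos ((logCurve h h' z t).im - θ) * ‖γ t - z‖ := by gcongr
        _ = _ := mul_comm _ _
    rw [h1] at this
    linarith
  have rep := H.cauchyTransform_add hΦ hz hconj
  have c1 : Continuous fun t => ((ψ t * μ t : ℝ) : ℂ) • Φ (γ t) :=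
    (Complex.continuous_ofReal.comp (cψ.mul cμ)).smul hΦ
  have c2 : Continuous fun t => (((1 - ψ t) * μ t : ℝ) : ℂ) • (Φ (γ t) - Φ z) :=
    (Complex.continuous_ofReal.comp ((continuous_const.sub cψ).mul cμ)).smul
      (hΦ.sub continuous_const)
  have c3 : Continuous fun t => (((1 - ψ t) * μ t : ℝ) : ℂ) • Φ z :=
    (Complex.continuous_ofReal.comp ((continuous_const.sub cψ).mul cμ)).smul continuous_const
  have i1 : ∫ t in (0 : ℝ)..(2 * Real.pi), (1 - ψ t) * μ t = 2 - c := by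
    have : ∀ t, (1 - ψ t) * μ t = μ t - ψ t * μ t := fun t => by ring
    simp only [this]
    have c0 : Continuous fun t => ψ t * μ t := cψ.mul cμ
    rw [intervalIntegral.integral_sub (cμ.intervalIntegrable _ _)
      (c0.intervalIntegrable _ _), hμ2]
  -- In an incomplete space the Bochner integral is 0 by convention and the bound is trivial.
  by_cases hE : CompleteSpace E
  swap
  · rw [cauchyTransform, intervalIntegral, MeasureTheory.integral, dif_neg hE,
      MeasureTheory.integral, dif_neg hE, sub_zero, smul_zero, norm_zero]
    positivity
  have split : cauchyTransform h h' h'' Φ z =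
      (∫ t in (0 : ℝ)..(2 * Real.pi), ((ψ t * μ t : ℝ) : ℂ) • Φ (γ t)) +
      (∫ t in (0 : ℝ)..(2 * Real.pi), (((1 - ψ t) * μ t : ℝ) : ℂ) • (Φ (γ t) - Φ z)) +
      ((1 - c : ℝ) : ℂ) • Φ z := by
    have e3 : ((1 - c : ℝ) : ℂ) • Φ z = (∫ t in (0 : ℝ)..(2 * Real.pi),
        (((1 - ψ t) * μ t : ℝ) : ℂ) • Φ z) - Φ z := by
      rw [intervalIntegral.integral_smul_const, intervalIntegral.integral_ofReal, i1]
      push_cast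
      module
    have c4 : Continuous fun t => ((ψ t * μ t : ℝ) : ℂ) • Φ (γ t) +
      (((1 - ψ t) * μ t : ℝ) : ℂ) • (Φ (γ t) - Φ z) := c1.add c2
    rw [e3, eq_sub_of_add_eq rep, ← add_sub_assoc, ← intervalIntegral.integral_add
      (c1.intervalIntegrable _ _) (c2.intervalIntegrable _ _), ← intervalIntegral.integral_add
      (c4.intervalIntegrable _ _) (c3.intervalIntegrable _ _)]
    congr 1
    refine intervalIntegral.integral_congr fun t _ => ?_
    simp only [hμ]
    push_cast
    module
  have n1 : ‖∫ t in (0 : ℝ)..(2 * Real.pi), ((ψ t * μ t : ℝ) : ℂ) • Φ (γ t)‖ ≤ c := by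
    refine intervalIntegral.norm_integral_le_of_norm_le h2pi.le (Filter.Eventually.of_forall
      fun t _ => ?_) ((cψ.mul cμ).intervalIntegrable _ _)
    have h0 := mul_nonneg (ψ0 t) (μ0 t)
    rw [norm_smul, Complex.norm_real, Real.norm_of_nonneg h0]
    exact mul_le_of_le_one_right h0 (hΦ1 t)
  have n2 : ‖∫ t in (0 : ℝ)..(2 * Real.pi), (((1 - ψ t) * μ t : ℝ) : ℂ) • (Φ (γ t) - Φ z)‖ ≤
      2 * ω := by
    have : 2 * ω = ∫ t in (0 : ℝ)..(2 * Real.pi), μ t * ω := by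
      rw [intervalIntegral.integral_mul_const, hμ2]
    rw [this]
    refine intervalIntegral.norm_integral_le_of_norm_le h2pi.le (Filter.Eventually.of_forall
      fun t _ => ?_) ((cμ.mul continuous_const).intervalIntegrable _ _)
    have h0 := mul_nonneg (sub_nonneg.2 (ψ1 t)) (μ0 t)
    rw [norm_smul, Complex.norm_real, Real.norm_of_nonneg h0]
    by_cases hψt : ψ t = 1
    · rw [hψt, sub_self, zero_mul, zero_mul]
      exact mul_nonneg (μ0 t) hω
    · have h3 := hclose t (hfar t hψt)
      have h4 : (1 - ψ t) * μ t ≤ μ t := mul_le_of_le_one_left (μ0 t) (by linarith [ψ0 t])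
      gcongr
      exact μ0 t
  have n3 : ‖((1 - c : ℝ) : ℂ) • Φ z‖ ≤ |1 - c| := by
    rw [norm_smul, Complex.norm_real, Real.norm_eq_abs]
    exact mul_le_of_le_one_right (abs_nonneg _) hz1
  rw [split]
  refine (norm_add₃_le).trans ?_
  rcases abs_cases (1 - c) with ⟨h1, _⟩ | ⟨h1, _⟩ <;> linarith

theorem closedBody_isCompact (H : IsSupportFn h h' h'') :
    IsCompact {z | ∀ θ, (rot θ * z).re ≤ h θ} := by
  obtain ⟨B, hB⟩ := H.exists_bound
  refine Metric.isCompact_of_isClosed_isBounded ?_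
    (isBounded_iff_forall_norm_le.2 ⟨B, fun z hz => ?_⟩)
  · simp only [Set.ofPred_forall]
    exact isClosed_iInter fun θ => isClosed_le (by fun_prop) continuous_const
  · have h1 := hz z.arg
    rw [rot_arg_mul, Complex.ofReal_re] at h1
    exact h1.trans (hB _)

theorem exists_pos_mem_sub (H : IsSupportFn h h' h'') {z : ℂ} (hz : z ∈ supportBody h) {η₀ : ℝ}
    (hη₀ : 0 < η₀) : ∃ η, 0 < η ∧ η ≤ η₀ ∧ z ∈ supportBody (fun θ => h θ - η) := by
  have hcont : Continuous fun θ => h θ - (rot θ * z).re :=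
    H.continuous.sub (Complex.continuous_re.comp (continuous_rot.mul continuous_const))
  obtain ⟨θ₁, -, hmin⟩ := (isCompact_Icc (a := (0 : ℝ)) (b := 2 * Real.pi)).exists_isMinOn
    ⟨0, le_rfl, Real.two_pi_pos.le⟩ hcont.continuousOn
  have hpos := sub_pos.2 (hz θ₁)
  refine ⟨min η₀ ((h θ₁ - (rot θ₁ * z).re) / 2), lt_min hη₀ (by linarith), min_le_left _ _,
    fun θ => ?_⟩
  have hper : Function.Periodic (fun θ => h θ - (rot θ * z).re) (2 * Real.pi) := by
    intro θ; simp only [H.periodic θ, rot_periodic θ]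
  obtain ⟨y, hy, hyt⟩ := hper.exists_mem_Ico₀ Real.two_pi_pos θ
  have h1 : h θ₁ - (rot θ₁ * z).re ≤ h y - (rot y * z).re := hmin ⟨hy.1, hy.2.le⟩
  rw [← hyt] at h1
  have := min_le_right η₀ ((h θ₁ - (rot θ₁ * z).re) / 2)
  linarith

/-- Maximum principle on the slightly smaller set with bounds h − η: each of its frontier points is
η-close to some supporting line, where `norm_cauchyTransform_le` applies. -/
theorem norm_cauchyTransform_le_one [CompleteSpace E] (H : IsSupportFn h h' h'') {Φ : ℂ → E}
    (hΦ : ContinuousOn Φ {z | ∀ θ, (rot θ * z).re ≤ h θ})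
    (hΦ1 : ∀ z, (∀ θ, (rot θ * z).re ≤ h θ) → ‖Φ z‖ ≤ 1)
    (hconj : ∀ z ∈ supportBody h, (2 * Real.pi * Complex.I : ℂ)⁻¹ •
      ∫ t in (0 : ℝ)..(2 * Real.pi), (starRingEnd ℂ) (logDerivCurve h h' h'' z t) •
        Φ (supportCurve h h' t) = -Φ z) {z : ℂ} (hz : z ∈ supportBody h) :
    ‖cauchyTransform h h' h'' Φ z‖ ≤ 1 := by
  have hcurve : ∀ t θ, (rot θ * supportCurve h h' t).re ≤ h θ := fun t θ =>
    H.rot_mul_curve_re_le θ t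
  have hΦc : Continuous fun t => Φ (supportCurve h h' t) :=
    hΦ.comp_continuous H.continuous_curve hcurve
  refine le_of_forall_pos_le_add fun ε hε => ?_
  obtain ⟨δ, hδ, hunif⟩ := Metric.uniformContinuousOn_iff.1
    (H.closedBody_isCompact.uniformContinuousOn_of_continuous hΦ) (ε / 4) (by linarith)
  -- With s = ε/8 and ω = ε/4 the boundary estimate becomes 1 + 4s + 2ω = 1 + ε.
  obtain ⟨η, hη, hηle, hzη⟩ := H.exists_pos_mem_sub hz (η₀ := ε / 8 * δ) (by positivity)
  have hclos : closure (supportBody fun θ => h θ - η) ⊆ {z | ∀ θ, (rot θ * z).re ≤ h θ - η} := by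
    refine closure_minimal (fun z hz θ => (hz θ).le) ?_
    simp only [Set.ofPred_forall]
    exact isClosed_iInter fun θ => isClosed_le (by fun_prop) continuous_const
  have hsub : {z | ∀ θ, (rot θ * z).re ≤ h θ - η} ⊆ supportBody h := fun z hz θ =>
    (hz θ).trans_lt (by linarith)
  have hopen : IsOpen (supportBody fun θ => h θ - η) :=
    supportBody_isOpen (H.continuous.sub continuous_const) fun t => by simp only [H.periodic t]
  have hdiff := H.differentiableOn_cauchyTransform hΦc
  refine Complex.norm_le_of_forall_mem_frontier_norm_le
    (H.isBounded.subset (subset_closure.trans (hclos.trans hsub)))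
    (hdiff.mono (hclos.trans hsub)).diffContOnCl (fun w hw => ?_) (subset_closure hzη)
  have hwcl := hclos hw.1
  have hwb := hsub hwcl
  have hwn : w ∉ supportBody fun θ => h θ - η := by
    have := hw.2
    rwa [hopen.interior_eq] at this
  obtain ⟨θ, hθ⟩ : ∃ θ, h θ - η ≤ (rot θ * w).re := by
    by_contra hcon
    push Not at hcon
    exact hwn hcon
  have hwle : ∀ θ, (rot θ * w).re ≤ h θ := fun θ => (hwb θ).le
  have := H.norm_cauchyTransform_le hΦc (fun t => hΦ1 _ (hcurve t)) hwb (hΦ1 w hwle) (hconj w hwb)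
    (s := ε / 8) (δ := δ) (ω := ε / 4) (θ := θ) (by linarith) hδ (by linarith)
    (fun t ht => by
      have h1 := hunif _ (hcurve t) _ hwle (by rwa [dist_eq_norm])
      rw [dist_eq_norm] at h1
      exact h1.le) (by linarith)
  linarith

end cauchyTransform

end IsSupportFn

/-! ### Norms of integrals of Kronecker products. -/

section matrixIntegral

variable {α β : Type*} [Fintype α] [Fintype β] [DecidableEq β]

/-- Evaluation of a linear functional commutes with integration of matrix-valued maps. -/
theorem linearMap_intervalIntegral (φ : Matrix α β ℂ →ₗ[ℂ] ℂ) {M : ℝ → Matrix α β ℂ}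
    (hM : Continuous M) (a b : ℝ) : φ (∫ t in a..b, M t) = ∫ t in a..b, φ (M t) :=
  (φ.toContinuousLinearMap.intervalIntegral_comp_comm (hM.intervalIntegrable a b)).symm

theorem intervalIntegral_matrix_apply {M : ℝ → Matrix α β ℂ} (hM : Continuous M) (a b : ℝ)
    (i : α) (j : β) : (∫ t in a..b, M t) i j = ∫ t in a..b, M t i j :=
  linearMap_intervalIntegral (Matrix.entryLinearMap ℂ ℂ i j) hM a b

/-- Test with v proportional to Xu and rescaled to ‖v‖ = ‖u‖. The sum-of-squares form of the
hypothesis is additive, so it survives integration. -/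
theorem norm_matrix_le_of_bilin {X : Matrix α β ℂ} {C : ℝ} (hC : 0 ≤ C)
    (h : ∀ (u : EuclideanSpace ℂ β) (v : EuclideanSpace ℂ α),
      ‖star v.ofLp ⬝ᵥ X.mulVec u.ofLp‖ ≤ C / 2 * (‖u‖ ^ 2 + ‖v‖ ^ 2)) : ‖X‖ ≤ C := by
  rw [Matrix.l2_opNorm_def]
  refine ContinuousLinearMap.opNorm_le_bound _ hC fun u => ?_
  set y : EuclideanSpace ℂ α := WithLp.toLp 2 (X.mulVec u.ofLp) with hy
  change ‖y‖ ≤ _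
  by_cases hy0 : ‖y‖ = 0
  · rw [hy0]; positivity
  have hypos : 0 < ‖y‖ := lt_of_le_of_ne (norm_nonneg _) (Ne.symm hy0)
  have hu0 : ‖u‖ ≠ 0 := by
    intro hu
    have : u = 0 := norm_eq_zero.1 hu
    apply hy0
    rw [hy, this]
    simp
  have hupos : 0 < ‖u‖ := lt_of_le_of_ne (norm_nonneg _) (Ne.symm hu0)
  have key := h u (((‖u‖ / ‖y‖ : ℝ) : ℂ) • y)
  have e1 : star y.ofLp ⬝ᵥ X.mulVec u.ofLp = ((‖y‖ ^ 2 : ℝ) : ℂ) := by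
    have := inner_self_eq_norm_sq_to_K (𝕜 := ℂ) y
    rw [EuclideanSpace.inner_eq_star_dotProduct, dotProduct_comm] at this
    rw [Complex.ofReal_pow]
    exact this
  rw [WithLp.ofLp_smul, star_smul, smul_dotProduct, e1, smul_eq_mul, norm_mul,
    norm_star, norm_smul, Complex.norm_real, Complex.norm_real,
    Real.norm_of_nonneg (by positivity : 0 ≤ ‖u‖ / ‖y‖),
    Real.norm_of_nonneg (by positivity : 0 ≤ ‖y‖ ^ 2)] at key
  have e2 : ‖u‖ / ‖y‖ * ‖y‖ ^ 2 = ‖u‖ * ‖y‖ := by field_simp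
  have e3 : ‖u‖ / ‖y‖ * ‖y‖ = ‖u‖ := by field_simp
  rw [e2, e3] at key
  have : ‖u‖ * ‖y‖ ≤ ‖u‖ * (C * ‖u‖) := by linarith
  exact le_of_mul_le_mul_left this hupos

variable {ι : Type*} [Fintype ι]

/-- The quadratic form of `1 ⊗ M`. -/
noncomputable def blockQuad (M : Matrix ι ι ℂ) (u : α × ι → ℂ) : ℂ :=
  ∑ a, star (fun i => u (a, i)) ⬝ᵥ M.mulVec fun i => u (a, i)

theorem blockQuad_sum_re {κ : Type*} [Fintype κ] {m : ℕ} (w : Fin m → ι → ℂ) (x : κ × ι → ℂ) :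
    (blockQuad (∑ k, Matrix.vecMulVec (w k) (star (w k))) x).re =
      ∑ k, ‖(WithLp.toLp 2 fun b => ∑ j, star (w k j) * x (b, j) : EuclideanSpace ℂ κ)‖ ^ 2 := by
  have : blockQuad (∑ k, Matrix.vecMulVec (w k) (star (w k))) x =
      ∑ k, ∑ b, star (∑ j, star (w k j) * x (b, j)) * ∑ j, star (w k j) * x (b, j) := by
    rw [blockQuad, Finset.sum_comm]
    refine Finset.sum_congr rfl fun b _ => ?_
    simp only [Matrix.sum_mulVec, dotProduct_sum]
    refine Finset.sum_congr rfl fun k _ => ?_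
    simp only [Matrix.vecMulVec_mulVec, dotProduct, Pi.smul_apply, Pi.star_apply, star_sum,
      star_mul', star_star, op_smul_eq_smul, smul_eq_mul, Finset.sum_mul, Finset.mul_sum]
    rw [Finset.sum_comm]
    refine Finset.sum_congr rfl fun i _ => Finset.sum_congr rfl fun j _ => ?_
    ring
  rw [this, Complex.re_sum]
  refine Finset.sum_congr rfl fun k _ => ?_
  rw [EuclideanSpace.norm_sq_eq, Complex.re_sum]
  refine Finset.sum_congr rfl fun b _ => ?_
  simp only
  rw [← starRingEnd_apply, Complex.conj_mul', ← Complex.ofReal_pow, Complex.ofReal_re]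

open scoped ComplexOrder in
-- Write M as a sum of rank-one w w*. Each summand reduces the form to ⟨V_k, F U_k⟩, and ‖V_k‖‖U_k‖
-- is at most half the sum of squares.
theorem norm_kron_bilin_le {F : Matrix α β ℂ} (hF : ‖F‖ ≤ 1) {M : Matrix ι ι ℂ}
    (hM : M.PosSemidef) (u : β × ι → ℂ) (v : α × ι → ℂ) :
    ‖star v ⬝ᵥ (F ⊗ₖ M).mulVec u‖ ≤ ((blockQuad M u).re + (blockQuad M v).re) / 2 := by
  obtain ⟨m, w, rfl⟩ := Matrix.posSemidef_iff_eq_sum_vecMulVec.1 hM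
  set U : Fin m → EuclideanSpace ℂ β := fun k =>
    WithLp.toLp 2 fun b => ∑ j, star (w k j) * u (b, j) with hU
  set V : Fin m → EuclideanSpace ℂ α := fun k =>
    WithLp.toLp 2 fun a => ∑ j, star (w k j) * v (a, j) with hV
  have main : star v ⬝ᵥ (F ⊗ₖ ∑ k, Matrix.vecMulVec (w k) (star (w k))).mulVec u =
      ∑ k, star (V k).ofLp ⬝ᵥ F.mulVec (U k).ofLp := by
    have e0 : ∀ a i, (F ⊗ₖ ∑ k, Matrix.vecMulVec (w k) (star (w k))).mulVec u (a, i) =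
        ∑ k, w k i * F.mulVec (U k).ofLp a := by
      intro a i
      simp only [dotProduct, Matrix.mulVec, Matrix.kroneckerMap_apply, Matrix.sum_apply,
        Matrix.vecMulVec_apply, Pi.star_apply, hU, Fintype.sum_prod_type, Finset.mul_sum,
        Finset.sum_mul]
      have : ∀ b : β, ∑ j, ∑ k, F a b * (w k i * star (w k j)) * u (b, j) =
          ∑ k, ∑ j, w k i * (F a b * (star (w k j) * u (b, j))) := by
        intro b
        rw [Finset.sum_comm]
        refine Finset.sum_congr rfl fun k _ => Finset.sum_congr rfl fun j _ => ?_
        ring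
      simp only [this]
      rw [Finset.sum_comm]
    simp only [dotProduct, Fintype.sum_prod_type, e0, Finset.mul_sum, Pi.star_apply, hV, star_sum,
      star_mul', star_star, Finset.sum_mul]
    have : ∀ a : α, ∑ i, ∑ k, star (v (a, i)) * (w k i * F.mulVec (U k).ofLp a) =
        ∑ k, ∑ i, w k i * star (v (a, i)) * F.mulVec (U k).ofLp a := by
      intro a
      rw [Finset.sum_comm]
      refine Finset.sum_congr rfl fun k _ => Finset.sum_congr rfl fun j _ => ?_
      ring
    simp only [this]
    rw [Finset.sum_comm]
  rw [main, blockQuad_sum_re, blockQuad_sum_re, ← Finset.sum_add_distrib, Finset.sum_div]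
  refine (norm_sum_le _ _).trans (Finset.sum_le_sum fun k _ => ?_)
  have e1 : star (V k).ofLp ⬝ᵥ F.mulVec (U k).ofLp =
      inner ℂ (V k) (WithLp.toLp 2 (F.mulVec (U k).ofLp)) := by
    rw [EuclideanSpace.inner_eq_star_dotProduct, dotProduct_comm]
  rw [e1]
  have h1 := norm_inner_le_norm (𝕜 := ℂ) (V k) (WithLp.toLp 2 (F.mulVec (U k).ofLp))
  have h2 := Matrix.l2_opNorm_mulVec F (U k)
  have h3 : ‖F‖ * ‖U k‖ ≤ ‖U k‖ := mul_le_of_le_one_left (norm_nonneg _) hF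
  have h4 : ‖V k‖ * ‖WithLp.toLp 2 (F.mulVec (U k).ofLp)‖ ≤ ‖V k‖ * ‖U k‖ := by
    gcongr
    exact h2.trans h3
  have h5 := two_mul_le_add_sq ‖V k‖ ‖U k‖
  refine h1.trans (h4.trans ?_)
  change _ ≤ (‖U k‖ ^ 2 + ‖V k‖ ^ 2) / 2
  linarith

theorem continuous_blockQuad {κ : Type*} [Fintype κ] {M : ℝ → Matrix ι ι ℂ} (hM : Continuous M)
    (x : κ × ι → ℂ) : Continuous fun t => blockQuad (M t) x := by
  unfold blockQuad
  exact continuous_finsetSum _ fun a _ => Continuous.dotProduct continuous_const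
    (hM.matrix_mulVec continuous_const)

theorem integral_blockQuad_re [DecidableEq ι] {κ : Type*} [Fintype κ] {M : ℝ → Matrix ι ι ℂ}
    (hM : Continuous M) {T C : ℝ} (hint : ∫ t in (0 : ℝ)..T, M t = (C : ℂ) • 1)
    (x : EuclideanSpace ℂ (κ × ι)) :
    ∫ t in (0 : ℝ)..T, (blockQuad (M t) x.ofLp).re = C * ‖x‖ ^ 2 := by
  let φ : Matrix ι ι ℂ →ₗ[ℂ] ℂ :=
    { toFun := fun N => blockQuad N x.ofLp
      map_add' := fun N N' => by
        simp only [blockQuad, Matrix.add_mulVec, dotProduct_add, Finset.sum_add_distrib]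
      map_smul' := fun c N => by
        simp only [blockQuad, Matrix.smul_mulVec, dotProduct_smul, Finset.smul_sum,
          RingHom.id_apply] }
  have h1 := linearMap_intervalIntegral φ hM 0 T
  have h2 := Complex.reCLM.intervalIntegral_comp_comm
    ((continuous_blockQuad hM x.ofLp).intervalIntegrable (μ := MeasureTheory.volume) 0 T)
  simp only [Complex.reCLM_apply] at h2
  rw [h2]
  change _ = ∫ t in (0 : ℝ)..T, blockQuad (M t) x.ofLp at h1
  rw [← h1, hint]
  change (blockQuad ((C : ℂ) • (1 : Matrix ι ι ℂ)) x.ofLp).re = _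
  rw [EuclideanSpace.norm_sq_eq, Fintype.sum_prod_type, blockQuad, Complex.re_sum, Finset.mul_sum]
  refine Finset.sum_congr rfl fun a _ => ?_
  rw [Matrix.smul_mulVec, Matrix.one_mulVec, dotProduct_smul, smul_eq_mul, Complex.re_ofReal_mul,
    dotProduct, Complex.re_sum]
  congr 1
  refine Finset.sum_congr rfl fun i _ => ?_
  rw [Pi.star_apply, ← starRingEnd_apply, Complex.conj_mul', ← Complex.ofReal_pow,
    Complex.ofReal_re]

open scoped ComplexOrder in
-- The pointwise bound `norm_kron_bilin_le` is linear in M, so it integrates exactly to C/2 · (‖u‖²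
-- + ‖v‖²).
theorem norm_integral_kron_le [DecidableEq ι] {F : ℝ → Matrix α β ℂ} (hF : Continuous F)
    (hF1 : ∀ t, ‖F t‖ ≤ 1) {M : ℝ → Matrix ι ι ℂ} (hM : Continuous M)
    (hpos : ∀ t, (M t).PosSemidef) {T C : ℝ} (hT : 0 ≤ T) (hC : 0 ≤ C)
    (hint : ∫ t in (0 : ℝ)..T, M t = (C : ℂ) • 1) :
    ‖∫ t in (0 : ℝ)..T, F t ⊗ₖ M t‖ ≤ C := by
  have hFM : Continuous fun t => F t ⊗ₖ M t := by
    refine continuous_matrix fun p q => ?_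
    exact (hF.matrix_elem p.1 q.1).mul (hM.matrix_elem p.2 q.2)
  refine norm_matrix_le_of_bilin hC fun u v => ?_
  let φ : Matrix (α × ι) (β × ι) ℂ →ₗ[ℂ] ℂ :=
    { toFun := fun N => star v.ofLp ⬝ᵥ N.mulVec u.ofLp
      map_add' := fun N N' => by
        simp only [Matrix.add_mulVec, dotProduct_add]
      map_smul' := fun c N => by
        simp only [Matrix.smul_mulVec, dotProduct_smul, RingHom.id_apply] }
  have h1 : star v.ofLp ⬝ᵥ (∫ t in (0 : ℝ)..T, F t ⊗ₖ M t).mulVec u.ofLp =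
      ∫ t in (0 : ℝ)..T, star v.ofLp ⬝ᵥ (F t ⊗ₖ M t).mulVec u.ofLp :=
    linearMap_intervalIntegral φ hFM 0 T
  have cu := Complex.continuous_re.comp (continuous_blockQuad hM u.ofLp)
  have cv := Complex.continuous_re.comp (continuous_blockQuad hM v.ofLp)
  have h2 : C / 2 * (‖u‖ ^ 2 + ‖v‖ ^ 2) = ∫ t in (0 : ℝ)..T,
      ((blockQuad (M t) u.ofLp).re + (blockQuad (M t) v.ofLp).re) / 2 := by
    have := intervalIntegral.integral_add (cu.intervalIntegrable (μ := MeasureTheory.volume) 0 T)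
      (cv.intervalIntegrable 0 T)
    simp only [Function.comp_apply] at this
    rw [intervalIntegral.integral_div, this, integral_blockQuad_re hM hint,
      integral_blockQuad_re hM hint]
    ring
  rw [h1, h2]
  exact intervalIntegral.norm_integral_le_of_norm_le hT
    (Filter.Eventually.of_forall fun t _ => norm_kron_bilin_le (hF1 t) (hpos t) _ _)
    (((cu.add cv).div_const 2).intervalIntegrable _ _)

end matrixIntegral

/-! ### Rayleigh quotients and positivity of the resolvent. -/

theorem star_dotProduct_self_eq {ι : Type*} [Fintype ι] (w : ι → ℂ) :
    star w ⬝ᵥ w = ((‖(WithLp.toLp 2 w : EuclideanSpace ℂ ι)‖ ^ 2 : ℝ) : ℂ) := by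
  have := inner_self_eq_norm_sq_to_K (𝕜 := ℂ) (WithLp.toLp 2 w : EuclideanSpace ℂ ι)
  rw [EuclideanSpace.inner_eq_star_dotProduct, dotProduct_comm] at this
  rw [Complex.ofReal_pow]
  exact this

/-- The Rayleigh quotient of a nonzero vector is in the numerical range. -/
theorem exists_mem_numericalRange {n : ℕ} (A : Matrix (Fin n) (Fin n) ℂ) {w : Fin n → ℂ}
    (hw : w ≠ 0) : ∃ z ∈ numericalRange A, star w ⬝ᵥ A.mulVec w =
      ((‖(WithLp.toLp 2 w : EuclideanSpace ℂ (Fin n))‖ ^ 2 : ℝ) : ℂ) * z := by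
  set y : EuclideanSpace ℂ (Fin n) := WithLp.toLp 2 w with hy
  have hy0 : ‖y‖ ≠ 0 := fun h0 => hw (by
    have := norm_eq_zero.1 h0
    simpa [hy] using this)
  have hyc : ((‖y‖ : ℝ) : ℂ) ≠ 0 := Complex.ofReal_ne_zero.2 hy0
  refine ⟨_, ⟨((‖y‖⁻¹ : ℝ) : ℂ) • y, ?_, rfl⟩, ?_⟩
  · rw [norm_smul, Complex.norm_real, norm_inv, norm_norm, inv_mul_cancel₀ hy0]
  · simp only [hy, WithLp.ofLp_smul, star_smul, Matrix.mulVec_smul, dotProduct_smul,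
      smul_dotProduct, smul_eq_mul]
    rw [← hy]
    simp only [Complex.star_def, Complex.conj_ofReal]
    push_cast
    field_simp

theorem re_mul_dotProduct_le {n : ℕ} {A : Matrix (Fin n) (Fin n) ℂ} {r : ℂ} {b : ℝ}
    (hA : ∀ z ∈ numericalRange A, (r * z).re ≤ b) (w : Fin n → ℂ) :
    (r * (star w ⬝ᵥ A.mulVec w)).re ≤
      ‖(WithLp.toLp 2 w : EuclideanSpace ℂ (Fin n))‖ ^ 2 * b := by
  by_cases hw : w = 0
  · simp [hw]
  obtain ⟨z, hz, hwz⟩ := exists_mem_numericalRange A hw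
  rw [hwz, mul_left_comm, Complex.re_ofReal_mul]
  exact mul_le_mul_of_nonneg_left (hA z hz) (by positivity)

theorem spectrum_subset_numericalRange {n : ℕ} (A : Matrix (Fin n) (Fin n) ℂ) :
    spectrum ℂ A ⊆ numericalRange A := by
  intro a ha
  rw [← Matrix.spectrum_toLin', ← Module.End.hasEigenvalue_iff_mem_spectrum] at ha
  obtain ⟨v, hv⟩ := ha.exists_hasEigenvector
  have h1 : A.mulVec v = a • v := by simpa using hv.apply_eq_smul
  obtain ⟨z, hz, hvz⟩ := exists_mem_numericalRange A hv.2
  rw [h1, dotProduct_smul, star_dotProduct_self_eq, smul_eq_mul, mul_comm] at hvz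
  have hne : ((‖(WithLp.toLp 2 v : EuclideanSpace ℂ (Fin n))‖ ^ 2 : ℝ) : ℂ) ≠ 0 := by
    rw [Complex.ofReal_ne_zero]
    refine pow_ne_zero _ (norm_ne_zero_iff.2 fun h0 => hv.2 ?_)
    simpa using h0
  rw [mul_left_cancel₀ hne hvz]
  exact hz

open scoped ComplexOrder in
/-- If `W(A)` lies in the closed half plane `{w | Re (r w) ≤ Re (r x)}`, then the Hermitian part of
`c (x - A)⁻¹` is positive semidefinite when `c` is a nonnegative multiple of `conj r`. -/
theorem posSemidef_resolv_add {n : ℕ} {A : Matrix (Fin n) (Fin n) ℂ} {x r : ℂ} {ρ : ℝ}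
    (hρ : 0 ≤ ρ) (hx : x ∉ spectrum ℂ A)
    (hA : ∀ w ∈ numericalRange A, (r * w).re ≤ (r * x).re) :
    ((ρ * star r) • resolv A x + ((ρ * star r) • resolv A x)ᴴ).PosSemidef := by
  set N := (ρ * star r) • resolv A x with hN
  rw [Matrix.posSemidef_iff_dotProduct_mulVec]
  refine ⟨?_, fun v => ?_⟩
  · rw [Matrix.IsHermitian, Matrix.conjTranspose_add, Matrix.conjTranspose_conjTranspose, add_comm]
  have e1 : star v ⬝ᵥ (N + Nᴴ).mulVec v =
      ((2 * (star v ⬝ᵥ N.mulVec v).re : ℝ) : ℂ) := by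
    have h1 : star v ⬝ᵥ Nᴴ.mulVec v = (starRingEnd ℂ) (star v ⬝ᵥ N.mulVec v) := by
      rw [starRingEnd_apply, ← Matrix.star_dotProduct, Matrix.star_mulVec,
        ← Matrix.dotProduct_mulVec]
    rw [Matrix.add_mulVec, dotProduct_add, h1, Complex.add_conj]
  rw [e1, Complex.zero_le_real]
  refine mul_nonneg zero_le_two ?_
  set w := (resolv A x).mulVec v with hw
  -- With v = (x − A)w, the form of the resolvent at v becomes that of x − A at w, which the
  -- half-plane condition controls.
  have hv : v = x • w - A.mulVec w := by
    have := congrArg (fun B => B.mulVec v) (smul_one_sub_mul_resolv hx)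
    simp only [← Matrix.mulVec_mulVec, Matrix.sub_mulVec, Matrix.smul_mulVec, Matrix.one_mulVec]
      at this
    exact this.symm
  have e2 : star v ⬝ᵥ N.mulVec v = ρ * (starRingEnd ℂ)
      (r * x * (star w ⬝ᵥ w) - r * (star w ⬝ᵥ A.mulVec w)) := by
    have h1 : (starRingEnd ℂ) (star w ⬝ᵥ w) = star w ⬝ᵥ w := by
      rw [starRingEnd_apply, ← Matrix.star_dotProduct]
    have h2 : (starRingEnd ℂ) (star w ⬝ᵥ A.mulVec w) = star (A.mulVec w) ⬝ᵥ w := by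
      rw [starRingEnd_apply, ← Matrix.star_dotProduct]
    rw [map_sub, map_mul, map_mul, map_mul, h1, h2, hN, Matrix.smul_mulVec, ← hw,
      dotProduct_smul, hv, star_sub, star_smul, sub_dotProduct, smul_dotProduct, smul_eq_mul,
      smul_eq_mul, starRingEnd_apply, starRingEnd_apply]
    ring
  have e3 : star w ⬝ᵥ w = ((‖(WithLp.toLp 2 w : EuclideanSpace ℂ (Fin n))‖ ^ 2 : ℝ) : ℂ) :=
    star_dotProduct_self_eq w
  have e4 := re_mul_dotProduct_le (A := A) (r := r) (b := (r * x).re) hA w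
  rw [e2, Complex.re_ofReal_mul, Complex.conj_re, Complex.sub_re, e3, mul_comm (r * x),
    Complex.re_ofReal_mul]
  exact mul_nonneg hρ (by linarith)

namespace IsCauchyLoop

variable {Ω C D : Set ℂ} {T : ℝ} {γ γ' : ℝ → ℂ} {n : ℕ} {A : Matrix (Fin n) (Fin n) ℂ}

theorem cauchy_formula (h : IsCauchyLoop Ω C D T γ γ') {f : ℂ → ℂ} (hf : HolOn Ω C f) {w : ℂ}
    (hw : w ∈ D) :
    ∫ t in (0 : ℝ)..T, (γ t - w)⁻¹ * γ' t * f (γ t) = 2 * Real.pi * Complex.I * f w := by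
  have hd := hf.dslope h.isOpen h.subset (h.subset' hw)
  have c0 := h.continuous_deriv
  have c1 : Continuous fun t => dslope f w (γ t) * γ' t := (h.continuous_comp hd.2).mul c0
  have c2 : Continuous fun t => (γ t - w)⁻¹ * γ' t * f w :=
    (((h.continuous.sub continuous_const).inv₀ fun t => sub_ne_zero.2 (h.ne w hw t)).mul c0).mul
      continuous_const
  have h0 := intervalIntegral.integral_add (c1.intervalIntegrable (μ := MeasureTheory.volume) 0 T)
    (c2.intervalIntegrable 0 T)
  rw [h.integral_eq_zero _ hd, zero_add] at h0
  rw [← h.winding w hw, ← intervalIntegral.integral_mul_const, ← h0]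
  refine intervalIntegral.integral_congr fun t _ => ?_
  have := sub_smul_dslope f w (γ t)
  rw [smul_eq_mul] at this
  have hne : γ t - w ≠ 0 := sub_ne_zero.2 (h.ne w hw t)
  have e : f (γ t) = (γ t - w) * dslope f w (γ t) + f w := by rw [this]; ring
  rw [e]
  field_simp

end IsCauchyLoop

/-! ### The functional calculus for matrix-valued functions. -/

section kron

variable {α β κ : Type*} {n : ℕ}

/-- The value `F{A}` of a matrix-valued holomorphic function at `A`. -/
noncomputable def kronHfc (A : Matrix (Fin n) (Fin n) ℂ) (F : ℂ → Matrix α β ℂ) :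
    Matrix (α × Fin n) (β × Fin n) ℂ :=
  Matrix.of fun p q => hfc A (fun z => F z p.1 q.1) p.2 q.2

variable {Ω C D : Set ℂ} {T : ℝ} {γ γ' : ℝ → ℂ} {A : Matrix (Fin n) (Fin n) ℂ}

theorem kronHfc_mul [Fintype β] (h : IsCauchyLoop Ω C D T γ γ') (hA : spectrum ℂ A ⊆ D)
    {F : ℂ → Matrix α β ℂ} {G : ℂ → Matrix β κ ℂ} (hF : ∀ i j, HolOn Ω C fun z => F z i j)
    (hG : ∀ i j, HolOn Ω C fun z => G z i j) :
    kronHfc A (fun z => F z * G z) = kronHfc A F * kronHfc A G := by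
  ext ⟨a, i⟩ ⟨c, j⟩
  simp only [kronHfc, Matrix.of_apply, Matrix.mul_apply, Fintype.sum_prod_type]
  rw [h.hfc_sum hA _ fun b => (hF a b).mul (hG b c), Matrix.sum_apply]
  refine Finset.sum_congr rfl fun b _ => ?_
  rw [h.hfc_mul hA (hF a b) (hG b c), Matrix.mul_apply]

theorem IsCauchyLoop.cauchyInt_apply (h : IsCauchyLoop Ω C D T γ γ') (hA : spectrum ℂ A ⊆ D)
    {f : ℂ → ℂ} (hf : ContinuousOn f C) (i j : Fin n) :
    cauchyInt T γ γ' A f i j = ∫ t in (0 : ℝ)..T, f (γ t) * γ' t * resolv A (γ t) i j := by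
  rw [cauchyInt, intervalIntegral_matrix_apply]
  · simp only [Matrix.smul_apply, smul_eq_mul]
  · exact ((h.continuous_comp hf).mul h.continuous_deriv).smul (h.continuous_resolv hA)

theorem kronHfc_eq_integral [Fintype α] [Fintype β] [DecidableEq β]
    (h : IsCauchyLoop Ω C D T γ γ') (hA : spectrum ℂ A ⊆ D)
    {F : ℂ → Matrix α β ℂ} (hF : ∀ i j, HolOn Ω C fun z => F z i j) :
    kronHfc A F = ∫ t in (0 : ℝ)..T,
      F (γ t) ⊗ₖ (((2 * Real.pi * Complex.I : ℂ)⁻¹ * γ' t) • resolv A (γ t)) := by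
  have c0 := h.continuous_deriv
  have cR := h.continuous_resolv hA
  have c1 : Continuous fun t =>
      F (γ t) ⊗ₖ (((2 * Real.pi * Complex.I : ℂ)⁻¹ * γ' t) • resolv A (γ t)) := by
    refine continuous_matrix fun p q => ?_
    exact (h.continuous_comp (hF p.1 q.1).2).mul
      (((continuous_const.mul c0).smul cR).matrix_elem p.2 q.2)
  ext ⟨a, i⟩ ⟨b, j⟩
  rw [intervalIntegral_matrix_apply c1, kronHfc, Matrix.of_apply, h.hfc_eq hA (hF a b),
    Matrix.smul_apply, h.cauchyInt_apply hA (hF a b).2, smul_eq_mul,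
    ← intervalIntegral.integral_const_mul]
  refine intervalIntegral.integral_congr fun t _ => ?_
  simp only [Matrix.kroneckerMap_apply, Matrix.smul_apply, smul_eq_mul]
  ring

/-- The functional calculus is bounded by the supremum over a Cauchy loop. -/
theorem exists_norm_kronHfc_le [Fintype α] [Fintype β] [DecidableEq β]
    (h₀ : IsCauchyLoop Ω C D T γ γ') (hA : spectrum ℂ A ⊆ D) :
    ∃ B : ℝ, ∀ Ω' C' D' : Set ℂ, IsCauchyLoop Ω' C' D' T γ γ' → spectrum ℂ A ⊆ D' →
      ∀ F : ℂ → Matrix α β ℂ, (∀ i j, HolOn Ω' C' fun z => F z i j) →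
      (∀ t, ‖F (γ t)‖ ≤ 1) → ‖kronHfc A F‖ ≤ B := by
  classical
  have c0 := h₀.continuous_deriv
  have cR := h₀.continuous_resolv hA
  let e : α → β → (Matrix α β ℂ →L[ℂ] ℂ) := fun a b =>
    (Matrix.entryLinearMap ℂ ℂ a b).toContinuousLinearMap
  let c : ℂ := (2 * Real.pi * Complex.I : ℂ)⁻¹
  let S : Fin n → Fin n → ℝ := fun i j => ∫ t in (0 : ℝ)..T, ‖γ' t * resolv A (γ t) i j‖
  -- A crude entrywise bound: it depends on the curve and `A` but not on the domain of holomorphy,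
  -- which shrinks during the iteration.
  refine ⟨∑ p : α × Fin n, ∑ q : β × Fin n, (‖c‖ * (‖e p.1 q.1‖ * S p.2 q.2)) *
    ‖(Matrix.single p q (1 : ℂ) : Matrix (α × Fin n) (β × Fin n) ℂ)‖, fun Ω' C' D' h hA F hF hF1 => ?_⟩
  rw [Matrix.matrix_eq_sum_single (kronHfc A F)]
  refine (norm_sum_le _ _).trans (Finset.sum_le_sum fun p _ =>
    (norm_sum_le _ _).trans (Finset.sum_le_sum fun q _ => ?_))
  have e1 : Matrix.single p q (kronHfc A F p q) =
      kronHfc A F p q • (Matrix.single p q (1 : ℂ) : Matrix (α × Fin n) (β × Fin n) ℂ) := by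
    rw [Matrix.smul_single, smul_eq_mul, mul_one]
  rw [e1, norm_smul]
  gcongr
  have e2 : kronHfc A F p q = c * ∫ t in (0 : ℝ)..T,
      F (γ t) p.1 q.1 * γ' t * resolv A (γ t) p.2 q.2 := by
    rw [kronHfc, Matrix.of_apply, h.hfc_eq hA (hF _ _), Matrix.smul_apply,
      h.cauchyInt_apply hA (hF _ _).2, smul_eq_mul]
  rw [e2, norm_mul]
  gcongr
  simp only [S]
  rw [← intervalIntegral.integral_const_mul]
  refine intervalIntegral.norm_integral_le_of_norm_le h.nonneg
    (Filter.Eventually.of_forall fun t _ => ?_)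
    ((continuous_const.mul (c0.mul (cR.matrix_elem p.2 q.2)).norm).intervalIntegrable _ _)
  rw [mul_assoc, norm_mul]
  gcongr
  calc ‖F (γ t) p.1 q.1‖ = ‖e p.1 q.1 (F (γ t))‖ := rfl
    _ ≤ ‖e p.1 q.1‖ * ‖F (γ t)‖ := (e p.1 q.1).le_opNorm _
    _ ≤ ‖e p.1 q.1‖ * 1 := by gcongr; exact hF1 t
    _ = _ := mul_one _

end kron

/-! ### The Crouzeix–Palencia argument. -/

/-- The norm inequality behind the Crouzeix–Palencia constant. -/
theorem pow_three_le_of_norm_add_le {a b : Type*} [Fintype a] [Fintype b] [DecidableEq a]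
    [DecidableEq b] {X : Matrix a b ℂ} {Y : Matrix b a ℂ} (h : ‖X + Yᴴ‖ ≤ 2) :
    ‖X‖ ^ 3 ≤ 2 * ‖X‖ ^ 2 + ‖X * Y * X‖ := by
  have e1 : ‖X‖ ^ 4 = ‖(Xᴴ * X) * (Xᴴ * X)‖ := by
    have h1 := Matrix.l2_opNorm_conjTranspose_mul_self X
    have h2 := Matrix.l2_opNorm_conjTranspose_mul_self (Xᴴ * X)
    rw [Matrix.conjTranspose_mul, Matrix.conjTranspose_conjTranspose, h1] at h2
    rw [h2]; ring
  -- One factor Xᴴ is replaced by (X + Yᴴ)ᴴ − Y.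
  have e2 : (Xᴴ * X) * (Xᴴ * X) = Xᴴ * X * (X + Yᴴ)ᴴ * X - Xᴴ * (X * Y * X) := by
    rw [Matrix.conjTranspose_add, Matrix.conjTranspose_conjTranspose]
    simp only [Matrix.mul_add, Matrix.add_mul, Matrix.mul_assoc]
    abel
  have hn : ‖Xᴴ‖ = ‖X‖ := Matrix.l2_opNorm_conjTranspose X
  have n1 : ‖Xᴴ * X * (X + Yᴴ)ᴴ * X‖ ≤ ‖X‖ * ‖X‖ * 2 * ‖X‖ := by
    refine (Matrix.l2_opNorm_mul _ _).trans ?_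
    gcongr
    refine (Matrix.l2_opNorm_mul _ _).trans ?_
    rw [Matrix.l2_opNorm_conjTranspose, Matrix.l2_opNorm_conjTranspose_mul_self]
    gcongr
  have n2 : ‖Xᴴ * (X * Y * X)‖ ≤ ‖X‖ * ‖X * Y * X‖ := by
    rw [← hn]
    exact Matrix.l2_opNorm_mul _ _
  have n3 : ‖X‖ ^ 4 ≤ ‖X‖ * ‖X‖ * 2 * ‖X‖ + ‖X‖ * ‖X * Y * X‖ := by
    rw [e1, e2]
    exact (norm_sub_le _ _).trans (add_le_add n1 n2)
  rcases (norm_nonneg X).eq_or_lt with h0 | h0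
  · rw [← h0]
    simp
  · refine le_of_mul_le_mul_left ?_ h0
    calc ‖X‖ * ‖X‖ ^ 3 = ‖X‖ ^ 4 := by ring
      _ ≤ _ := n3
      _ = _ := by ring

namespace IsSupportFn

variable {h h' h'' : ℝ → ℝ} {n : ℕ} {A : Matrix (Fin n) (Fin n) ℂ}

/-- `g(A)` for a Cauchy transform `g`. -/
theorem hfc_cauchyTransform (H : IsSupportFn h h' h'') {D : Set ℂ} {T : ℝ} {γ γ' : ℝ → ℂ}
    (hl : IsCauchyLoop (supportBody h) (supportBody h) D T γ γ') (hA : spectrum ℂ A ⊆ D)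
    {φ : ℂ → ℂ} (hφ : Continuous fun t => φ (supportCurve h h' t)) (i j : Fin n) :
    hfc A (cauchyTransform h h' h'' φ) i j = ∫ t in (0 : ℝ)..(2 * Real.pi),
      φ (supportCurve h h' t) * (((2 * Real.pi * Complex.I : ℂ)⁻¹ * supportCurveDeriv h h'' t) •
        resolv A (supportCurve h h' t)) i j := by
  have hG := H.differentiableOn_cauchyTransform hφ
  have c0 := hl.continuous_deriv
  have cR := hl.continuous_resolv hA
  have cd := H.continuous_curveDeriv
  rw [hl.hfc_eq hA ⟨hG, hG.continuousOn⟩, Matrix.smul_apply,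
    hl.cauchyInt_apply hA hG.continuousOn, smul_eq_mul]
  set c := (2 * Real.pi * Complex.I : ℂ)⁻¹ with hc
  -- G is holomorphic only inside the body, so G(A) is an integral over the inner loop γ. By
  -- `hfc_inv` the resolvent at an outer point is an integral over that same loop, and Fubini
  -- matches the two.
  have hR : ∀ t, resolv A (supportCurve h h' t) i j = c * ∫ u in (0 : ℝ)..T,
      (supportCurve h h' t - γ u)⁻¹ * γ' u * resolv A (γ u) i j := by
    intro t
    have hmem := curve_notMem (h := h) (h' := h') t
    have hcont : ContinuousOn (fun z => (supportCurve h h' t - z)⁻¹) (supportBody h) :=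
      (continuousOn_const.sub continuousOn_id).inv₀ fun z hz h0 => by
        have h1 : supportCurve h h' t = z := sub_eq_zero.1 h0
        exact hmem (h1 ▸ hz)
    have hdiff : DifferentiableOn ℂ (fun z => (supportCurve h h' t - z)⁻¹) (supportBody h) :=
      ((differentiableOn_const _).sub differentiableOn_id).inv fun z hz h0 => by
        have h1 : supportCurve h h' t = z := sub_eq_zero.1 h0
        exact hmem (h1 ▸ hz)
    rw [← hl.hfc_inv hA hmem, hl.hfc_eq hA ⟨hdiff, hcont⟩, Matrix.smul_apply,
      hl.cauchyInt_apply hA hcont, smul_eq_mul]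
  have cK : Continuous (Function.uncurry fun u t : ℝ => logDerivCurve h h' h'' (γ u) t *
      φ (supportCurve h h' t) * (γ' u * resolv A (γ u) i j)) := by
    have c1 : Continuous fun q : ℝ × ℝ => logDerivCurve h h' h'' (γ q.1) q.2 :=
      H.continuousOn_logDerivCurve.comp_continuous (f := fun q : ℝ × ℝ => (γ q.1, q.2))
        ((hl.continuous.comp continuous_fst).prodMk continuous_snd) fun q => ⟨hl.mem _, trivial⟩
    have c2 : Continuous fun u => γ' u * resolv A (γ u) i j := c0.mul (cR.matrix_elem i j)
    exact (c1.mul (hφ.comp continuous_snd)).mul (c2.comp continuous_fst)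
  have swap := MeasureTheory.intervalIntegral_intervalIntegral_swap (a := 0) (b := T) (c := 0)
    (d := 2 * Real.pi) (F := fun u t : ℝ => logDerivCurve h h' h'' (γ u) t *
      φ (supportCurve h h' t) * (γ' u * resolv A (γ u) i j)) (by
      have hcomp : IsCompact (Set.uIcc 0 T ×ˢ Set.uIcc 0 (2 * Real.pi)) :=
        isCompact_uIcc.prod isCompact_uIcc
      exact (cK.continuousOn.integrableOn_compact hcomp).mono_set
        (Set.prod_mono Set.uIoc_subset_uIcc Set.uIoc_subset_uIcc))
  have e1 : ∀ u, cauchyTransform h h' h'' φ (γ u) * γ' u * resolv A (γ u) i j =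
      c * ∫ t in (0 : ℝ)..(2 * Real.pi), logDerivCurve h h' h'' (γ u) t *
      φ (supportCurve h h' t) * (γ' u * resolv A (γ u) i j) := by
    intro u
    rw [intervalIntegral.integral_mul_const, cauchyTransform]
    simp only [smul_eq_mul]
    ring
  simp only [e1]
  rw [intervalIntegral.integral_const_mul, swap]
  simp only [← intervalIntegral.integral_const_mul]
  refine intervalIntegral.integral_congr fun t _ => ?_
  simp only [Matrix.smul_apply, smul_eq_mul]
  rw [hR t]
  simp only [← intervalIntegral.integral_const_mul]
  refine intervalIntegral.integral_congr fun u _ => ?_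
  simp only [logDerivCurve]
  ring

section

variable {α β : Type*} [Fintype α] [Fintype β] [DecidableEq α] [DecidableEq β]

open scoped ComplexOrder in
/-- There is a companion function `G` with `‖F{A} + G{A}ᴴ‖ ≤ 2`. -/
theorem exists_companion (H : IsSupportFn h h' h'') (hA : numericalRange A ⊆ supportBody h)
    {D : Set ℂ} {T : ℝ} {γ γ' : ℝ → ℂ}
    (hl : IsCauchyLoop (supportBody h) (supportBody h) D T γ γ') (hAD : spectrum ℂ A ⊆ D)
    {ε : ℝ} (hε : 0 < ε) {F : ℂ → Matrix α β ℂ}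
    (hF : ∀ i j, DifferentiableOn ℂ (fun z => F z i j) (supportBody fun θ => h θ + ε))
    (hF1 : ∀ z ∈ supportBody (fun θ => h θ + ε), ‖F z‖ ≤ 1) :
    ∃ G : ℂ → Matrix β α ℂ, (∀ i j, DifferentiableOn ℂ (fun z => G z i j) (supportBody h)) ∧
      (∀ z ∈ supportBody h, ‖G z‖ ≤ 1) ∧ ‖kronHfc A F + (kronHfc A G)ᴴ‖ ≤ 2 := by
  set U := supportBody fun θ => h θ + ε with hU
  have hUo : IsOpen U := (H.add_const hε.le).isOpen
  have hsub : supportBody h ⊆ U := subset_supportBody_add h hε.le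
  have hcurve : ∀ t, supportCurve h h' t ∈ U := H.curve_mem_add hε
  have hclU : {z | ∀ θ, (rot θ * z).re ≤ h θ} ⊆ U := fun z hz θ => (hz θ).trans_lt (by linarith)
  have hL : IsCauchyLoop U U (supportBody h) (2 * Real.pi) (supportCurve h h')
      (supportCurveDeriv h h'') :=
    H.isCauchyLoop hUo (supportBody_convex _) hcurve subset_rfl hsub
  have hsp : spectrum ℂ A ⊆ supportBody h := (spectrum_subset_numericalRange A).trans hA
  have hFhol : ∀ i j, HolOn U U fun z => F z i j := fun i j => ⟨hF i j, (hF i j).continuousOn⟩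
  have hFc : ∀ i j, Continuous fun t => F (supportCurve h h' t) i j := fun i j =>
    hL.continuous_comp (hF i j).continuousOn
  have hFcm : Continuous fun t => F (supportCurve h h' t) := continuous_matrix hFc
  set Φ : ℂ → Matrix β α ℂ := fun z => (F z)ᴴ with hΦ
  have hΦcont : ContinuousOn Φ U := by
    refine continuousOn_pi.2 fun i => continuousOn_pi.2 fun j => ?_
    exact Complex.continuous_conj.comp_continuousOn (hF j i).continuousOn
  have hΦc : Continuous fun t => Φ (supportCurve h h' t) :=
    hΦcont.comp_continuous H.continuous_curve hcurve
  have hΦ1 : ∀ z ∈ U, ‖Φ z‖ ≤ 1 := fun z hz => by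
    rw [hΦ]
    simp only
    rw [Matrix.l2_opNorm_conjTranspose]
    exact hF1 z hz
  have hGij : ∀ z ∈ supportBody h, ∀ i j, cauchyTransform h h' h'' Φ z i j =
      cauchyTransform h h' h'' (fun z => (starRingEnd ℂ) (F z j i)) z := by
    intro z hz i j
    have c1 : Continuous fun t => logDerivCurve h h' h'' z t • Φ (supportCurve h h' t) :=
      (H.continuous_logDerivCurve hz).smul hΦc
    exact congrArg ((2 * Real.pi * Complex.I : ℂ)⁻¹ • ·)
      (intervalIntegral_matrix_apply c1 0 (2 * Real.pi) i j)
  have hconjc : ∀ i j, Continuous fun t =>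
      (starRingEnd ℂ) (F (supportCurve h h' t) j i) := fun i j =>
    Complex.continuous_conj.comp (hFc j i)
  -- The conjugated Cauchy formula for F; the minus sign is the conjugate of i.
  have hconj : ∀ w ∈ supportBody h, (2 * Real.pi * Complex.I : ℂ)⁻¹ •
      ∫ t in (0 : ℝ)..(2 * Real.pi), (starRingEnd ℂ) (logDerivCurve h h' h'' w t) •
        Φ (supportCurve h h' t) = -Φ w := by
    intro w hw
    have c1 : Continuous fun t => (starRingEnd ℂ) (logDerivCurve h h' h'' w t) •
        Φ (supportCurve h h' t) :=
      (Complex.continuous_conj.comp (H.continuous_logDerivCurve hw)).smul hΦc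
    ext i j
    have h1 := hL.cauchy_formula (hFhol j i) hw
    have h2 : (∫ t in (0 : ℝ)..(2 * Real.pi), (starRingEnd ℂ) (logDerivCurve h h' h'' w t) •
        Φ (supportCurve h h' t)) i j = (starRingEnd ℂ) (∫ t in (0 : ℝ)..(2 * Real.pi),
          logDerivCurve h h' h'' w t * F (supportCurve h h' t) j i) := by
      rw [intervalIntegral_matrix_apply c1, ← intervalIntegral.intervalIntegral_conj]
      refine intervalIntegral.integral_congr fun t _ => ?_
      simp only [map_mul]
      rfl
    have h3 : (∫ t in (0 : ℝ)..(2 * Real.pi),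
        logDerivCurve h h' h'' w t * F (supportCurve h h' t) j i) =
        2 * Real.pi * Complex.I * F w j i := h1
    have h4 : Φ w i j = (starRingEnd ℂ) (F w j i) := rfl
    rw [Matrix.smul_apply, h2, h3, Matrix.neg_apply, h4, smul_eq_mul]
    have := Complex.ofReal_ne_zero.2 Real.pi_ne_zero
    have := Complex.I_ne_zero
    simp only [map_mul, Complex.conj_ofReal, Complex.conj_I, map_ofNat]
    field_simp
  have hG1 : ∀ z ∈ supportBody h, ‖cauchyTransform h h' h'' Φ z‖ ≤ 1 := fun z hz =>
    H.norm_cauchyTransform_le_one (hΦcont.mono hclU) (fun z hz => hΦ1 z (hclU hz)) hconj hz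
  -- The companion is the Cauchy transform of F*, written entrywise so that the scalar calculus
  -- applies to each entry.
  refine ⟨fun z => Matrix.of fun i j =>
    cauchyTransform h h' h'' (fun z => (starRingEnd ℂ) (F z j i)) z, ?_, ?_, ?_⟩
  · intro i j
    exact H.differentiableOn_cauchyTransform (Φ := fun z => (starRingEnd ℂ) (F z j i)) (hconjc i j)
  · intro z hz
    have e : (Matrix.of fun i j =>
        cauchyTransform h h' h'' (fun z => (starRingEnd ℂ) (F z j i)) z) =
        cauchyTransform h h' h'' Φ z := by
      ext i j
      rw [hGij z hz, Matrix.of_apply]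
    refine le_of_eq_of_le (congrArg _ e) (hG1 z hz)
  · set c : ℂ := (2 * Real.pi * Complex.I : ℂ)⁻¹ with hc
    -- N is the resolvent density: F{A} = ∫ F ⊗ N and G{A}* = ∫ F ⊗ N*, where F multiplies both
    -- because G is built from F*.
    set N : ℝ → Matrix (Fin n) (Fin n) ℂ := fun t =>
      (c * supportCurveDeriv h h'' t) • resolv A (supportCurve h h' t) with hN
    have cN : Continuous N :=
      (continuous_const.mul H.continuous_curveDeriv).smul (hL.continuous_resolv hsp)
    have cNH : Continuous fun t => (N t)ᴴ := cN.matrix_conjTranspose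
    have cM : Continuous fun t => N t + (N t)ᴴ := cN.add cNH
    have hN1 : ∫ t in (0 : ℝ)..(2 * Real.pi), N t = 1 := by
      have h1 := hL.hfc_const hsp 1
      rw [hL.hfc_eq hsp (HolOn.const 1), cauchyInt, ← intervalIntegral.integral_smul, one_smul]
        at h1
      rw [← h1]
      refine intervalIntegral.integral_congr fun t _ => ?_
      simp only [hN, one_mul, smul_smul, hc]
    have hNH : ∫ t in (0 : ℝ)..(2 * Real.pi), (N t)ᴴ = 1 := by
      ext i j
      have h1 : (∫ t in (0 : ℝ)..(2 * Real.pi), N t) j i = (1 : Matrix (Fin n) (Fin n) ℂ) j i := by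
        rw [hN1]
      rw [intervalIntegral_matrix_apply cN] at h1
      have h2 := congrArg (starRingEnd ℂ) h1
      rw [← intervalIntegral.intervalIntegral_conj] at h2
      rw [intervalIntegral_matrix_apply cNH, Matrix.one_apply]
      rw [Matrix.one_apply, apply_ite (starRingEnd ℂ), map_one, map_zero] at h2
      simp only [eq_comm (a := i)]
      exact h2
    have hint : ∫ t in (0 : ℝ)..(2 * Real.pi), (N t + (N t)ᴴ) = ((2 : ℝ) : ℂ) • 1 := by
      rw [intervalIntegral.integral_add (cN.intervalIntegrable _ _) (cNH.intervalIntegrable _ _),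
        hN1, hNH]
      push_cast
      rw [two_smul]
    have hpos : ∀ t, (N t + (N t)ᴴ).PosSemidef := by
      intro t
      have h1 := posSemidef_resolv_add (A := A) (x := supportCurve h h' t) (r := rot t)
        (ρ := (h t + h'' t) / (2 * Real.pi))
        (div_nonneg (H.nonneg t) Real.two_pi_pos.le) (hL.notMem_spectrum hsp t) (fun w hw => by
          rw [rot_mul_curve_self_re]
          exact (hA hw t).le)
      have h2 : N t = ((((h t + h'' t) / (2 * Real.pi) : ℝ) : ℂ) * star (rot t)) •
          resolv A (supportCurve h h' t) := by
        have h3 : star (rot t) = Complex.exp (t * Complex.I) := by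
          have h4 := exp_mul_rot t
          have h5 : star (rot t) * rot t = 1 := by
            rw [← starRingEnd_apply, Complex.conj_mul', norm_rot]; simp
          have h6 : rot t ≠ 0 := right_ne_zero_of_mul_eq_one h5
          exact mul_right_cancel₀ h6 (h5.trans h4.symm)
        simp only [hN]
        congr 1
        rw [h3, supportCurveDeriv, hc]
        have := Complex.ofReal_ne_zero.2 Real.pi_ne_zero
        have := Complex.I_ne_zero
        push_cast
        field_simp
      rw [h2]
      exact h1
    have key := norm_integral_kron_le hFcm (fun t => hF1 _ (hcurve t)) cM hpos
      Real.two_pi_pos.le zero_le_two hint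
    refine le_of_eq_of_le (congrArg _ ?_) key
    have ck : Continuous fun t => F (supportCurve h h' t) ⊗ₖ (N t + (N t)ᴴ) :=
      continuous_matrix fun p q => (hFc p.1 q.1).mul (cM.matrix_elem p.2 q.2)
    ext ⟨a, i⟩ ⟨b, j⟩
    have g1 : kronHfc A F (a, i) (b, j) = ∫ t in (0 : ℝ)..(2 * Real.pi),
        F (supportCurve h h' t) a b * N t i j := by
      have ck' : Continuous fun t => F (supportCurve h h' t) ⊗ₖ N t :=
        continuous_matrix fun p q => (hFc p.1 q.1).mul (cN.matrix_elem p.2 q.2)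
      rw [kronHfc_eq_integral hL hsp hFhol]
      exact intervalIntegral_matrix_apply ck' 0 (2 * Real.pi) (a, i) (b, j)
    have g2 := H.hfc_cauchyTransform hl hAD
      (φ := fun z => (starRingEnd ℂ) (F z a b)) (hconjc b a) j i
    have g3 := congrArg (starRingEnd ℂ) g2
    rw [← intervalIntegral.intervalIntegral_conj] at g3
    have d1 : Continuous fun t => F (supportCurve h h' t) a b * N t i j :=
      (hFc a b).mul (cN.matrix_elem i j)
    have d2 : Continuous fun t => F (supportCurve h h' t) a b * (N t)ᴴ i j :=
      (hFc a b).mul (cNH.matrix_elem i j)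
    rw [intervalIntegral_matrix_apply ck, Matrix.add_apply, g1]
    refine (congrArg (_ + ·) (g3.trans (c := ∫ t in (0 : ℝ)..(2 * Real.pi),
      F (supportCurve h h' t) a b * (N t)ᴴ i j) ?_)).trans ?_
    · refine intervalIntegral.integral_congr fun t _ => ?_
      simp only [map_mul, Complex.conj_conj]
      rfl
    · rw [← intervalIntegral.integral_add (d1.intervalIntegrable _ _) (d2.intervalIntegrable _ _)]
      refine intervalIntegral.integral_congr fun t _ => ?_
      simp only [Matrix.kroneckerMap_apply, Matrix.add_apply, mul_add]

/-- The Crouzeix–Palencia bound over a smooth convex domain containing the numerical range. -/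
theorem norm_kronHfc_le (H : IsSupportFn h h' h'') (hA : numericalRange A ⊆ supportBody h)
    {τ : ℝ} (hτ : 0 < τ) {F : ℂ → Matrix α β ℂ}
    (hF : ∀ i j, DifferentiableOn ℂ (fun z => F z i j) (supportBody fun θ => h θ + τ))
    (hF1 : ∀ z ∈ supportBody (fun θ => h θ + τ), ‖F z‖ ≤ 1) :
    ‖kronHfc A F‖ ≤ 1 + √2 := by
  have hsp : spectrum ℂ A ⊆ supportBody h := (spectrum_subset_numericalRange A).trans hA
  have hloop : ∀ s, 0 < s → IsCauchyLoop (supportBody fun θ => h θ + s)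
      (supportBody fun θ => h θ + s) (supportBody h) (2 * Real.pi) (supportCurve h h')
      (supportCurveDeriv h h'') := fun s hs =>
    H.isCauchyLoop (H.add_const hs.le).isOpen (supportBody_convex _) (H.curve_mem_add hs)
      subset_rfl (subset_supportBody_add h hs.le)
  obtain ⟨B, hB⟩ : ∃ B : ℝ, ∀ s, 0 < s → ∀ F : ℂ → Matrix α β ℂ,
      (∀ i j, DifferentiableOn ℂ (fun z => F z i j) (supportBody fun θ => h θ + s)) →
      (∀ z ∈ supportBody (fun θ => h θ + s), ‖F z‖ ≤ 1) → ‖kronHfc A F‖ ≤ B := by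
    obtain ⟨B, hB⟩ := exists_norm_kronHfc_le (α := α) (β := β) (hloop 1 one_pos) hsp
    exact ⟨B, fun s hs F hF hF1 => hB _ _ _ (hloop s hs) hsp F
      (fun i j => ⟨hF i j, (hF i j).continuousOn⟩) fun t => hF1 _ (H.curve_mem_add hs t)⟩
  by_contra hcon
  push Not at hcon
  set x₀ := ‖kronHfc A F‖ with hx₀
  have h2 : (0 : ℝ) ≤ √2 := Real.sqrt_nonneg 2
  have h22 : √2 * √2 = 2 := Real.mul_self_sqrt zero_le_two
  -- x(x − 2) = 1 has positive root 1 + √2, so exceeding the bound means a growth factor q > 1.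
  set q := x₀ * (x₀ - 2) with hq
  have hq1 : 1 < q := by nlinarith
  have step : ∀ s, 0 < s → ∀ F : ℂ → Matrix α β ℂ,
      (∀ i j, DifferentiableOn ℂ (fun z => F z i j) (supportBody fun θ => h θ + s)) →
      (∀ z ∈ supportBody (fun θ => h θ + s), ‖F z‖ ≤ 1) → x₀ ≤ ‖kronHfc A F‖ →
      ∃ F' : ℂ → Matrix α β ℂ,
      (∀ i j, DifferentiableOn ℂ (fun z => F' z i j) (supportBody fun θ => h θ + s / 2)) ∧
      (∀ z ∈ supportBody (fun θ => h θ + s / 2), ‖F' z‖ ≤ 1) ∧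
      q * ‖kronHfc A F‖ ≤ ‖kronHfc A F'‖ := by
    intro s hs F hF hF1 hx
    have hs2 : 0 < s / 2 := by linarith
    have e : ∀ θ, h θ + s / 2 + s / 2 = h θ + s := fun θ => by ring
    have hl := hloop _ hs2
    -- The collar of width s is halved: the transform is taken over the boundary of the body h +
    -- s/2, leaving s/2 for the holomorphy of F beyond it.
    obtain ⟨G, hG, hG1, hFG⟩ := (H.add_const hs2.le).exists_companion
      (hA.trans (subset_supportBody_add h hs2.le)) hl hsp hs2 (F := F)
      (by simpa only [e] using hF) (by simpa only [e] using hF1)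
    have hsub := supportBody_add_subset h (by linarith : s / 2 ≤ s)
    have hFhol : ∀ i j, HolOn (supportBody fun θ => h θ + s / 2)
        (supportBody fun θ => h θ + s / 2) fun z => F z i j := fun i j =>
      ⟨(hF i j).mono hsub, ((hF i j).mono hsub).continuousOn⟩
    have hGhol : ∀ i j, HolOn (supportBody fun θ => h θ + s / 2)
        (supportBody fun θ => h θ + s / 2) fun z => G z i j := fun i j =>
      ⟨hG i j, (hG i j).continuousOn⟩
    have hFGhol : ∀ i j, HolOn (supportBody fun θ => h θ + s / 2)
        (supportBody fun θ => h θ + s / 2) fun z => (F z * G z) i j := fun i j => by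
      simp only [Matrix.mul_apply]
      exact HolOn.sum _ fun k _ => (hFhol i k).mul (hGhol k j)
    -- FGF replaces F: its value at A is XYX, of norm at least x²(x − 2) ≥ qx.
    refine ⟨fun z => F z * G z * F z, fun i j => ?_, fun z hz => ?_, ?_⟩
    · simp only [Matrix.mul_apply (M := F _ * G _)]
      exact (HolOn.sum _ fun k _ => (hFGhol i k).mul (hFhol k j)).1
    · have n1 := hF1 z (hsub hz)
      have n2 := hG1 z hz
      calc ‖F z * G z * F z‖ ≤ ‖F z * G z‖ * ‖F z‖ := Matrix.l2_opNorm_mul _ _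
        _ ≤ (‖F z‖ * ‖G z‖) * ‖F z‖ := by gcongr; exact Matrix.l2_opNorm_mul _ _
        _ ≤ (1 * 1) * 1 := by gcongr
        _ = 1 := by norm_num
    · rw [kronHfc_mul hl hsp hFGhol hFhol, kronHfc_mul hl hsp hFhol hGhol]
      have key := pow_three_le_of_norm_add_le hFG
      set x := ‖kronHfc A F‖
      have hx2 : q ≤ x * (x - 2) := by
        rw [hq]
        nlinarith
      nlinarith
  have growth : ∀ (k : ℕ) (s : ℝ), 0 < s → ∀ F : ℂ → Matrix α β ℂ,
      (∀ i j, DifferentiableOn ℂ (fun z => F z i j) (supportBody fun θ => h θ + s)) →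
      (∀ z ∈ supportBody (fun θ => h θ + s), ‖F z‖ ≤ 1) → x₀ ≤ ‖kronHfc A F‖ →
      q ^ k * ‖kronHfc A F‖ ≤ B := by
    intro k
    induction k with
    | zero =>
      intro s hs F hF hF1 _
      simpa using hB s hs F hF hF1
    | succ k ih =>
      intro s hs F hF hF1 hx
      obtain ⟨F', hF', hF1', hq'⟩ := step s hs F hF hF1 hx
      have hx0 : 0 ≤ ‖kronHfc A F‖ := norm_nonneg _
      have h1 := ih (s / 2) (by linarith) F' hF' hF1' (hx.trans (by nlinarith))
      calc q ^ (k + 1) * ‖kronHfc A F‖ = q ^ k * (q * ‖kronHfc A F‖) := by ring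
        _ ≤ q ^ k * ‖kronHfc A F'‖ := by gcongr
        _ ≤ B := h1
  have hx0 : 0 < x₀ := by linarith
  obtain ⟨k, hk⟩ := pow_unbounded_of_one_lt (B / x₀) hq1
  have := growth k τ hτ F hF hF1 le_rfl
  rw [div_lt_iff₀ hx0] at hk
  linarith

end

end IsSupportFn

/-! ### Compactness and convexity of the numerical range. -/

section numericalRange

variable {n : ℕ} (A : Matrix (Fin n) (Fin n) ℂ)

theorem numericalRange_isCompact : IsCompact (numericalRange A) := by
  have h1 : IsCompact (Metric.sphere (0 : EuclideanSpace ℂ (Fin n)) 1) := isCompact_sphere _ _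
  have h2 : Continuous fun v : EuclideanSpace ℂ (Fin n) => star v.ofLp ⬝ᵥ A.mulVec v.ofLp := by
    have : Continuous fun v : EuclideanSpace ℂ (Fin n) => v.ofLp := PiLp.continuous_ofLp 2 _
    exact Continuous.dotProduct this.star (continuous_const.matrix_mulVec this)
  convert h1.image h2 using 1
  ext z
  simp only [numericalRange, Set.mem_ofPred_eq, Set.mem_image, mem_sphere_iff_norm, sub_zero]
  exact exists_congr fun v => and_congr_right fun _ => eq_comm

theorem numericalRange_nonempty (hn : 0 < n) : (numericalRange A).Nonempty := by
  have : NeZero n := ⟨hn.ne'⟩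
  exact ⟨_, EuclideanSpace.single (0 : Fin n) (1 : ℂ), by simp, rfl⟩

/-- The Toeplitz–Hausdorff theorem. -/
theorem numericalRange_convex : Convex ℝ (numericalRange A) := by
  rw [convex_iff_segment_subset]
  rintro _ ⟨v₁, hv₁, rfl⟩ _ ⟨v₂, hv₂, rfl⟩
  set z₁ := star v₁.ofLp ⬝ᵥ A.mulVec v₁.ofLp with hz₁
  set z₂ := star v₂.ofLp ⬝ᵥ A.mulVec v₂.ofLp with hz₂
  rw [segment_eq_image']
  rintro _ ⟨s, hs, rfl⟩
  by_cases hz : z₂ - z₁ = 0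
  · simp only [hz, smul_zero, add_zero]
    exact ⟨v₁, hv₁, rfl⟩
  set x := v₁.ofLp
  set y := v₂.ofLp
  have hx1 : star x ⬝ᵥ x = 1 := by
    rw [star_dotProduct_self_eq x]
    change (((‖v₁‖ ^ 2 : ℝ)) : ℂ) = 1
    rw [hv₁]; simp
  have hy1 : star y ⬝ᵥ y = 1 := by
    rw [star_dotProduct_self_eq y]
    change (((‖v₂‖ ^ 2 : ℝ)) : ℂ) = 1
    rw [hv₂]; simp
  -- Affine normalization sending z₁ to 0 and z₂ to 1.
  set B : Matrix (Fin n) (Fin n) ℂ := (z₂ - z₁)⁻¹ • (A - z₁ • 1) with hB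
  have hBq : ∀ u w : Fin n → ℂ, star u ⬝ᵥ B.mulVec w =
      (z₂ - z₁)⁻¹ * (star u ⬝ᵥ A.mulVec w - z₁ * (star u ⬝ᵥ w)) := by
    intro u w
    rw [hB, Matrix.smul_mulVec, Matrix.sub_mulVec, Matrix.smul_mulVec, Matrix.one_mulVec,
      dotProduct_smul, dotProduct_sub, dotProduct_smul, smul_eq_mul, smul_eq_mul]
  have hBx : star x ⬝ᵥ B.mulVec x = 0 := by rw [hBq, hx1, ← hz₁]; ring
  have hBy : star y ⬝ᵥ B.mulVec y = 1 := by
    rw [hBq, hy1, ← hz₂, mul_one, inv_mul_cancel₀ hz]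
  set w := star x ⬝ᵥ B.mulVec y - (starRingEnd ℂ) (star y ⬝ᵥ B.mulVec x) with hw
  -- The phase c makes the cross term k real, so the form of B along the path V is real and the
  -- intermediate value theorem applies.
  obtain ⟨c, hc1, hcw⟩ : ∃ c : ℂ, ‖c‖ = 1 ∧ (c * w).im = 0 := by
    refine ⟨rot w.arg, norm_rot _, ?_⟩
    rw [rot_arg_mul, Complex.ofReal_im]
  have hcc : (starRingEnd ℂ) c * c = 1 := by rw [Complex.conj_mul', hc1]; simp
  set k : ℂ := c * (star x ⬝ᵥ B.mulVec y) + (starRingEnd ℂ) c * (star y ⬝ᵥ B.mulVec x) with hk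
  have hkim : k.im = 0 := by
    have e : k = c * w + (c * (starRingEnd ℂ) (star y ⬝ᵥ B.mulVec x) +
        (starRingEnd ℂ) (c * (starRingEnd ℂ) (star y ⬝ᵥ B.mulVec x))) := by
      rw [hk, hw, map_mul, Complex.conj_conj]; ring
    rw [e, Complex.add_im, hcw, Complex.add_conj]
    simp
  have hkre : k = (k.re : ℂ) := by
    apply Complex.ext <;> simp [hkim]
  let V : ℝ → Fin n → ℂ := fun t => ((1 - t : ℝ) : ℂ) • x + ((t : ℂ) * c) • y
  have hVexp : ∀ (N : Matrix (Fin n) (Fin n) ℂ) (t : ℝ), star (V t) ⬝ᵥ N.mulVec (V t) =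
      (1 - t) ^ 2 * (star x ⬝ᵥ N.mulVec x) + t ^ 2 * (star y ⬝ᵥ N.mulVec y) +
      t * (1 - t) * (c * (star x ⬝ᵥ N.mulVec y) +
        (starRingEnd ℂ) c * (star y ⬝ᵥ N.mulVec x)) := by
    intro N t
    simp only [V, star_add, star_smul, Matrix.mulVec_add, Matrix.mulVec_smul, add_dotProduct,
      dotProduct_add, smul_dotProduct, dotProduct_smul, smul_eq_mul, star_mul',
      Complex.star_def, Complex.conj_ofReal]
    push_cast
    linear_combination ((t : ℂ) ^ 2 * (star y ⬝ᵥ N.mulVec y)) * hcc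
  have hVB : ∀ t : ℝ, star (V t) ⬝ᵥ B.mulVec (V t) = ((t ^ 2 + t * (1 - t) * k.re : ℝ) : ℂ) := by
    intro t
    rw [hVexp, hBx, hBy, ← hk, hkre]
    push_cast
    simp
  set N : ℝ → ℝ := fun t => ‖(WithLp.toLp 2 (V t) : EuclideanSpace ℂ (Fin n))‖ ^ 2 with hN
  have hNeq : ∀ t, star (V t) ⬝ᵥ V t = ((N t : ℝ) : ℂ) := fun t => star_dotProduct_self_eq (V t)
  have hVcont : Continuous V := by
    refine continuous_pi fun i => ?_
    simp only [V, Pi.add_apply, Pi.smul_apply, smul_eq_mul]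
    fun_prop
  have hNcont : Continuous N :=
    ((PiLp.continuous_toLp 2 _).comp hVcont).norm.pow 2
  -- Otherwise y would be a multiple of x, and the form of B would vanish at y instead of being 1.
  have hVne : ∀ t, V t ≠ 0 := by
    intro t ht
    by_cases ht0 : t = 0
    · rw [ht0] at ht
      simp only [V, sub_zero, Complex.ofReal_one, one_smul, Complex.ofReal_zero, zero_mul,
        zero_smul, add_zero] at ht
      rw [ht] at hx1
      simp at hx1
    have hy : y = (-(((1 - t : ℝ) : ℂ)) * (t : ℂ)⁻¹ * (starRingEnd ℂ) c) • x := by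
      have h1 : ((t : ℂ) * c) • y = -(((1 - t : ℝ) : ℂ) • x) := by
        have ht' : ((1 - t : ℝ) : ℂ) • x + ((t : ℂ) * c) • y = 0 := ht
        exact eq_neg_of_add_eq_zero_right ht'
      have htc : (t : ℂ) ≠ 0 := Complex.ofReal_ne_zero.2 ht0
      have h2 : y = ((t : ℂ)⁻¹ * (starRingEnd ℂ) c) • (((t : ℂ) * c) • y) := by
        rw [smul_smul]
        have : (t : ℂ)⁻¹ * (starRingEnd ℂ) c * (t * c) = 1 := by
          field_simp
          linear_combination hcc
        rw [this, one_smul]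
      rw [h2, h1, ← neg_smul, smul_smul]
      congr 1
      ring
    rw [hy] at hBy
    simp only [star_smul, Matrix.mulVec_smul, smul_dotProduct, dotProduct_smul, hBx, smul_zero]
      at hBy
    exact zero_ne_one hBy
  have hNne : ∀ t, N t ≠ 0 := by
    intro t h0
    apply hVne t
    have : (WithLp.toLp 2 (V t) : EuclideanSpace ℂ (Fin n)) = 0 :=
      norm_eq_zero.1 (pow_eq_zero_iff two_ne_zero |>.1 h0)
    simpa using this
  have hφ : Continuous fun t : ℝ => (t ^ 2 + t * (1 - t) * k.re) / N t :=
    Continuous.div (by fun_prop) hNcont hNne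
  have hN1 : N 1 = 1 := by
    have h1 := hNeq 1
    have : star (V 1) ⬝ᵥ V 1 = 1 := by
      simpa [hy1] using hVexp 1 1
    rw [this] at h1
    exact_mod_cast h1.symm
  obtain ⟨t, -, ht⟩ := (isPreconnected_Icc (a := (0 : ℝ)) (b := 1)).intermediate_value
    (Set.left_mem_Icc.2 zero_le_one) (Set.right_mem_Icc.2 zero_le_one) hφ.continuousOn
    (by simpa [hN1] using hs)
  simp only at ht
  obtain ⟨z, hzW, hzV⟩ := exists_mem_numericalRange A (hVne t)
  have h1 := hBq (V t) (V t)
  rw [hVB, hNeq, hzV] at h1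
  have h2 : (t ^ 2 + t * (1 - t) * k.re : ℝ) = s * N t := by
    rw [← ht]; field_simp [hNne t]
  rw [h2] at h1
  have hNc : ((N t : ℝ) : ℂ) ≠ 0 := Complex.ofReal_ne_zero.2 (hNne t)
  have h3 : z = z₁ + (s : ℂ) * (z₂ - z₁) := by
    change _ = (z₂ - z₁)⁻¹ * (((N t : ℝ) : ℂ) * z - z₁ * ((N t : ℝ) : ℂ)) at h1
    have h4 : ((N t : ℝ) : ℂ) * (s * (z₂ - z₁)) = ((N t : ℝ) : ℂ) * (z - z₁) := by
      push_cast at h1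
      field_simp at h1
      linear_combination ((N t : ℝ) : ℂ) * h1
    have h5 := mul_left_cancel₀ hNc h4
    rw [h5]; ring
  simp only [Complex.real_smul]
  rw [← h3]
  exact hzW

end numericalRange

/-! ### Smooth outer approximation of convex sets. -/

section smoothing

/-- The moving average over `[θ, θ + δ]`. -/
noncomputable def movAvg (δ : ℝ) (u : ℝ → ℝ) (θ : ℝ) : ℝ := δ⁻¹ * ∫ t in θ..(θ + δ), u t

theorem hasDerivAt_movAvg {u : ℝ → ℝ} (hu : Continuous u) (δ θ : ℝ) :
    HasDerivAt (movAvg δ u) (δ⁻¹ * (u (θ + δ) - u θ)) θ := by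
  have e : movAvg δ u = fun θ => δ⁻¹ * ((∫ t in (0 : ℝ)..(θ + δ), u t) - ∫ t in (0 : ℝ)..θ, u t) := by
    ext θ
    rw [movAvg, intervalIntegral.integral_interval_sub_left] <;> exact hu.intervalIntegrable _ _
  rw [e]
  have h1 := hu.integral_hasStrictDerivAt 0 (θ + δ)
  have h2 := hu.integral_hasStrictDerivAt 0 θ
  exact ((h1.hasDerivAt.comp_add_const θ δ).sub h2.hasDerivAt).const_mul _

theorem movAvg_periodic {u : ℝ → ℝ} {c : ℝ} (hu : Function.Periodic u c) (δ : ℝ) :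
    Function.Periodic (movAvg δ u) c := by
  intro θ
  rw [movAvg, movAvg, show θ + c + δ = θ + δ + c by ring,
    ← intervalIntegral.integral_comp_add_right]
  simp only [hu _]

theorem abs_movAvg_sub_le {u : ℝ → ℝ} (hu : Continuous u) {δ θ c ε : ℝ} (hδ : 0 < δ)
    (h : ∀ t ∈ Set.Icc θ (θ + δ), |u t - c| ≤ ε) : |movAvg δ u θ - c| ≤ ε := by
  have e : movAvg δ u θ - c = δ⁻¹ * ∫ t in θ..(θ + δ), (u t - c) := by
    rw [intervalIntegral.integral_sub (hu.intervalIntegrable _ _)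
      (continuous_const.intervalIntegrable _ _), intervalIntegral.integral_const, movAvg]
    simp only [add_sub_cancel_left, smul_eq_mul]
    field_simp
  have h1 : ‖∫ t in θ..(θ + δ), (u t - c)‖ ≤ ε * |θ + δ - θ| := by
    refine intervalIntegral.norm_integral_le_of_norm_le_const fun t ht => ?_
    rw [Set.uIoc_of_le (by linarith)] at ht
    exact h t ⟨ht.1.le, ht.2⟩
  rw [add_sub_cancel_left, abs_of_pos hδ, Real.norm_eq_abs] at h1
  rw [e, abs_mul, abs_of_pos (inv_pos.2 hδ)]
  calc δ⁻¹ * |∫ t in θ..(θ + δ), (u t - c)| ≤ δ⁻¹ * (ε * δ) := by gcongr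
    _ = ε := by field_simp

theorem norm_rot_sub_rot_le (θ θ' : ℝ) : ‖rot θ - rot θ'‖ ≤ |θ - θ'| := by
  have h1 : ∀ θ : ℝ, rot θ = Complex.exp (Complex.I * ((-θ : ℝ) : ℂ)) := fun θ => by
    rw [rot]; congr 1; push_cast; ring
  have h2 : rot θ - rot θ' = rot θ' * (Complex.exp (Complex.I * ((θ' - θ : ℝ) : ℂ)) - 1) := by
    rw [mul_sub, mul_one, h1, h1, ← Complex.exp_add]
    congr 2
    push_cast; ring
  rw [h2, norm_mul, norm_rot, one_mul, abs_sub_comm]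
  exact Real.norm_exp_I_mul_ofReal_sub_one_le

theorem rot_add_rot (θ δ : ℝ) : rot (θ + δ) + rot (θ - δ) = ((2 * Real.cos δ : ℝ) : ℂ) * rot θ := by
  simp only [rot_eq, Real.cos_add, Real.cos_sub, Real.sin_add, Real.sin_sub]
  push_cast
  ring

/-- A compact convex set has arbitrarily close outer approximations by bodies with `C²` support
functions. -/
theorem exists_isSupportFn {W : Set ℂ} (hW : IsCompact W) (hne : W.Nonempty) (hconv : Convex ℝ W)
    {ε : ℝ} (hε : 0 < ε) : ∃ h h' h'' τ, IsSupportFn h h' h'' ∧ 0 < τ ∧ W ⊆ supportBody h ∧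
      supportBody (fun θ => h θ + τ) ⊆ Metric.thickening ε W := by
  have hmax : ∀ θ, ∃ w ∈ W, ∀ z ∈ W, (rot θ * z).re ≤ (rot θ * w).re := fun θ =>
    hW.exists_isMaxOn hne (f := fun z => (rot θ * z).re) (by fun_prop)
  choose p hpW hp using hmax
  set u : ℝ → ℝ := fun θ => (rot θ * p θ).re with hu
  obtain ⟨R, hR⟩ := hW.isBounded.exists_norm_le
  have hR0 : 0 ≤ R := (norm_nonneg _).trans (hR _ (hpW 0))
  have hlip1 : ∀ θ θ', u θ - u θ' ≤ R * |θ - θ'| := by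
    intro θ θ'
    have h1 := hp θ' (p θ) (hpW θ)
    have h2 : (rot θ * p θ).re - (rot θ' * p θ).re = ((rot θ - rot θ') * p θ).re := by
      rw [sub_mul, Complex.sub_re]
    have h3 : ((rot θ - rot θ') * p θ).re ≤ R * |θ - θ'| := by
      refine (Complex.re_le_norm _).trans ?_
      rw [norm_mul, mul_comm]
      exact mul_le_mul (hR _ (hpW θ)) (norm_rot_sub_rot_le _ _) (norm_nonneg _) hR0
    simp only [hu]
    linarith
  have hlip : ∀ θ θ', |u θ - u θ'| ≤ R * |θ - θ'| := by
    intro θ θ'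
    rw [abs_le]
    have h1 := hlip1 θ θ'
    have h2 := hlip1 θ' θ
    rw [abs_sub_comm] at h2
    constructor <;> linarith
  have huc : Continuous u := by
    have : LipschitzWith (Real.toNNReal R) u := LipschitzWith.of_dist_le_mul fun θ θ' => by
      rw [Real.coe_toNNReal _ hR0, Real.dist_eq, Real.dist_eq]
      exact hlip θ θ'
    exact this.continuous
  have huper : Function.Periodic u (2 * Real.pi) := by
    intro θ
    simp only [hu]
    apply le_antisymm
    · have := hp θ (p (θ + 2 * Real.pi)) (hpW _)
      rwa [← rot_periodic θ] at this ⊢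
    · have := hp (θ + 2 * Real.pi) (p θ) (hpW _)
      rwa [rot_periodic θ] at this ⊢
  have huR : ∀ θ, |u θ| ≤ R := fun θ => by
    refine (Complex.abs_re_le_norm _).trans ?_
    rw [norm_mul, norm_rot, one_mul]
    exact hR _ (hpW θ)
  -- The discrete form of u + u'' ≥ 0, valid for any support function: compare three directions at
  -- the maximizer for θ.
  have hthree : ∀ θ δ, 2 * Real.cos δ * u θ ≤ u (θ + δ) + u (θ - δ) := by
    intro θ δ
    have h1 := hp (θ + δ) (p θ) (hpW θ)
    have h2 := hp (θ - δ) (p θ) (hpW θ)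
    have h3 : (rot (θ + δ) * p θ).re + (rot (θ - δ) * p θ).re = 2 * Real.cos δ * u θ := by
      rw [← Complex.add_re, ← add_mul, rot_add_rot, mul_assoc, Complex.re_ofReal_mul]
    simp only [hu] at h3 ⊢
    linarith
  set δ : ℝ := min 1 (ε / (8 * (R + 1))) with hδ
  have hδ0 : 0 < δ := lt_min one_pos (by positivity)
  have hδ1 : δ ≤ 1 := min_le_left _ _
  have hRδ : R * δ ≤ ε / 8 := by
    have h1 : (R + 1) * δ ≤ (R + 1) * (ε / (8 * (R + 1))) := by gcongr; exact min_le_right _ _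
    have h2 : (R + 1) * (ε / (8 * (R + 1))) = ε / 8 := by
      have : R + 1 ≠ 0 := by positivity
      field_simp
    nlinarith
  set h₁ := movAvg δ u with hh₁
  have hd₁ := hasDerivAt_movAvg huc δ
  have hc₁ : Continuous h₁ := continuous_iff_continuousAt.2 fun t => (hd₁ t).continuousAt
  have hd₂ := hasDerivAt_movAvg hc₁ δ
  -- Averaging twice makes the merely Lipschitz u into a C² function, with second derivative equal
  -- to the second difference quotient of u. The shift by δ centres the average, and ε/2 absorbs all
  -- errors.
  set h : ℝ → ℝ := fun θ => movAvg δ h₁ (θ - δ) + ε / 2 with hh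
  set h' : ℝ → ℝ := fun θ => δ⁻¹ * (h₁ θ - h₁ (θ - δ)) with hh'
  set h'' : ℝ → ℝ := fun θ => δ⁻¹ * (δ⁻¹ * (u (θ + δ) - u θ) - δ⁻¹ * (u θ - u (θ - δ))) with hh''
  have hclose : ∀ θ, |movAvg δ h₁ (θ - δ) - u θ| ≤ ε / 8 := by
    intro θ
    refine abs_movAvg_sub_le hc₁ hδ0 fun s hs => abs_movAvg_sub_le huc hδ0 fun t ht => ?_
    refine (hlip t θ).trans (le_trans ?_ hRδ)
    gcongr
    rw [abs_le]
    constructor <;> linarith [hs.1, hs.2, ht.1, ht.2]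
  have hH : IsSupportFn h h' h'' := by
    refine ⟨fun θ => ?_, fun θ => ?_, by fun_prop, fun θ => ?_, fun θ => ?_, fun θ => ?_⟩
    · have := ((hd₂ (θ - δ)).comp_sub_const θ δ).add_const (ε / 2)
      simpa only [sub_add_cancel] using this
    · have h1 := (hd₁ (θ - δ)).comp_sub_const θ δ
      rw [sub_add_cancel] at h1
      have h2 : HasDerivAt (fun y => h₁ y - h₁ (y - δ))
        (δ⁻¹ * (u (θ + δ) - u θ) - δ⁻¹ * (u θ - u (θ - δ))) θ := (hd₁ θ).sub h1
      exact h2.const_mul δ⁻¹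
    · have := movAvg_periodic (movAvg_periodic huper δ) δ (θ - δ)
      simp only [hh]
      rw [show θ + 2 * Real.pi - δ = θ - δ + 2 * Real.pi by ring, this]
    · have h1 : Function.Periodic h₁ (2 * Real.pi) := movAvg_periodic huper δ
      simp only [hh']
      rw [show θ + 2 * Real.pi - δ = θ - δ + 2 * Real.pi by ring, h1 θ, h1 (θ - δ)]
    · have h1 := hthree θ δ
      have h2 := (abs_le.1 (hclose θ)).1
      have h3 : h'' θ = (u (θ + δ) + u (θ - δ) - 2 * u θ) / δ ^ 2 := by
        simp only [hh'']; field_simp; ring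
      -- By the discrete inequality h'' ≥ −u − ε/8, while h ≥ u + ε/2 − ε/8; the sum is positive.
      have h4 : (2 * Real.cos δ - 2) * u θ / δ ^ 2 ≤ h'' θ := by
        rw [h3]; gcongr; linarith
      have h5 := Real.cos_bound (x := δ) (by rwa [abs_of_pos hδ0])
      rw [abs_of_pos hδ0] at h5
      have h6 : |(2 * Real.cos δ - 2) * u θ / δ ^ 2 + u θ| ≤ R * δ := by
        have e : (2 * Real.cos δ - 2) * u θ / δ ^ 2 + u θ =
            2 * (Real.cos δ - (1 - δ ^ 2 / 2)) / δ ^ 2 * u θ := by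
          field_simp; ring
        rw [e, abs_mul, mul_comm R]
        refine mul_le_mul ?_ (huR θ) (abs_nonneg _) hδ0.le
        rw [abs_div, abs_mul, abs_of_pos (by positivity : (0 : ℝ) < δ ^ 2), abs_two,
          div_le_iff₀ (by positivity)]
        have : δ ^ 4 ≤ δ ^ 3 := pow_le_pow_of_le_one hδ0.le hδ1 (by norm_num)
        nlinarith [pow_pos hδ0 3]
      have h7 := (abs_le.1 h6).1
      simp only [hh]
      linarith
  refine ⟨h, h', h'', ε / 4, hH, by linarith, fun w hw θ => ?_, fun z hz => ?_⟩
  · have h1 := hp θ w hw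
    have h2 := (abs_le.1 (hclose θ)).1
    simp only [hh]
    simp only [hu] at h2
    linarith
  -- At the nearest point P of W, the direction of z − P is an outer normal. Hence ‖z − P‖ is below
  -- h(θ) + ε/4 − u(θ) ≤ 7ε/8.
  · obtain ⟨P, hPW, hPmin⟩ := exists_norm_eq_iInf_of_complete_convex hne hW.isComplete hconv z
    have hproj := (norm_eq_iInf_iff_real_inner_le_zero hconv hPW).1 hPmin
    rw [Metric.mem_thickening_iff]
    refine ⟨P, hPW, ?_⟩
    rw [dist_eq_norm]
    by_cases h0 : z - P = 0
    · rw [h0, norm_zero]; exact hε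
    set θ := (z - P).arg with hθ
    have h1 : (rot θ * (z - P)).re = ‖z - P‖ := by rw [rot_arg_mul, Complex.ofReal_re]
    have h2 : u θ ≤ (rot θ * P).re := by
      have h3 := hproj (p θ) (hpW θ)
      have h4 : (starRingEnd ℂ) (z - P) = ‖z - P‖ * rot θ := by
        have h5 := congrArg (starRingEnd ℂ) (Complex.norm_mul_exp_arg_mul_I (z - P))
        rw [← h5, map_mul, Complex.conj_ofReal, ← Complex.exp_conj, map_mul, Complex.conj_ofReal,
          Complex.conj_I, mul_neg, rot]
      rw [Complex.inner, h4, mul_left_comm, Complex.re_ofReal_mul, mul_comm (p θ - P), mul_sub,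
        Complex.sub_re] at h3
      have h6 : 0 < ‖z - P‖ := norm_pos_iff.2 h0
      have h7 := nonpos_of_mul_nonpos_right h3 h6
      simp only [hu]
      linarith
    have h8 := hz θ
    have h9 := (abs_le.1 (hclose θ)).2
    simp only [hh] at h8
    rw [mul_sub, Complex.sub_re] at h1
    linarith

end smoothing

/-! ### The one-variable theorem on the numerical range. -/

section oneVariable

variable {α β : Type*} [Fintype α] [Fintype β] [DecidableEq α] [DecidableEq β]
  {n : ℕ} {A : Matrix (Fin n) (Fin n) ℂ}

/-- The Crouzeix–Palencia theorem for matrix-valued functions. -/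
theorem norm_kronHfc_le_of_numericalRange (hn : 0 < n) {U : Set ℂ} (hU : IsOpen U)
    (hA : numericalRange A ⊆ U) {F : ℂ → Matrix α β ℂ}
    (hF : ∀ i j, DifferentiableOn ℂ (fun z => F z i j) U) {M : ℝ}
    (hM : ∀ z ∈ numericalRange A, ‖F z‖ ≤ M) : ‖kronHfc A F‖ ≤ (1 + √2) * M := by
  obtain ⟨z₀, hz₀⟩ := numericalRange_nonempty A hn
  have hM0 : 0 ≤ M := (norm_nonneg _).trans (hM z₀ hz₀)
  -- The slack makes {‖F‖ < M + ε} an open neighbourhood of W(A), with room for a smooth body, and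
  -- makes M + ε invertible even if M = 0.
  suffices h : ∀ ε, 0 < ε → ‖kronHfc A F‖ ≤ (1 + √2) * (M + ε) by
    refine le_of_forall_pos_le_add fun ε hε => ?_
    have h2 : 0 < 1 + √2 := by positivity
    have := h (ε / (1 + √2)) (by positivity)
    rwa [mul_add, mul_div_cancel₀ _ h2.ne'] at this
  intro ε hε
  have hMε : 0 < M + ε := by linarith
  have hFc : ContinuousOn F U :=
    continuousOn_pi.2 fun i => continuousOn_pi.2 fun j => (hF i j).continuousOn
  have hVo : IsOpen (U ∩ F ⁻¹' {X | ‖X‖ < M + ε}) :=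
    hFc.isOpen_inter_preimage hU (isOpen_lt continuous_norm continuous_const)
  have hAV : numericalRange A ⊆ U ∩ F ⁻¹' {X | ‖X‖ < M + ε} := fun z hz =>
    ⟨hA hz, (hM z hz).trans_lt (by linarith)⟩
  obtain ⟨δ, hδ, hthick⟩ := (numericalRange_isCompact A).exists_thickening_subset_open hVo hAV
  obtain ⟨h, h', h'', τ, H, hτ, hWh, hbody⟩ := exists_isSupportFn (numericalRange_isCompact A)
    ⟨z₀, hz₀⟩ (numericalRange_convex A) hδ
  have hsub := hbody.trans hthick
  have hFd : ∀ i j, DifferentiableOn ℂ (fun z => F z i j) (supportBody fun θ => h θ + τ) :=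
    fun i j => (hF i j).mono (hsub.trans Set.inter_subset_left)
  set c : ℂ := ((M + ε : ℝ) : ℂ)⁻¹ with hc
  have hcn : ‖c‖ = (M + ε)⁻¹ := by
    rw [hc, norm_inv, Complex.norm_real, Real.norm_of_nonneg hMε.le]
  have key := H.norm_kronHfc_le hWh hτ (F := fun z => c • F z)
    (fun i j => (hFd i j).const_mul c) (fun z hz => by
      rw [norm_smul, hcn, inv_mul_le_iff₀ hMε, mul_one]
      exact (hsub hz).2.le)
  have hl := H.isCauchyLoop (H.add_const hτ.le).isOpen (supportBody_convex _)
    (H.curve_mem_add hτ) subset_rfl (subset_supportBody_add h hτ.le)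
  have e : kronHfc A (fun z => c • F z) = c • kronHfc A F := by
    ext ⟨a, i⟩ ⟨b, j⟩
    have h1 := hl.hfc_mul ((spectrum_subset_numericalRange A).trans hWh)
      (HolOn.const c) (f := fun _ => c) (g := fun z => F z a b)
      ⟨hFd a b, (hFd a b).continuousOn⟩
    rw [hl.hfc_const ((spectrum_subset_numericalRange A).trans hWh), Matrix.smul_mul,
      one_mul] at h1
    exact congrFun (congrFun h1 i) j
  rw [e, norm_smul, hcn, inv_mul_le_iff₀ hMε] at key
  linarith

end oneVariable

/-! ### Induction on the number of variables. -/

section multivariate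

variable {m p : ℕ}

theorem multivariateMatrixFunction_succ_apply {d : ℕ} {n : Fin (d + 1) → ℕ}
    (γ : Fin (d + 1) → ℝ → ℂ) (A : (i : Fin (d + 1)) → Matrix (Fin (n i)) (Fin (n i)) ℂ)
    (F : (Fin (d + 1) → ℂ) → Matrix (Fin m) (Fin p) ℂ)
    (I : KronIndex d m (fun i => n i.succ) × Fin (n 0))
    (J : KronIndex d p (fun i => n i.succ) × Fin (n 0)) :
    multivariateMatrixFunction γ A F I J = (2 * Real.pi * Complex.I : ℂ)⁻¹ *
      ∫ t in (0 : ℝ)..1, multivariateMatrixFunction (fun i : Fin d => γ i.succ)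
        (fun i => A i.succ) (fun y => F (Fin.cons (γ 0 t) y)) I.1 J.1 *
        resolv (A 0) (γ 0 t) I.2 J.2 * deriv (γ 0) t :=
  rfl

/-- The parameter space is arbitrary so that, in the induction, the contour parameter can join it:
`S` becomes `S × ℝ`. -/
theorem continuousOn_multivariateMatrixFunction {d : ℕ} {n : Fin d → ℕ} {γ : Fin d → ℝ → ℂ}
    {A : (i : Fin d) → Matrix (Fin (n i)) (Fin (n i)) ℂ} {Ω : Fin d → Set ℂ}
    (hΩ : ∀ i, IsConvexDomainWithBoundary (Ω i) (γ i)) (hW : ∀ i, numericalRange (A i) ⊆ Ω i)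
    {S : Type} [TopologicalSpace S] {K : Set S} {F : S → (Fin d → ℂ) → Matrix (Fin m) (Fin p) ℂ}
    (hF : ∀ r c, ContinuousOn (fun q : S × (Fin d → ℂ) => F q.1 q.2 r c)
      (K ×ˢ Set.univ.pi fun i => closure (Ω i))) (I : KronIndex d m n) (J : KronIndex d p n) :
    ContinuousOn (fun s => multivariateMatrixFunction γ A (F s) I J) K := by
  induction d generalizing S with
  | zero =>
    exact (hF I J).comp (f := fun s => (s, Fin.elim0)) (by fun_prop) fun s hs =>
      ⟨hs, fun i => i.elim0⟩
  | succ d ih =>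
    have hl := (hΩ 0).isCauchyLoop
    have hR := hl.continuous_resolv ((spectrum_subset_numericalRange (A 0)).trans (hW 0))
    refine ContinuousOn.const_mul (continuousOn_intervalIntegral_param
      (f := fun s t => multivariateMatrixFunction (fun i : Fin d => γ i.succ)
        (fun i => A i.succ) (fun y => F s (Fin.cons (γ 0 t) y)) I.1 J.1 *
        resolv (A 0) (γ 0 t) I.2 J.2 * deriv (γ 0) t) ?_ 0 1) _
    refine ContinuousOn.mul (ContinuousOn.mul ?_ ?_) ?_
    · refine ih (fun i => hΩ i.succ) (fun i => hW i.succ)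
        (F := fun (q : S × ℝ) y => F q.1 (Fin.cons (γ 0 q.2) y)) (fun r c => ?_) I.1 J.1
      have h0 : Continuous fun q : (S × ℝ) × (Fin d → ℂ) =>
          (q.1.1, (Fin.cons (γ 0 q.1.2) q.2 : Fin (d + 1) → ℂ)) :=
        (continuous_fst.comp continuous_fst).prodMk
          ((hl.continuous.comp (continuous_snd.comp continuous_fst)).finCons continuous_snd)
      refine (hF r c).comp h0.continuousOn fun q hq => ⟨hq.1.1, fun i _ => ?_⟩
      refine Fin.cases ?_ (fun j => ?_) i
      · exact hl.mem _
      · exact hq.2 j trivial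
    · exact ((hR.matrix_elem I.2 J.2).comp continuous_snd).continuousOn
    · exact (hl.continuous_deriv.comp continuous_snd).continuousOn

theorem differentiableOn_multivariateMatrixFunction {d : ℕ} {n : Fin d → ℕ}
    {γ : Fin d → ℝ → ℂ} {A : (i : Fin d) → Matrix (Fin (n i)) (Fin (n i)) ℂ} {Ω : Fin d → Set ℂ}
    (hΩ : ∀ i, IsConvexDomainWithBoundary (Ω i) (γ i)) (hW : ∀ i, numericalRange (A i) ⊆ Ω i)
    {U : Set ℂ} (hU : IsOpen U) {F : ℂ → (Fin d → ℂ) → Matrix (Fin m) (Fin p) ℂ}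
    (hF : ∀ r c, ContinuousOn (fun q : ℂ × (Fin d → ℂ) => F q.1 q.2 r c)
      (U ×ˢ Set.univ.pi fun i => closure (Ω i)))
    (hd : ∀ r c, ∀ y ∈ Set.univ.pi fun i => closure (Ω i),
      DifferentiableOn ℂ (fun s => F s y r c) U) (I : KronIndex d m n) (J : KronIndex d p n) :
    DifferentiableOn ℂ (fun s => multivariateMatrixFunction γ A (F s) I J) U := by
  induction d with
  | zero => exact hd I J Fin.elim0 fun i => i.elim0
  | succ d ih =>
    have hl := (hΩ 0).isCauchyLoop
    have hR := hl.continuous_resolv ((spectrum_subset_numericalRange (A 0)).trans (hW 0))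
    have hmem : ∀ t, ∀ y ∈ Set.univ.pi fun i : Fin d => closure (Ω i.succ),
        (Fin.cons (γ 0 t) y : Fin (d + 1) → ℂ) ∈ Set.univ.pi fun i => closure (Ω i) := by
      intro t y hy i _
      refine Fin.cases ?_ (fun j => ?_) i
      · exact hl.mem _
      · exact hy j trivial
    refine DifferentiableOn.const_mul (differentiableOn_intervalIntegral_param hU
      (f := fun s t => multivariateMatrixFunction (fun i : Fin d => γ i.succ)
        (fun i => A i.succ) (fun y => F s (Fin.cons (γ 0 t) y)) I.1 J.1 *
        resolv (A 0) (γ 0 t) I.2 J.2 * deriv (γ 0) t) ?_ (fun t => ?_) 0 1) _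
    · refine ContinuousOn.mul (ContinuousOn.mul ?_ ?_) ?_
      · refine continuousOn_multivariateMatrixFunction (fun i => hΩ i.succ) (fun i => hW i.succ)
          (F := fun (q : ℂ × ℝ) y => F q.1 (Fin.cons (γ 0 q.2) y)) (fun r c => ?_) I.1 J.1
        have h0 : Continuous fun q : (ℂ × ℝ) × (Fin d → ℂ) =>
            (q.1.1, (Fin.cons (γ 0 q.1.2) q.2 : Fin (d + 1) → ℂ)) :=
          (continuous_fst.comp continuous_fst).prodMk
            ((hl.continuous.comp (continuous_snd.comp continuous_fst)).finCons continuous_snd)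
        exact (hF r c).comp h0.continuousOn fun q hq => ⟨hq.1.1, hmem _ _ hq.2⟩
      · exact ((hR.matrix_elem I.2 J.2).comp continuous_snd).continuousOn
      · exact (hl.continuous_deriv.comp continuous_snd).continuousOn
    · refine ((ih (fun i => hΩ i.succ) (fun i => hW i.succ)
        (F := fun s y => F s (Fin.cons (γ 0 t) y)) (fun r c => ?_) (fun r c y hy => ?_)
        I.1 J.1).mul_const _).mul_const _
      · have h0 : Continuous fun q : ℂ × (Fin d → ℂ) =>
            (q.1, (Fin.cons (γ 0 t) q.2 : Fin (d + 1) → ℂ)) :=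
          continuous_fst.prodMk (continuous_const.finCons continuous_snd)
        exact (hF r c).comp h0.continuousOn fun q hq => ⟨hq.1, hmem _ _ hq.2⟩
      · exact hd r c _ (hmem t y hy)

theorem multivariateMatrixFunction_succ_eq_kronHfc {d : ℕ} {n : Fin (d + 1) → ℕ}
    {γ : Fin (d + 1) → ℝ → ℂ} {A : (i : Fin (d + 1)) → Matrix (Fin (n i)) (Fin (n i)) ℂ}
    {Ω : Set ℂ} (hΩ : IsConvexDomainWithBoundary Ω (γ 0)) (hW : numericalRange (A 0) ⊆ Ω)
    {F : (Fin (d + 1) → ℂ) → Matrix (Fin m) (Fin p) ℂ}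
    (hG : ∀ I J, HolOn Ω (closure Ω) fun x => multivariateMatrixFunction
      (fun i : Fin d => γ i.succ) (fun i => A i.succ) (fun y => F (Fin.cons x y)) I J) :
    multivariateMatrixFunction γ A F = kronHfc (A 0) fun x => multivariateMatrixFunction
      (fun i : Fin d => γ i.succ) (fun i => A i.succ) (fun y => F (Fin.cons x y)) := by
  have hl := hΩ.isCauchyLoop
  have hs := (spectrum_subset_numericalRange (A 0)).trans hW
  ext ⟨I, i⟩ ⟨J, j⟩
  rw [multivariateMatrixFunction_succ_apply, kronHfc, Matrix.of_apply, hl.hfc_eq hs (hG I J),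
    Matrix.smul_apply, hl.cauchyInt_apply hs (hG I J).2, smul_eq_mul]
  congr 1
  refine intervalIntegral.integral_congr fun t _ => ?_
  simp only
  ring

/-- A function that is analytic on a product of convex domains and continuous on its closure is
holomorphic in each variable when the others range over the closures. -/
theorem differentiableOn_update_of_analyticOnNhd {d : ℕ} {Ω : Fin d → Set ℂ}
    (ho : ∀ i, IsOpen (Ω i)) (hne : ∀ i, (Ω i).Nonempty) (hconv : ∀ i, Convex ℝ (Ω i))
    {f : (Fin d → ℂ) → ℂ} (hf : AnalyticOnNhd ℂ f (Set.univ.pi Ω))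
    (hfc : ContinuousOn f (Set.univ.pi fun i => closure (Ω i))) {y : Fin d → ℂ}
    (hy : y ∈ Set.univ.pi fun i => closure (Ω i)) (i : Fin d) :
    DifferentiableOn ℂ (fun x => f (Function.update y i x)) (Ω i) := by
  choose c hc using hne
  -- Points of the closure are approached along segments from interior points. The interior
  -- functions converge locally uniformly by compactness, so the limit is holomorphic; the recursion
  -- needs this because its other variables run on the boundaries.
  let g : ℝ → (Fin d → ℂ) := fun r j => (1 - r) • c j + r • y j
  have hgc : Continuous g := by fun_prop
  have hgcl : ∀ r ∈ Set.Icc (0 : ℝ) 1, ∀ j, g r j ∈ closure (Ω j) := fun r hr j =>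
    (hconv j).closure (subset_closure (hc j)) (hy j trivial) (sub_nonneg.2 hr.2) hr.1 (by ring)
  have hgin : ∀ r ∈ Set.Ico (0 : ℝ) 1, ∀ j, g r j ∈ Ω j := by
    intro r hr j
    have := (hconv j).combo_interior_closure_mem_interior ((ho j).interior_eq.symm ▸ hc j)
      (hy j trivial) (sub_pos.2 hr.2) hr.1 (by ring)
    rwa [(ho j).interior_eq] at this
  have hg1 : g 1 = y := by ext j; simp [g]
  have hmem : ∀ {s : Fin d → Set ℂ} {z : Fin d → ℂ} {x : ℂ}, (∀ j, z j ∈ s j) → x ∈ s i →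
      Function.update z i x ∈ Set.univ.pi s := by
    intro s z x hz hx j _
    by_cases h : j = i
    · subst h; rwa [Function.update_self]
    · rw [Function.update_of_ne h]; exact hz j
  have hne : (nhdsWithin (1 : ℝ) (Set.Ico 0 1)).NeBot := by
    rw [← mem_closure_iff_nhdsWithin_neBot, closure_Ico zero_ne_one]
    exact ⟨zero_le_one, le_rfl⟩
  have hlim : TendstoLocallyUniformlyOn (fun r x => f (Function.update (g r) i x))
      (fun x => f (Function.update y i x)) (nhdsWithin (1 : ℝ) (Set.Ico 0 1)) (Ω i) := by
    rw [tendstoLocallyUniformlyOn_iff_forall_isCompact (ho i)]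
    intro K hKΩ hK u hu
    have hcont : ContinuousOn (Function.uncurry fun r x => f (Function.update (g r) i x))
        (Set.Icc 0 1 ×ˢ K) := by
      have h0 : Continuous fun q : ℝ × ℂ => Function.update (g q.1) i q.2 :=
        (hgc.comp continuous_fst).update i continuous_snd
      exact hfc.comp h0.continuousOn fun q hq =>
        hmem (hgcl q.1 hq.1) (subset_closure (hKΩ hq.2))
    obtain ⟨v, hv, hvu⟩ := hK.mem_uniformity_of_prod hcont
      (Set.right_mem_Icc.2 zero_le_one) (symm_le_uniformity hu)
    filter_upwards [nhdsWithin_mono _ Set.Ico_subset_Icc_self hv] with r hr x hx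
    have := hvu r hr x hx
    rw [hg1] at this
    exact this
  refine hlim.differentiableOn ?_ (ho i)
  filter_upwards [self_mem_nhdsWithin] with r hr x hx
  have h1 : DifferentiableAt ℂ f (Function.update (g r) i x) :=
    (hf _ (hmem (hgin r hr) hx)).differentiableAt
  exact (h1.comp x (hasDerivAt_update (g r) i x).differentiableAt).differentiableWithinAt

/-- Separate holomorphy over the closures replaces joint analyticity because it is inherited when
the first variable is frozen at a point of the closure. For x in W(A₁) the inner function is bounded
by induction, and the outer calculus adds one factor. -/
theorem norm_multivariateMatrixFunction_le {d : ℕ} {n : Fin d → ℕ} (hn : ∀ i, 0 < n i)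
    {γ : Fin d → ℝ → ℂ} {A : (i : Fin d) → Matrix (Fin (n i)) (Fin (n i)) ℂ} {Ω : Fin d → Set ℂ}
    (hΩ : ∀ i, IsConvexDomainWithBoundary (Ω i) (γ i)) (hW : ∀ i, numericalRange (A i) ⊆ Ω i)
    {F : (Fin d → ℂ) → Matrix (Fin m) (Fin p) ℂ}
    (hd : ∀ r c, ∀ y ∈ Set.univ.pi fun i => closure (Ω i), ∀ i,
      DifferentiableOn ℂ (fun x => F (Function.update y i x) r c) (Ω i))
    (hF : ∀ r c, ContinuousOn (fun x => F x r c) (Set.univ.pi fun i => closure (Ω i))) {M : ℝ}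
    (hM : ∀ x ∈ Set.univ.pi fun i => numericalRange (A i), ‖F x‖ ≤ M) :
    ‖multivariateMatrixFunction γ A F‖ ≤ (1 + √2) ^ d * M := by
  induction d with
  | zero =>
    rw [pow_zero, one_mul]
    exact hM Fin.elim0 fun i => i.elim0
  | succ d ih =>
    have hmem : ∀ {s : Fin (d + 1) → Set ℂ} {x : ℂ} {y : Fin d → ℂ}, x ∈ s 0 →
        (y ∈ Set.univ.pi fun i : Fin d => s i.succ) →
        (Fin.cons x y : Fin (d + 1) → ℂ) ∈ Set.univ.pi s := by
      intro s x y hx hy i _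
      refine Fin.cases ?_ (fun j => ?_) i
      · exact hx
      · exact hy j trivial
    have h0 : Continuous fun q : ℂ × (Fin d → ℂ) => (Fin.cons q.1 q.2 : Fin (d + 1) → ℂ) :=
      Continuous.finCons (A := fun _ : Fin (d + 1) => ℂ) continuous_fst continuous_snd
    have hc : ∀ r c, ContinuousOn (fun q : ℂ × (Fin d → ℂ) => F (Fin.cons q.1 q.2) r c)
        (closure (Ω 0) ×ˢ Set.univ.pi fun i : Fin d => closure (Ω i.succ)) := fun r c =>
      (hF r c).comp h0.continuousOn fun q hq => hmem hq.1 hq.2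
    have hG : ∀ I J, HolOn (Ω 0) (closure (Ω 0)) fun x => multivariateMatrixFunction
        (fun i : Fin d => γ i.succ) (fun i => A i.succ) (fun y => F (Fin.cons x y)) I J := by
      refine fun I J => ⟨?_, ?_⟩
      · refine differentiableOn_multivariateMatrixFunction (fun i => hΩ i.succ)
          (fun i => hW i.succ) (hΩ 0).isOpen (F := fun x y => F (Fin.cons x y))
          (fun r c => (hc r c).mono (Set.prod_mono subset_closure subset_rfl))
          (fun r c y hy => ?_) I J
        obtain ⟨w, hw⟩ := (hΩ 0).nonempty
        have := hd r c (Fin.cons w y) (hmem (subset_closure hw) hy) 0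
        simpa only [Fin.update_cons_zero] using this
      · exact continuousOn_multivariateMatrixFunction (fun i => hΩ i.succ)
          (fun i => hW i.succ) (F := fun x y => F (Fin.cons x y)) hc I J
    rw [multivariateMatrixFunction_succ_eq_kronHfc (hΩ 0) (hW 0) hG, pow_succ', mul_assoc]
    refine norm_kronHfc_le_of_numericalRange (hn 0) (hΩ 0).isOpen (hW 0)
      (fun I J => (hG I J).1) fun x hx => ?_
    have hx' : x ∈ closure (Ω 0) := subset_closure (hW 0 hx)
    refine ih (fun i => hn i.succ) (fun i => hΩ i.succ) (fun i => hW i.succ)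
      (F := fun y => F (Fin.cons x y)) (fun r c y hy i => ?_) (fun r c => ?_) (fun y hy => ?_)
    · have := hd r c (Fin.cons x y) (hmem hx' hy) i.succ
      simpa only [Fin.cons_update] using this
    · exact (hc r c).comp (f := fun y => (x, y)) (by fun_prop) fun y hy => ⟨hx', hy⟩
    · exact hM _ (hmem (s := fun i => numericalRange (A i)) hx hy)

end multivariate

theorem mainTheorem3 (d m p : ℕ) (n : Fin d → ℕ) (hn : ∀ i, 0 < n i)
    (A : (i : Fin d) → Matrix (Fin (n i)) (Fin (n i)) ℂ)
    (Ω : Fin d → Set ℂ) (γ : Fin d → ℝ → ℂ)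
    (hΩ : ∀ i, IsConvexDomainWithBoundary (Ω i) (γ i))
    (hW : ∀ i, numericalRange (A i) ⊆ Ω i)
    (F : (Fin d → ℂ) → Matrix (Fin m) (Fin p) ℂ)
    (hFan : ∀ r c, AnalyticOnNhd ℂ (fun x => F x r c) (Set.univ.pi Ω))
    (hFcont : ∀ r c, ContinuousOn (fun x => F x r c) (Set.univ.pi fun i => closure (Ω i))) :
    ∃ M : ℝ,
      IsGreatest ((fun x => ‖F x‖) '' (Set.univ.pi fun i => numericalRange (A i))) M ∧
      ‖multivariateMatrixFunction γ A F‖ ≤ (1 + √2) ^ d * M := by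
  have hcomp : IsCompact (Set.univ.pi fun i => numericalRange (A i)) :=
    isCompact_univ_pi fun i => numericalRange_isCompact (A i)
  have hne : (Set.univ.pi fun i => numericalRange (A i)).Nonempty :=
    Set.univ_pi_nonempty_iff.2 fun i => numericalRange_nonempty (A i) (hn i)
  have hcont : ContinuousOn (fun x => ‖F x‖) (Set.univ.pi fun i => numericalRange (A i)) := by
    have h1 : ContinuousOn F (Set.univ.pi fun i => closure (Ω i)) :=
      continuousOn_pi.2 fun r => continuousOn_pi.2 fun c => hFcont r c
    exact h1.norm.mono (Set.pi_mono fun i _ => (hW i).trans subset_closure)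
  obtain ⟨x, hx, hmax⟩ := hcomp.exists_isMaxOn hne hcont
  refine ⟨‖F x‖, ⟨Set.mem_image_of_mem _ hx, ?_⟩, ?_⟩
  · rintro _ ⟨y, hy, rfl⟩
    exact hmax hy
  · exact norm_multivariateMatrixFunction_le hn hΩ hW
      (fun r c y hy i => differentiableOn_update_of_analyticOnNhd (fun i => (hΩ i).isOpen)
        (fun i => (hΩ i).nonempty) (fun i => (hΩ i).convex) (hFan r c) (hFcont r c) hy i)
      hFcont fun y hy => hmax hy
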